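/- Let $k$ be an algebraically closed field. A variety over $k$ is an integral separated scheme of finite type over $k$. A smooth variety $X$ over $k$, of dimension $n$, is called uniformly rational if every point of $X$ has a Zariski open neighbourhood isomorphic over $k$ to an open subset of affine space $\mathbb{A}^n_k$. Proposition. Let $X$ be a uniformly rational variety over $k$ and let $Y \subsetneq X$ be a smooth closed subvariety (more generally, a closed subscheme $Y \neq X$ that is smooth over $k$, not necessarily irreducible or equidimensional). Then the blow-up $\mathrm{Bl}_Y(X)$ is again a uniformly rational variety over $k$. -/

import Mathlib

open CategoryTheory AlgebraicGeometry

universe u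

namespace BlowUp

section Rees

open Polynomial HomogeneousIdeal
open scoped DirectSum

variable {R S : Type u} [CommRing R] [CommRing S]

/-- The degree `n` part `Iⁿ tⁿ` of the Rees algebra `⨁ Iⁿ tⁿ ⊆ R[t]` of an ideal `I`. -/
def reesGrading (I : Ideal R) (n : ℕ) : Submodule R (reesAlgebra I) where
  carrier := {x | ∀ m, m ≠ n → (x : R[X]).coeff m = 0}
  add_mem' hx hy m hm := by simp [hx m hm, hy m hm]
  zero_mem' m _ := by simp
  smul_mem' r x hx m hm := by simp [hx m hm]

theorem mem_reesGrading {I : Ideal R} {n : ℕ} {x : reesAlgebra I} :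
    x ∈ reesGrading I n ↔ ∀ m, m ≠ n → (x : R[X]).coeff m = 0 := Iff.rfl

/-- The degree `n` component of an element of the Rees algebra. -/
noncomputable def reesComponent (I : Ideal R) (n : ℕ) (x : reesAlgebra I) : reesGrading I n :=
  ⟨⟨monomial n ((x : R[X]).coeff n), reesAlgebra.monomial_mem.mpr (x.2 n)⟩, fun m hm => by
    simp [coeff_monomial, hm.symm]⟩

instance reesGrading.gradedMonoid (I : Ideal R) : SetLike.GradedMonoid (reesGrading I) where
  one_mem m hm := by simp [coeff_one, hm]
  mul_mem i j x y hx hy m hm := by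
    rw [MulMemClass.coe_mul, coeff_mul]
    refine Finset.sum_eq_zero fun p hp => ?_
    rw [Finset.HasAntidiagonal.mem_antidiagonal] at hp
    by_cases h : p.1 = i
    · have : p.2 ≠ j := by omega
      rw [hy _ this, mul_zero]
    · rw [hx _ h, zero_mul]

theorem reesGrading.coeff_coe (I : Ideal R) (z : ⨁ n, reesGrading I n) (n : ℕ) :
    ((DirectSum.coeAddMonoidHom (reesGrading I) z : reesAlgebra I) : R[X]).coeff n =
      ((z n : reesAlgebra I) : R[X]).coeff n := by
  induction z using DirectSum.induction_on with
  | zero => simp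
  | of i x =>
    rw [DirectSum.coeAddMonoidHom_of]
    by_cases h : i = n
    · subst h; simp
    · rw [DirectSum.of_eq_of_ne _ _ _ (Ne.symm h), x.2 n (Ne.symm h)]; simp
  | add x y hx hy => simp [hx, hy]

noncomputable instance reesGrading.gradedAlgebra (I : Ideal R) : GradedAlgebra (reesGrading I) where
  decompose' x := ∑ n ∈ (x : R[X]).support, DirectSum.of _ n (reesComponent I n x)
  left_inv x := by
    rw [map_sum]
    simp only [DirectSum.coeAddMonoidHom_of]
    apply Subtype.ext
    rw [AddSubmonoidClass.coe_finsetSum]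
    exact (x : R[X]).as_sum_support.symm
  right_inv z := by
    set y := DirectSum.coeAddMonoidHom (reesGrading I) z with hy
    have h : DirectSum.coeAddMonoidHom (reesGrading I)
        (∑ n ∈ (y : R[X]).support, DirectSum.of _ n (reesComponent I n y)) = y := by
      rw [map_sum]
      simp only [DirectSum.coeAddMonoidHom_of]
      apply Subtype.ext
      rw [AddSubmonoidClass.coe_finsetSum]
      exact (y : R[X]).as_sum_support.symm
    refine DFinsupp.ext fun n => Subtype.ext (Subtype.ext (Polynomial.ext fun m => ?_))
    by_cases hm : m = n
    · subst hm
      have h2 := congrArg (fun w : reesAlgebra I => (w : R[X]).coeff m) (h.trans hy)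
      simp only [reesGrading.coeff_coe] at h2
      exact h2
    · exact (mem_reesGrading.mp (Subtype.prop _) m hm).trans (mem_reesGrading.mp (z n).2 m hm).symm

/-- A ring homomorphism `φ : R → S` with `φ(I) ⊆ J` induces a graded homomorphism of Rees
algebras. -/
noncomputable def reesMap (φ : R →+* S) (I : Ideal R) (J : Ideal S) (h : I.map φ ≤ J) :
    GradedRingHom (reesGrading I) (reesGrading J) where
  toRingHom := ((mapRingHom φ).comp (reesAlgebra I).val.toRingHom).codRestrict
    (reesAlgebra J).toSubring (fun x n => by
      have h1 : φ ((x : R[X]).coeff n) ∈ (I ^ n).map φ := Ideal.mem_map_of_mem φ (x.2 n)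
      rw [Ideal.map_pow] at h1
      simpa using Ideal.pow_right_mono h n h1)
  map_mem hx m hm := by
    have := hx m hm
    simp [RingHom.codRestrict, this]

@[simp] theorem coe_reesMap (φ : R →+* S) (I : Ideal R) (J : Ideal S) (h : I.map φ ≤ J)
    (x : reesAlgebra I) : ((reesMap φ I J h x : reesAlgebra J) : S[X]) = (x : R[X]).map φ := rfl

theorem reesMap_irrelevant (φ : R →+* S) (I : Ideal R) (J : Ideal S) (h : I.map φ = J) :
    irrelevant (reesGrading J) ≤ (irrelevant (reesGrading I)).map (reesMap φ I J h.le) := by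
  rw [← toIdeal_le_toIdeal_iff, toIdeal_map, toIdeal_irrelevant_le]
  intro n hn y hy
  have key : ∀ b (hb : b ∈ J ^ n), (⟨monomial n b, reesAlgebra.monomial_mem.mpr hb⟩ :
      reesAlgebra J) ∈ Ideal.map (reesMap φ I J h.le) (irrelevant (reesGrading I)).toIdeal := by
    intro b hb
    have hb' := hb
    rw [← h, ← Ideal.map_pow, Ideal.map] at hb'
    induction hb' using Submodule.span_induction with
    | mem x hx =>
      obtain ⟨a, ha, rfl⟩ := hx
      have h0 : (⟨monomial n a, reesAlgebra.monomial_mem.mpr ha⟩ : reesAlgebra I) ∈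
          (irrelevant (reesGrading I)).toIdeal := by
        refine (toIdeal_irrelevant_le _).mp le_rfl n hn ?_
        intro m hm
        simp [coeff_monomial, hm.symm]
      convert Ideal.mem_map_of_mem (reesMap φ I J h.le) h0
      simp
    | zero => convert Ideal.zero_mem _; simp
    | add x z hx hz hx' hz' =>
      have e1 : x ∈ J ^ n := by rw [← h, ← Ideal.map_pow]; exact hx
      have e2 : z ∈ J ^ n := by rw [← h, ← Ideal.map_pow]; exact hz
      convert Ideal.add_mem _ (hx' e1) (hz' e2)
      simp
    | smul c x hx hx' =>
      have e1 : x ∈ J ^ n := by rw [← h, ← Ideal.map_pow]; exact hx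
      convert Ideal.mul_mem_left _ (algebraMap S (reesAlgebra J) c) (hx' e1)
      simp [C_mul_monomial]
  have hy' : y = ⟨monomial n ((y : S[X]).coeff n), reesAlgebra.monomial_mem.mpr (y.2 n)⟩ := by
    apply Subtype.ext
    ext m
    by_cases hm : m = n
    · subst hm; simp
    · rw [hy m hm]; simp [coeff_monomial, Ne.symm hm]
  rw [hy']
  exact key _ (y.2 n)

end Rees

section Proj

open Limits HomogeneousIdeal HomogeneousLocalization

theorem isPullback_Spec_of_isLocalization {R S P Q : Type u} [CommRing R] [CommRing S] [CommRing P]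
    [CommRing Q] (φ : R →+* S) (a : R →+* P) (b : S →+* Q) (c : P →+* Q)
    (h : c.comp a = b.comp φ) (r : R) (h1 : letI := φ.toAlgebra; IsLocalization.Away r S)
    (h2 : letI := c.toAlgebra; IsLocalization.Away (a r) Q) :
    IsPullback (Spec.map (CommRingCat.ofHom c)) (Spec.map (CommRingCat.ofHom b))
      (Spec.map (CommRingCat.ofHom a)) (Spec.map (CommRingCat.ofHom φ)) := by
  let := φ.toAlgebra
  let := a.toAlgebra
  let := b.toAlgebra
  let := c.toAlgebra
  let := (c.comp a).toAlgebra
  have : IsScalarTower R P Q := .of_algebraMap_eq' rfl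
  have : IsScalarTower R S Q := .of_algebraMap_eq' h
  apply isPullback_SpecMap_of_isPushout
  suffices Algebra.IsPushout R S P Q from (CommRingCat.isPushout_iff_isPushout.mpr this).flip
  have key' : IsLocalization (Algebra.algebraMapSubmonoid P (.powers r)) Q := by
    rw [Algebra.algebraMapSubmonoid_powers]
    exact h2
  have := (Algebra.isLocalization_iff_isPushout (.powers r) S).mp key'
  first | exact this | exact this.symm

variable {A B R S : Type u} [CommRing A] [CommRing B] [CommRing R] [CommRing S]
  [Algebra R A] [Algebra S B]

/-- The structure morphism `Proj 𝒜 ⟶ Spec R` for a graded `R`-algebra. -/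
noncomputable def projToSpec (𝒜 : ℕ → Submodule R A) [GradedAlgebra 𝒜] :
    Proj 𝒜 ⟶ Spec (.of R) :=
  Proj.toSpecZero 𝒜 ≫ Spec.map (CommRingCat.ofHom (algebraMap R (𝒜 0)))

variable {𝒜 : ℕ → Submodule R A} [GradedAlgebra 𝒜] {ℬ : ℕ → Submodule S B} [GradedAlgebra ℬ]
  (g : GradedRingHom 𝒜 ℬ) (hg : irrelevant ℬ ≤ (irrelevant 𝒜).map g) (φ : R →+* S)

/-- The structure map `R → A₍ₛ₎` to the degree zero part of a localization. -/
noncomputable def awayStr (𝒜 : ℕ → Submodule R A) [GradedAlgebra 𝒜] (s : A) :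
    R →+* Away 𝒜 s :=
  (fromZeroRingHom 𝒜 (Submonoid.powers s)).comp (algebraMap R (𝒜 0))

theorem val_awayStr (s : A) (r : R) : (awayStr 𝒜 s r).val = algebraMap A _ (algebraMap R A r) := by
  rw [← Localization.mk_one_eq_algebraMap]
  rfl

theorem awayι_projToSpec (s : A) {d : ℕ} (hs : s ∈ 𝒜 d) (hd : 0 < d) :
    Proj.awayι 𝒜 s hs hd ≫ projToSpec 𝒜 = Spec.map (CommRingCat.ofHom (awayStr 𝒜 s)) := by
  rw [projToSpec, Proj.awayι_toSpecZero_assoc, ← Spec.map_comp, ← CommRingCat.ofHom_comp]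
  rfl

theorem awayMap_comp_awayStr (hφ : ∀ r : R, g (algebraMap R A r) = algebraMap S B (φ r))
    (s : A) :
    (Away.map g s).comp (awayStr 𝒜 s) = (awayStr ℬ (g s)).comp φ := by
  ext r
  rw [RingHom.comp_apply, RingHom.comp_apply, val_awayStr, ← hφ, ← Localization.mk_one_eq_algebraMap]
  have : awayStr 𝒜 s r = HomogeneousLocalization.mk ⟨0, algebraMap R (𝒜 0) r, 1, one_mem _⟩ := rfl
  rw [this, Away.map, map_mk, val_mk]
  congr 1
  ext
  exact map_one g

theorem projMap_projToSpec (hφ : ∀ r : R, g (algebraMap R A r) = algebraMap S B (φ r))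
    :
 Proj.map g hg ≫ projToSpec 𝒜 = projToSpec ℬ ≫ Spec.map (CommRingCat.ofHom φ) := by
  refine (Proj.mapAffineOpenCover g hg).openCover.hom_ext _ _ fun s ↦ ?_
  obtain ⟨i, s, hs⟩ := s
  have e1 := Proj.awayι_comp_map_assoc g hg i.pos s hs (projToSpec 𝒜)
  have e2 := congrArg (· ≫ Spec.map (CommRingCat.ofHom φ))
    (awayι_projToSpec (𝒜 := ℬ) (g s) (g.2 hs) i.pos)
  refine e1.trans (Eq.trans ?_ (e2.symm.trans (Category.assoc _ _ _)))
  rw [awayι_projToSpec, ← Spec.map_comp, ← CommRingCat.ofHom_comp,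
    awayMap_comp_awayStr g φ hφ, ← Spec.map_comp]
  rfl

theorem isLocalization_awayMap (hφ : ∀ r : R, g (algebraMap R A r) = algebraMap S B (φ r))
    (r : R)
    (h1 : ∀ n, ∀ y ∈ ℬ n, ∃ k : ℕ, ∃ x ∈ 𝒜 n, g x = algebraMap S B (φ r) ^ k * y)
    (h2 : ∀ x, g x = 0 → ∃ k : ℕ, algebraMap R A r ^ k * x = 0) (hr : IsUnit (φ r))
    (s : A) {d : ℕ} (hs : s ∈ 𝒜 d) :
    letI := (Away.map g s).toAlgebra
    IsLocalization.Away (awayStr 𝒜 s r) (Away ℬ (g s)) := by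
  let := (Away.map g s).toAlgebra
  have hcomm (r : R) : algebraMap (Away 𝒜 s) (Away ℬ (g s)) (awayStr 𝒜 s r) =
      awayStr ℬ (g s) (φ r) := congr($(awayMap_comp_awayStr g φ hφ s) r)
  refine IsLocalization.Away.mk (awayStr 𝒜 s r) ?_ ?_ ?_
  · rw [hcomm]; exact hr.map _
  · intro z
    obtain ⟨n, y, hy, rfl⟩ := Away.mk_surjective ℬ (g.2 hs) z
    obtain ⟨k, x, hx, hxy⟩ := h1 _ y hy
    refine ⟨k, Away.mk 𝒜 hs n x hx, ?_⟩
    rw [hcomm]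
    change _ = Away.map g s _
    rw [Away.map_mk]
    ext
    rw [val_mul, val_pow, val_awayStr, Away.val_mk, Away.val_mk, hxy, mul_comm, ← map_pow,
      ← Localization.mk_one_eq_algebraMap, Localization.mk_mul, one_mul]
    rfl
  · intro a b hab
    suffices H : ∀ c : Away 𝒜 s, Away.map g s c = 0 → ∃ k, awayStr 𝒜 s r ^ k * c = 0 by
      obtain ⟨k, hk⟩ := H (a - b) (by rw [map_sub]; exact sub_eq_zero.mpr hab)
      exact ⟨k, sub_eq_zero.mp (by rw [← mul_sub]; exact hk)⟩
    intro c hc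
    obtain ⟨n, x, hx, rfl⟩ := Away.mk_surjective 𝒜 hs c
    rw [Away.map_mk] at hc
    have hc' := congrArg val hc
    rw [Away.val_mk, val_zero, Localization.mk_eq_mk', IsLocalization.mk'_eq_zero_iff] at hc'
    obtain ⟨⟨_, m, rfl⟩, hm⟩ := hc'
    obtain ⟨k, hk⟩ := h2 (s ^ m * x) (by rw [map_mul, map_pow]; exact hm)
    refine ⟨k, ?_⟩
    ext
    rw [val_mul, val_pow, val_awayStr, Away.val_mk, val_zero, ← map_pow,
      ← Localization.mk_one_eq_algebraMap, Localization.mk_mul, Localization.mk_eq_mk',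
      IsLocalization.mk'_eq_zero_iff]
    exact ⟨⟨_, m, rfl⟩, by rw [← hk]; ring⟩

theorem isPullback_awayι (s : A) {d : ℕ} (hs : s ∈ 𝒜 d) (hd : 0 < d) :
    IsPullback (Spec.map (CommRingCat.ofHom (Away.map g s)))
      (Proj.awayι ℬ (g s) (g.2 hs) hd) (Proj.awayι 𝒜 s hs hd) (Proj.map g hg) := by
  refine IsOpenImmersion.isPullback _ _ _ _ (Proj.awayι_comp_map g hg hd s hs) ?_
  rw [Proj.opensRange_awayι, Proj.opensRange_awayι, Proj.map_preimage_basicOpen]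

theorem isPullback_awayMap (hφ : ∀ r : R, g (algebraMap R A r) = algebraMap S B (φ r))
    (r : R) (hloc : letI := φ.toAlgebra; IsLocalization.Away r S)
    (h1 : ∀ n, ∀ y ∈ ℬ n, ∃ k : ℕ, ∃ x ∈ 𝒜 n, g x = algebraMap S B (φ r) ^ k * y)
    (h2 : ∀ x, g x = 0 → ∃ k : ℕ, algebraMap R A r ^ k * x = 0)
    (s : A) {d : ℕ} (hs : s ∈ 𝒜 d) :
    IsPullback (Spec.map (CommRingCat.ofHom (Away.map g s)))
      (Spec.map (CommRingCat.ofHom (awayStr ℬ (g s))))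
      (Spec.map (CommRingCat.ofHom (awayStr 𝒜 s))) (Spec.map (CommRingCat.ofHom φ)) := by
  have hr : IsUnit (φ r) := by
    let := φ.toAlgebra
    exact IsLocalization.Away.algebraMap_isUnit (S := S) r
  exact isPullback_Spec_of_isLocalization φ _ _ _ (awayMap_comp_awayStr g φ hφ s) r hloc
    (isLocalization_awayMap g φ hφ r h1 h2 hr s hs)

theorem isPullback_projMap (hφ : ∀ r : R, g (algebraMap R A r) = algebraMap S B (φ r))
    (r : R) (hloc : letI := φ.toAlgebra; IsLocalization.Away r S)
    (h1 : ∀ n, ∀ y ∈ ℬ n, ∃ k : ℕ, ∃ x ∈ 𝒜 n, g x = algebraMap S B (φ r) ^ k * y)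
    (h2 : ∀ x, g x = 0 → ∃ k : ℕ, algebraMap R A r ^ k * x = 0) :
    IsPullback (Proj.map g hg) (projToSpec ℬ) (projToSpec 𝒜)
      (Spec.map (CommRingCat.ofHom φ)) := by
  refine Scheme.isPullback_of_openCover _ _ _ _ (Proj.affineOpenCover 𝒜).openCover fun s => ?_
  have e1 := (isPullback_awayι g hg (s.2 : A) s.2.2 s.1.2)
  have e2 := isPullback_awayMap g φ hφ r hloc h1 h2 (s.2 : A) s.2.2
  have e3 := (IsPullback.of_hasPullback (Proj.map g hg) (Proj.awayι 𝒜 (s.2 : A) s.2.2 s.1.2)).flip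
  refine IsPullback.of_iso e2 (e1.isoIsPullback _ _ e3) (Iso.refl _) (Iso.refl _) (Iso.refl _) ?_ ?_ ?_ ?_
  · exact (Category.comp_id _).trans (e1.isoIsPullback_hom_fst _ _ e3).symm
  · rw [Iso.refl_hom, Category.comp_id, ← awayι_projToSpec (𝒜 := ℬ) _ (g.2 s.2.2) s.1.2]
    exact (congrArg (· ≫ projToSpec ℬ) (e1.isoIsPullback_hom_snd _ _ e3).symm).trans
      (Category.assoc _ _ _)
  · exact (Category.comp_id _).trans ((awayι_projToSpec _ s.2.2 s.1.2).symm.trans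
      (Category.id_comp _).symm)
  · simp

end Proj

section ReesLocalization

open Polynomial

variable {R S : Type u} [CommRing R] [CommRing S] (φ : R →+* S) (r : R)
  (I : Ideal R) (J : Ideal S)
  (h : I.map φ = J)

theorem reesMap_localization_surj
    (hloc : letI := φ.toAlgebra; IsLocalization.Away r S) (n : ℕ) (y : reesAlgebra J) (hy : y ∈ reesGrading J n) :
    ∃ k : ℕ, ∃ x ∈ reesGrading I n,
      reesMap φ I J h.le x = algebraMap S (reesAlgebra J) (φ r) ^ k * y := by
  let := φ.toAlgebra
  have hb : (y : S[X]).coeff n ∈ (I ^ n).map (algebraMap R S) := by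
    have h' : J ^ n = (I ^ n).map φ := by rw [← h, ← Ideal.map_pow]
    exact h' ▸ y.2 n
  obtain ⟨⟨⟨a, ha⟩, ⟨_, k, rfl⟩⟩, hk⟩ :=
    (IsLocalization.mem_map_algebraMap_iff (.powers r) S).mp hb
  refine ⟨k, ⟨monomial n a, reesAlgebra.monomial_mem.mpr ha⟩, fun m hm => ?_, ?_⟩
  · simp [coeff_monomial, hm.symm]
  · apply Subtype.ext
    ext m
    have hk' : φ a = φ r ^ k * (y : S[X]).coeff n := by
      rw [mul_comm, ← map_pow]; exact hk.symm
    rw [coe_reesMap, map_monomial, hk', ← map_pow (algebraMap S _), MulMemClass.coe_mul,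
      Subalgebra.coe_algebraMap, Polynomial.algebraMap_apply, coeff_C_mul, coeff_monomial]
    split_ifs with hm
    · subst hm; rfl
    · rw [hy m (Ne.symm hm), mul_zero]

theorem reesMap_localization_inj
    (hloc : letI := φ.toAlgebra; IsLocalization.Away r S) (x : reesAlgebra I) (hx : reesMap φ I J h.le x = 0) :
    ∃ k : ℕ, algebraMap R (reesAlgebra I) r ^ k * x = 0 := by
  let := φ.toAlgebra
  have hx' : (x : R[X]).map φ = 0 := congrArg (fun y : reesAlgebra J => (y : S[X])) hx
  have key : ∀ s : Finset ℕ, ∃ k : ℕ, ∀ n ∈ s, r ^ k * (x : R[X]).coeff n = 0 := by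
    intro s
    induction s using Finset.induction_on with
    | empty => exact ⟨0, by simp⟩
    | insert n s hn ih =>
      obtain ⟨k, hk⟩ := ih
      have h0 : algebraMap R S ((x : R[X]).coeff n) = 0 := by
        have := congrArg (fun p => coeff p n) hx'
        rw [coeff_map, coeff_zero] at this
        exact this
      obtain ⟨⟨_, l, rfl⟩, hl⟩ := (IsLocalization.map_eq_zero_iff (.powers r) S _).mp h0
      refine ⟨k + l, fun m hm => ?_⟩
      rcases Finset.mem_insert.mp hm with rfl | hm
      · rw [pow_add, mul_assoc]
        exact (congrArg _ hl).trans (mul_zero _)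
      · rw [pow_add, mul_comm (r ^ k), mul_assoc, hk m hm, mul_zero]
  obtain ⟨k, hk⟩ := key (x : R[X]).support
  refine ⟨k, Subtype.ext (Polynomial.ext fun n => ?_)⟩
  rw [← map_pow, MulMemClass.coe_mul, Subalgebra.coe_algebraMap, Polynomial.algebraMap_apply,
    coeff_C_mul]
  by_cases hn : n ∈ (x : R[X]).support
  · simpa using hk n hn
  · rw [notMem_support_iff.mp hn]; simp

theorem reesMap_algebraMap (a : R) : reesMap φ I J h.le (algebraMap R (reesAlgebra I) a) =
    algebraMap S (reesAlgebra J) (φ a) := by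
  apply Subtype.ext
  rw [coe_reesMap, Subalgebra.coe_algebraMap, Subalgebra.coe_algebraMap,
    Polynomial.algebraMap_apply, Polynomial.algebraMap_apply, map_C]
  rfl

theorem projMap_reesMap_id (χ : R →+* R) (hχ : χ = RingHom.id R) (I : Ideal R)
    (h : I.map χ = I) :
    Proj.map (reesMap χ I I h.le) (reesMap_irrelevant χ I I h) = 𝟙 _ := by
  have key : ∀ (g : GradedRingHom (reesGrading I) (reesGrading I)) (hg), g = .id _ →
      Proj.map g hg = 𝟙 _ := by
    rintro g hg rfl
    exact Proj.map_id
  refine key _ _ (GradedRingHom.ext fun x => Subtype.ext ?_)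
  subst hχ
  rw [coe_reesMap, Polynomial.map_id]
  rfl

theorem projMap_reesMap_comp {T : Type u} [CommRing T] (ψ : S →+* T) (χ : R →+* T)
    (hχ : χ = ψ.comp φ) (I : Ideal R) (J : Ideal S) (K : Ideal T) (h1 : I.map φ = J)
    (h2 : J.map ψ = K) (h3 : I.map χ = K) :
    Proj.map (reesMap χ I K h3.le) (reesMap_irrelevant χ I K h3) =
      Proj.map (reesMap ψ J K h2.le) (reesMap_irrelevant ψ J K h2) ≫
        Proj.map (reesMap φ I J h1.le) (reesMap_irrelevant φ I J h1) := by
  rw [← Proj.map_comp]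
  have key : ∀ (g g' : GradedRingHom (reesGrading I) (reesGrading K)) (hg hg'), g = g' →
      Proj.map g hg = Proj.map g' hg' := by
    rintro g _ hg hg' rfl
    rfl
  refine key _ _ _ _ (GradedRingHom.ext fun x => Subtype.ext ?_)
  subst hχ
  change _ = ((reesMap ψ J K h2.le (reesMap φ I J h1.le x) : reesAlgebra K) : T[X])
  rw [coe_reesMap, coe_reesMap, coe_reesMap, Polynomial.map_map]

end ReesLocalization

end BlowUp

namespace AlgebraicGeometry.Scheme.IdealSheafData

open AffineZariskiSite BlowUp

variable {X : Scheme.{u}} (I : X.IdealSheafData)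

/-- The ideal of `I` over an affine open. -/
abbrev zariskiIdeal (U : X.AffineZariskiSite) : Ideal Γ(X, U.toOpens) := I.ideal ⟨U.1, U.2⟩

/-- Restriction of functions from an affine open to a smaller one. -/
abbrev zariskiRes {U V : X.AffineZariskiSite} (h : U ⟶ V) :
    Γ(X, V.toOpens) →+* Γ(X, U.toOpens) :=
  (X.presheaf.map ((toOpensFunctor X).map h).op).hom

theorem map_zariskiIdeal {U V : X.AffineZariskiSite} (h : U ⟶ V) :
    (I.zariskiIdeal V).map (zariskiRes h) = I.zariskiIdeal U :=
  I.map_ideal' (U := ⟨U.1, U.2⟩) (V := ⟨V.1, V.2⟩) _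

/-- The diagram `U ↦ Proj (⨁ I(U)ⁿ)`, where `U` runs over the affine opens of `X`. -/
noncomputable def blowupDiagram : X.AffineZariskiSite ⥤ Scheme.{u} where
  obj U := Proj (reesGrading (I.zariskiIdeal U))
  map {U V} h := Proj.map (reesMap (zariskiRes h) _ _ (I.map_zariskiIdeal h).le)
    (reesMap_irrelevant (zariskiRes h) _ _ (I.map_zariskiIdeal h))
  map_id U := projMap_reesMap_id _ (by
    rw [zariskiRes, CategoryTheory.Functor.map_id, op_id, CategoryTheory.Functor.map_id]
    rfl) _ (I.map_zariskiIdeal (𝟙 U))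
  map_comp {U V W} f g := projMap_reesMap_comp (zariskiRes g) (zariskiRes f) _ (by
    rw [zariskiRes, Functor.map_comp, op_comp, Functor.map_comp]
    rfl) _ _ _ (I.map_zariskiIdeal g) (I.map_zariskiIdeal f) (I.map_zariskiIdeal (f ≫ g))

/-- The structure maps `Proj (⨁ I(U)ⁿ) ⟶ Spec Γ(X, U)`. -/
noncomputable def blowupDiagramToSpec :
    I.blowupDiagram ⟶ toOpensFunctor X ⋙ X.presheaf.rightOp ⋙ Scheme.Spec where
  app U := projToSpec (reesGrading (I.zariskiIdeal U))
  naturality _ _ h := projMap_projToSpec _ _ _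
    (reesMap_algebraMap (zariskiRes h) _ _ (I.map_zariskiIdeal h))

theorem blowupDiagramToSpec_equifibered : I.blowupDiagramToSpec.Equifibered := by
  intro U V h
  obtain ⟨f, hf⟩ := h.le
  have hloc := V.2.isLocalization_of_eq_basicOpen f ((toOpensFunctor X).map h) hf.symm
  exact isPullback_projMap _ _ _ (reesMap_algebraMap (zariskiRes h) _ _ (I.map_zariskiIdeal h))
    f hloc (reesMap_localization_surj _ f _ _ (I.map_zariskiIdeal h) hloc)
    (reesMap_localization_inj _ f _ _ (I.map_zariskiIdeal h) hloc)

/-- The structure maps `Proj (⨁ I(U)ⁿ) ⟶ U`. -/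
noncomputable def blowupDiagramMap :
    I.blowupDiagram ⟶ toOpensFunctor X ⋙ X.restrictFunctor ⋙ Over.forget _ :=
  I.blowupDiagramToSpec ≫ (restrictIsoSpec X).inv

theorem blowupDiagramMap_equifibered : I.blowupDiagramMap.Equifibered :=
  I.blowupDiagramToSpec_equifibered.comp (.of_isIso _)

/-- The gluing data consisting of the schemes `Proj (⨁ I(U)ⁿ)` over the affine opens `U` of `X`. -/
noncomputable def blowupGlueData : (directedCover X).RelativeGluingData where
  functor := I.blowupDiagram
  natTrans := I.blowupDiagramMap
  equifibered := I.blowupDiagramMap_equifibered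

/-- The blow-up of `X` in the closed subscheme with ideal sheaf `I`: the relative `Proj` over `X` of
the Rees algebra `⨁ Iⁿ`, i.e. the gluing of the schemes `Proj (⨁ I(U)ⁿ)` over all affine opens
`U` of `X`. -/
noncomputable def blowup : Scheme.{u} := I.blowupGlueData.glued

/-- The blow-down morphism from the blow-up to `X`. -/
noncomputable def blowupMap : I.blowup ⟶ X := I.blowupGlueData.toBase

end AlgebraicGeometry.Scheme.IdealSheafData

namespace AlgebraicGeometry

variable {k : Type u} [Field k] {X : Scheme.{u}}

/-- A variety over `k`: an integral, separated scheme of finite type over `k`. -/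
structure IsVariety (s : X ⟶ Spec (.of k)) : Prop where
  isIntegral : IsIntegral X
  isSeparated : IsSeparated s
  locallyOfFiniteType : LocallyOfFiniteType s
  quasiCompact : QuasiCompact s

/-- A uniformly rational variety over `k`: a smooth variety for which there is `n` such that every
point has a Zariski open neighbourhood which is isomorphic, over `k`, to an open subscheme of `𝔸ⁿ`.
Here `n` is necessarily the dimension, and rationality is automatic, since a variety is irreducible
and non-empty. -/
structure IsUniformlyRational (s : X ⟶ Spec (.of k)) : Prop extends IsVariety s where
  smooth : Smooth s
  exists_nhd : ∃ n : ℕ, ∀ x : X, ∃ U : X.Opens, x ∈ U ∧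
    ∃ j : U.toScheme ⟶ 𝔸(ULift.{u} (Fin n); Spec (.of k)),
      IsOpenImmersion j ∧ j ≫ (𝔸(ULift.{u} (Fin n); Spec (.of k)) ↘ Spec (.of k)) = U.ι ≫ s

end AlgebraicGeometry

/-! Uniform rationality of the blow-up is checked near the points over a closed point of $X$. Let
`O` be the local ring of $X$ there, which is a local ring of affine `n`-space, and let `J` be the
ideal of $Y$ in `O`. Everything rests on coordinates `x`, `t` of `O` with `J = (g(x), t)`: near the
point, $Y$ is a hypersurface `g = 0` inside the subspace `t = 0`. Such coordinates exist because a
germ with cotangent space of dimension `m` stays embedded under generic linear projections until `m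
+ 1` coordinates are left (`exists_projection`). On $Y$ a coordinate forgotten by the projection is
a quotient of polynomials in the remaining ones, and the equation saying so replaces it as a
coordinate `t` (`exists_coordinates_mem`, `exists_coordinates_span_eq`).

Now blow up `(g(x), t)`. In the chart where `g(x)` generates the exceptional ideal, the functions
`x` and `t_j / g(x)` are coordinates, since `t_j = g(x) · (t_j / g(x))`. There are `n` of them, so
this chart is open in affine space (`exists_isOpenImmersion_away`). A point over the centre which
misses it lies in the chart of some `t_j`. Smoothness of $Y$ gives `∂g/∂x_i ≠ 0` at the centre for
some `i`; replacing `x_i` by `x_i + t_j` keeps the ideal and changes `g(x)` by `t_j` times a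
function which does not vanish at the point. The chart of the new generator contains the point
(`exists_chart`).

Being coordinates is expressed by `fracAdjoin k (Set.range y) = ⊤`. For a local ring and a finite
family this is an embedding of the germ in affine space; for a finitely generated domain with `n`
algebraically independent elements, `n` such functions give an open immersion
(`isOpenImmersion_aeval_of_fracAdjoin_eq_top`). Charts at closed points suffice, and the blow-down
map, being proper, sends closed points to closed points. Smoothness of the blow-up is read off from
the charts. -/

section FracAdjoin

/-! ### Subalgebras generated up to inverses of units -/

variable (k : Type*) {R S : Type*} [CommRing k] [CommRing R] [CommRing S] [Algebra k R]
  [Algebra k S]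

/-- The subalgebra of all quotients `p / q` in `R`, where `p` and `q` lie in the subalgebra
generated by `s` and `q` is a unit of `R`. -/
def fracAdjoin (s : Set R) : Subalgebra k R where
  carrier := {r | ∃ p ∈ Algebra.adjoin k s, ∃ q ∈ Algebra.adjoin k s, IsUnit q ∧ r * q = p}
  mul_mem' := by
    rintro a b ⟨p, hp, q, hq, hu, h⟩ ⟨p', hp', q', hq', hu', h'⟩
    exact ⟨p * p', mul_mem hp hp', q * q', mul_mem hq hq', hu.mul hu', by rw [← h, ← h']; ring⟩
  add_mem' := by
    rintro a b ⟨p, hp, q, hq, hu, h⟩ ⟨p', hp', q', hq', hu', h'⟩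
    exact ⟨p * q' + p' * q, add_mem (mul_mem hp hq') (mul_mem hp' hq), q * q', mul_mem hq hq',
      hu.mul hu', by rw [← h, ← h']; ring⟩
  algebraMap_mem' c := ⟨_, Subalgebra.algebraMap_mem _ c, 1, one_mem _, isUnit_one, mul_one _⟩

variable {k}

theorem adjoin_le_fracAdjoin (s : Set R) : Algebra.adjoin k s ≤ fracAdjoin k s :=
  fun p hp => ⟨p, hp, 1, one_mem _, isUnit_one, mul_one _⟩

theorem subset_fracAdjoin (s : Set R) : s ⊆ fracAdjoin k s :=
  Algebra.subset_adjoin.trans (adjoin_le_fracAdjoin s)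

theorem mem_fracAdjoin_of_mul_eq_one {s : Set R} {a b : R} (ha : a ∈ fracAdjoin k s)
    (h : a * b = 1) : b ∈ fracAdjoin k s := by
  obtain ⟨p, hp, q, hq, hu, e⟩ := ha
  refine ⟨q, hq, p, hp, ?_, ?_⟩
  · rw [← e]; exact (IsUnit.of_mul_eq_one _ h).mul hu
  · rw [← e, ← mul_assoc, mul_comm b a, h, one_mul]

theorem mem_fracAdjoin_of_mul_mem {s : Set R} {a b : R} (hb : b ∈ fracAdjoin k s)
    (hu : IsUnit b) (h : a * b ∈ fracAdjoin k s) : a ∈ fracAdjoin k s := by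
  obtain ⟨c, hc⟩ := hu.exists_right_inv
  have := mul_mem h (mem_fracAdjoin_of_mul_eq_one hb hc)
  rwa [mul_assoc, hc, mul_one] at this

/-- With `mem_fracAdjoin_of_mul_eq_one` this characterises `fracAdjoin k s` as the least subalgebra
that contains `s` and the inverses of those of its elements that are units of `R`. -/
theorem fracAdjoin_le {s : Set R} {T : Subalgebra k R} (hs : s ⊆ T)
    (hT : ∀ a ∈ T, ∀ b, a * b = 1 → b ∈ T) : fracAdjoin k s ≤ T := by
  rintro r ⟨p, hp, q, hq, hu, e⟩
  have h := Algebra.adjoin_le hs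
  obtain ⟨c, hc⟩ := hu.exists_right_inv
  have := mul_mem (h hp) (hT _ (h hq) _ hc)
  rwa [← e, mul_assoc, hc, mul_one] at this

theorem fracAdjoin_le_fracAdjoin {s t : Set R} (h : s ⊆ fracAdjoin k t) :
    fracAdjoin k s ≤ fracAdjoin k t :=
  fracAdjoin_le h fun _ ha _ hb => mem_fracAdjoin_of_mul_eq_one ha hb

theorem fracAdjoin_eq_top_of_subset {s t : Set R} (hs : fracAdjoin k s = ⊤)
    (h : s ⊆ fracAdjoin k t) : fracAdjoin k t = ⊤ :=
  top_le_iff.mp (hs ▸ fracAdjoin_le_fracAdjoin h)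

theorem map_mem_fracAdjoin (f : R →ₐ[k] S) {s : Set R} {t : Set S}
    (h : ∀ a ∈ s, f a ∈ fracAdjoin k t) {r : R} (hr : r ∈ fracAdjoin k s) :
    f r ∈ fracAdjoin k t := by
  have : fracAdjoin k s ≤ (fracAdjoin k t).comap f :=
    fracAdjoin_le h fun a ha b hab =>
      mem_fracAdjoin_of_mul_eq_one (a := f a) ha ((map_mul f a b).symm.trans (by rw [hab, map_one]))
  exact this hr

theorem fracAdjoin_eq_top_of_surjective (f : R →ₐ[k] S) (hf : Function.Surjective f) {s : Set R}
    {t : Set S} (hs : fracAdjoin k s = ⊤) (h : ∀ a ∈ s, f a ∈ fracAdjoin k t) :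
    fracAdjoin k t = ⊤ := by
  refine top_le_iff.mp fun b _ => ?_
  obtain ⟨a, rfl⟩ := hf b
  exact map_mem_fracAdjoin f h (hs ▸ Algebra.mem_top)

theorem exists_aeval_of_mem_fracAdjoin {ι : Type*} {y : ι → R} {r : R}
    (hr : r ∈ fracAdjoin k (Set.range y)) : ∃ p q : MvPolynomial ι k,
      IsUnit (MvPolynomial.aeval y q) ∧ r * MvPolynomial.aeval y q = MvPolynomial.aeval y p := by
  obtain ⟨p, hp, q, hq, hu, e⟩ := hr
  rw [Algebra.adjoin_range_eq_range_aeval] at hp hq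
  obtain ⟨p, rfl⟩ := hp
  obtain ⟨q, rfl⟩ := hq
  exact ⟨p, q, hu, e⟩

theorem aeval_mem_fracAdjoin {ι : Type*} (y : ι → R) (p : MvPolynomial ι k) :
    MvPolynomial.aeval y p ∈ fracAdjoin k (Set.range y) := by
  refine adjoin_le_fracAdjoin _ ?_
  rw [Algebra.adjoin_range_eq_range_aeval]
  exact ⟨p, rfl⟩

theorem essFiniteType_of_fracAdjoin {ι : Type*} [Finite ι] {y : ι → R}
    (h : fracAdjoin k (Set.range y) = ⊤) : Algebra.EssFiniteType k R := by
  classical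
  have := Fintype.ofFinite ι
  refine ⟨Finset.univ.image y, ?_⟩
  rw [Finset.coe_image, Finset.coe_univ, Set.image_univ]
  refine ⟨fun q => q.2, fun r => ?_, fun {a b} hab => ⟨1, by rw [Subtype.ext hab]⟩⟩
  obtain ⟨p, hp, q, hq, hu, e⟩ : r ∈ fracAdjoin k (Set.range y) := h ▸ Algebra.mem_top
  exact ⟨(⟨p, hp⟩, ⟨⟨q, hq⟩, hu⟩), e⟩

end FracAdjoin

/-! ### Transcendence degree and homogeneous relations -/

section TranscendenceDegree

open scoped IntermediateField.algebraAdjoinAdjoin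
open MvPolynomial IsLocalRing

/-- If the differential module of `K` over `k` is spanned by the differentials of a finite set
`s` (expressed by saying that derivations vanish when they vanish on `s`), then
the transcendence degree is at most the cardinality of `s`. -/
theorem card_le_of_algebraicIndependent_of_derivation {k K : Type u} [Field k] [Field K]
    [Algebra k K] [Algebra.EssFiniteType k K] (s : Finset K)
    (hs : ∀ (V : Type u) [AddCommGroup V] [Module k V] [Module K V] [IsScalarTower k K V]
      (D : Derivation k K V), (∀ x ∈ s, D x = 0) → D = 0) {a : ℕ} (x : Fin a → K)
    (hx : AlgebraicIndependent k x) : a ≤ s.card := by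
  let F := IntermediateField.adjoin k (s : Set K)
  have : Algebra.EssFiniteType F K := Algebra.EssFiniteType.of_comp k F K
  -- The universal derivation over `F = k(s)` kills `s`, so the hypothesis forces `Ω[K⁄F] = 0`.
  have hD : (KaehlerDifferential.D F K).restrictScalars k = 0 := by
    refine hs _ _ fun y hy => ?_
    exact (KaehlerDifferential.D F K).map_algebraMap
      ⟨y, IntermediateField.subset_adjoin k _ hy⟩
  have : Algebra.FormallyUnramified F K := by
    rw [Algebra.formallyUnramified_iff]
    refine ⟨fun m₁ m₂ => ?_⟩
    have h : (⊤ : Submodule K (Ω[K⁄F])) = ⊥ := by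
      rw [← KaehlerDifferential.span_range_derivation, Submodule.span_eq_bot]
      rintro _ ⟨y, rfl⟩
      exact congrArg (fun d => d y) hD
    have hz : ∀ m : Ω[K⁄F], m = 0 := fun m => by
      have : m ∈ (⊤ : Submodule K (Ω[K⁄F])) := trivial
      rw [h] at this
      exact this
    rw [hz m₁, hz m₂]
  -- An unramified, essentially finitely generated field extension is separable algebraic; this
  -- needs no assumption on the characteristic.
  have : Algebra.IsSeparable F K := Algebra.FormallyUnramified.isSeparable F K
  have : Algebra.IsAlgebraic (Algebra.adjoin k (s : Set K)) K :=
    (IsFractionRing.comap_isAlgebraic_iff (K := F)).mpr inferInstance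
  have h1 := hx.lift_cardinalMk_le_trdeg
  have h2 := Algebra.IsAlgebraic.trdeg_le_cardinalMk k (s : Set K)
  simpa using h1.trans (Cardinal.lift_le.mpr h2)

variable {k C : Type u} [Field k] [CommRing C] [IsLocalRing C] [Algebra k C]

/-- The span `N` of the `D (x i)` is finitely generated and, by the quotient rule, contains all
values of `D`. As the maximal ideal is generated by `w` modulo its square, Leibniz' rule shows that
`D` maps it into `maximalIdeal C • N`. Each `x i` lies in the maximal ideal up to a constant, so `N
≤ maximalIdeal C • N`, and Nakayama's lemma gives `N = ⊥`. -/
theorem Derivation.eq_zero_of_isLocalRing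
    (hk : ∀ c : C, ∃ r : k, c - algebraMap k C r ∈ maximalIdeal C) {a m : ℕ} {x : Fin a → C}
    (hx : fracAdjoin k (Set.range x) = ⊤) {w : Fin m → C} (hw : ∀ i, w i ∈ maximalIdeal C)
    (hM : maximalIdeal C ≤ Ideal.span (Set.range w) ⊔ maximalIdeal C ^ 2)
    {V : Type*} [AddCommGroup V] [Module k V] [Module C V]
    (D : Derivation k C V) (hD : ∀ i, D (w i) = 0) : D = 0 := by
  let N : Submodule C V := Submodule.span C (Set.range fun i => D (x i))
  let T : Subalgebra k C :=
    { carrier := {c | D c ∈ N}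
      mul_mem' := fun {a b} ha hb => by
        rw [Set.mem_ofPred_eq, D.leibniz]
        exact add_mem (N.smul_mem _ hb) (N.smul_mem _ ha)
      add_mem' := fun {a b} ha hb => by
        rw [Set.mem_ofPred_eq, map_add]
        exact add_mem ha hb
      algebraMap_mem' := fun r => by
        rw [Set.mem_ofPred_eq, D.map_algebraMap]
        exact zero_mem _ }
  have hN : ∀ c, D c ∈ N := by
    have : fracAdjoin k (Set.range x) ≤ T := by
      refine fracAdjoin_le ?_ fun a ha b hab => ?_
      · rintro _ ⟨i, rfl⟩
        exact Submodule.subset_span ⟨i, rfl⟩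
      · change D b ∈ N
        rw [D.leibniz_of_mul_eq_one (by rwa [mul_comm])]
        exact N.smul_mem _ ha
    intro c
    exact this (hx ▸ Algebra.mem_top)
  have hM' : ∀ c ∈ maximalIdeal C, D c ∈ maximalIdeal C • N := by
    intro c hc
    obtain ⟨c1, h1, c2, h2, rfl⟩ := Submodule.mem_sup.mp (hM hc)
    rw [map_add]
    refine add_mem ?_ ?_
    · clear hc
      induction h1 using Submodule.span_induction with
      | mem y hy =>
        obtain ⟨i, rfl⟩ := hy
        rw [hD]
        exact zero_mem _
      | zero => rw [map_zero]; exact zero_mem _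
      | add y z hy hz hy' hz' => rw [map_add]; exact add_mem hy' hz'
      | smul r y hy hy' =>
        rw [smul_eq_mul, D.leibniz]
        refine add_mem (Submodule.smul_mem _ _ hy') (Submodule.smul_mem_smul ?_ (hN _))
        exact (Ideal.span_le.mpr (by rintro _ ⟨i, rfl⟩; exact hw i)) hy
    · rw [pow_two] at h2
      clear hc
      induction h2 using Submodule.mul_induction_on' with
      | mem_mul_mem a ha b hb =>
        rw [D.leibniz]
        exact add_mem (Submodule.smul_mem_smul ha (hN _)) (Submodule.smul_mem_smul hb (hN _))
      | add y hy z hz hy' hz' => rw [map_add]; exact add_mem hy' hz'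
  have hbot : N = ⊥ := by
    refine Submodule.eq_bot_of_le_smul_of_le_jacobson_bot (maximalIdeal C) N
      (Submodule.fg_span (Set.finite_range _)) ?_ (maximalIdeal_le_jacobson _)
    refine Submodule.span_le.mpr ?_
    rintro _ ⟨i, rfl⟩
    obtain ⟨r, hr⟩ := hk (x i)
    have := hM' _ hr
    rwa [map_sub, D.map_algebraMap, sub_zero] at this
  ext c
  have := hN c
  rwa [hbot] at this

theorem aeval_mul_of_isHomogeneous {σ k A : Type*} [CommSemiring k] [CommRing A]
    [Algebra k A] {d : ℕ} {f : MvPolynomial σ k} (hf : f.IsHomogeneous d) (r : A) (y : σ → A) :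
    aeval (fun i => r * y i) f = r ^ d * aeval y f := by
  simp only [aeval_def, eval₂_eq, Finset.mul_sum]
  refine Finset.sum_congr rfl fun α hα => ?_
  have hd : ∑ i ∈ α.support, α i = d := by
    rw [← hf (mem_support_iff.mp hα), Finsupp.weight_apply, Finsupp.sum]
    simp
  simp only [mul_pow, Finset.prod_mul_distrib, Finset.prod_pow_eq_pow_sum, hd]
  ring

/-- If the maximal ideal of the local `k`-algebra `C` is generated by `m` elements, then any `m + 2`
elements satisfy a non-trivial homogeneous equation. -/
theorem exists_isHomogeneous_aeval_eq_zero
    (hk : ∀ c : C, ∃ r : k, c - algebraMap k C r ∈ maximalIdeal C) {a m : ℕ} {x : Fin a → C}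
    (hx : fracAdjoin k (Set.range x) = ⊤) {w : Fin m → C} (hw : ∀ i, w i ∈ maximalIdeal C)
    (hM : maximalIdeal C ≤ Ideal.span (Set.range w) ⊔ maximalIdeal C ^ 2) (ham : m + 2 ≤ a) :
    ∃ (d : ℕ) (f : MvPolynomial (Fin a) k), f ≠ 0 ∧ f.IsHomogeneous d ∧ aeval x f = 0 := by
  by_contra! hno
  -- Substituting `x i * T` separates the homogeneous components by powers of `T`; without
  -- homogeneous relations `ψ` is therefore injective.
  let ψ : MvPolynomial (Fin a) k →ₐ[k] Polynomial C :=
    aeval fun i => Polynomial.C (x i) * Polynomial.X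
  have hψ : ∀ (d : ℕ) (f : MvPolynomial (Fin a) k), f.IsHomogeneous d →
      ψ f = Polynomial.C (aeval x f) * Polynomial.X ^ d := by
    intro d f hf
    have h1 : aeval (fun i => Polynomial.C (x i)) f = Polynomial.C (aeval x f) := by
      simp only [← Polynomial.algebraMap_eq]
      exact aeval_algebraMap_apply (Polynomial C) x f
    have h2 : (fun i => Polynomial.C (x i) * (Polynomial.X : Polynomial C)) =
      fun i => Polynomial.X * Polynomial.C (x i) := funext fun i => mul_comm _ _
    rw [mul_comm, ← h1, ← aeval_mul_of_isHomogeneous hf, ← h2]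
  have hinj : ∀ f, f ≠ 0 → ψ f ≠ 0 := by
    intro f hf h0
    refine hf ?_
    rw [← f.sum_homogeneousComponent]
    refine Finset.sum_eq_zero fun d hd => ?_
    by_contra hne
    refine hno d _ hne (homogeneousComponent_isHomogeneous d f) ?_
    have h1 := congrArg (fun p => Polynomial.coeff p d) h0
    simp only [Polynomial.coeff_zero] at h1
    rw [← f.sum_homogeneousComponent, map_sum, Polynomial.finsetSum_coeff,
      Finset.sum_eq_single_of_mem d hd, hψ d _ (homogeneousComponent_isHomogeneous d f)] at h1
    · rwa [Polynomial.coeff_C_mul_X_pow, if_pos rfl] at h1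
    · intro e _ he
      rw [hψ e _ (homogeneousComponent_isHomogeneous e f), Polynomial.coeff_C_mul_X_pow,
        if_neg he.symm]
  -- `C` need not be a domain. A prime `Q` that avoids the images of the non-zero polynomials yields
  -- a field `K` in which the `x i * T` remain algebraically independent.
  let S : Submonoid (Polynomial C) := (nonZeroDivisors (MvPolynomial (Fin a) k)).map ψ
  have hS : Disjoint ((⊥ : Ideal (Polynomial C)) : Set (Polynomial C)) S := by
    rw [Set.disjoint_left]
    rintro p hp ⟨f, hf, rfl⟩
    exact hinj f (nonZeroDivisors.ne_zero hf) hp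
  obtain ⟨Q, hQ, -, hQS⟩ := Ideal.exists_le_prime_disjoint _ S hS
  let K := FractionRing (Polynomial C ⧸ Q)
  let φ : Polynomial C →ₐ[k] K :=
    (IsScalarTower.toAlgHom k (Polynomial C ⧸ Q) K).comp (Ideal.Quotient.mkₐ k Q)
  have hφ0 : ∀ p, φ p = 0 → p ∈ Q := fun p hp => by
    have : algebraMap (Polynomial C ⧸ Q) K (Ideal.Quotient.mk Q p) = 0 := hp
    rwa [IsFractionRing.to_map_eq_zero_iff, Ideal.Quotient.eq_zero_iff_mem] at this
  have hφ : AlgebraicIndependent k fun i => φ (ψ (X i)) := by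
    have : aeval (fun i => φ (ψ (X i))) = φ.comp ψ := algHom_ext fun i => by simp
    rw [AlgebraicIndependent, this, injective_iff_map_eq_zero]
    intro f hf
    by_contra hne
    exact Set.disjoint_left.mp hQS (hφ0 _ hf)
      ⟨f, mem_nonZeroDivisors_of_ne_zero hne, rfl⟩
  have hC : Algebra.EssFiniteType k C := essFiniteType_of_fracAdjoin hx
  have hK : Algebra.EssFiniteType k K := by
    have : Algebra.EssFiniteType k (Polynomial C) := .comp k C _
    have : Algebra.EssFiniteType k (Polynomial C ⧸ Q) :=
      .of_surjective (Ideal.Quotient.mkₐ k Q) (Ideal.Quotient.mkₐ_surjective k Q)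
    exact .comp k (Polynomial C ⧸ Q) K
  classical
  -- Derivations of `K` are determined on `T` and the `m` elements `w i`, which bounds the
  -- transcendence degree by `m + 1` and contradicts `m + 2 ≤ a`.
  have := card_le_of_algebraicIndependent_of_derivation (k := k) (K := K)
    (insert (φ Polynomial.X) (Finset.univ.image fun i => φ (Polynomial.C (w i)))) ?_ _ hφ
  · have h2 := Finset.card_insert_le (φ Polynomial.X)
      (Finset.univ.image fun i => φ (Polynomial.C (w i)))
    have h3 := Finset.card_image_le (s := Finset.univ) (f := fun i => φ (Polynomial.C (w i)))
    rw [Finset.card_univ, Fintype.card_fin] at h3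
    omega
  · intro V _ _ _ _ D hD
    -- With `V` viewed as a `C`-module, `D` restricts to a derivation of `C` that kills every `w i`.
    let : Module C V := Module.compHom V (φ.toRingHom.comp Polynomial.C)
    let D' : Derivation k C V :=
      { toLinearMap := D.toLinearMap ∘ₗ (φ.comp Polynomial.CAlgHom).toLinearMap
        map_one_eq_zero' := by simp
        leibniz' := fun b c => by
          change D (φ (Polynomial.C (b * c))) = _
          rw [map_mul, map_mul, D.leibniz]
          rfl }
    have hD' : D' = 0 := Derivation.eq_zero_of_isLocalRing hk hx hw hM D' fun i =>
      hD _ (Finset.mem_insert_of_mem (Finset.mem_image_of_mem _ (Finset.mem_univ i)))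
    have hP : ∀ p, D (φ p) = 0 := by
      intro p
      induction p using Polynomial.induction_on' with
      | add p q hp hq => rw [map_add, map_add, hp, hq, add_zero]
      | monomial n c =>
        have h1 : D (φ (Polynomial.C c)) = 0 := congrArg (fun d => d c) hD'
        rw [← Polynomial.C_mul_X_pow_eq_monomial, map_mul, map_pow, D.leibniz, D.leibniz_pow, h1,
          hD _ (Finset.mem_insert_self _ _)]
        simp
    ext z
    obtain ⟨p, q, hq, rfl⟩ := IsFractionRing.div_surjective (A := Polynomial C ⧸ Q) z
    obtain ⟨p, rfl⟩ := Ideal.Quotient.mk_surjective p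
    obtain ⟨q, rfl⟩ := Ideal.Quotient.mk_surjective q
    change D (φ p / φ q) = 0
    rw [D.leibniz_div, hP, hP]
    simp

/-- Write an element of the maximal ideal as `p(x) / q(x)`. The constant term of `p` is not a unit,
hence is zero, and so `p(x)` lies in the ideal generated by `x`. -/
theorem maximalIdeal_eq_span_range {ι : Type*} {x : ι → C} (hxM : ∀ i, x i ∈ maximalIdeal C)
    (hx : fracAdjoin k (Set.range x) = ⊤) : maximalIdeal C = Ideal.span (Set.range x) := by
  have hle : Ideal.span (Set.range x) ≤ maximalIdeal C :=
    Ideal.span_le.mpr (by rintro _ ⟨i, rfl⟩; exact hxM i)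
  refine le_antisymm (fun μ hμ => ?_) hle
  obtain ⟨p, q, hu, e⟩ := exists_aeval_of_mem_fracAdjoin
    (show μ ∈ fracAdjoin k (Set.range x) from hx ▸ Algebra.mem_top)
  have key : ∀ p : MvPolynomial ι k,
      aeval x p - algebraMap k C (constantCoeff p) ∈ Ideal.span (Set.range x) := by
    intro p
    induction p using MvPolynomial.induction_on with
    | C r => simp
    | add p q hp hq =>
      convert add_mem hp hq using 1
      simp only [map_add]
      ring
    | mul_X p i hp =>
      simp only [map_mul, aeval_X, constantCoeff_X, mul_zero, map_zero, sub_zero]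
      exact Ideal.mul_mem_left _ _ (Ideal.subset_span ⟨i, rfl⟩)
  have h0 : constantCoeff p = 0 := by
    by_contra h
    have h1 : algebraMap k C (constantCoeff p) ∈ maximalIdeal C := by
      have h2 := sub_mem (e ▸ Ideal.mul_mem_right _ _ hμ) (hle (key p))
      rwa [sub_sub_cancel] at h2
    exact h1 ((IsUnit.mk0 _ h).map _)
  have h3 := key p
  rw [h0, map_zero, sub_zero, ← e] at h3
  exact (Ideal.mul_unit_mem_iff_mem _ hu).mp h3

end TranscendenceDegree

/-! ### Generic linear projections of germs -/

section Projection

open MvPolynomial IsLocalRing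

/-- Substituting `x' + v w` for the first variables and `w` for the last variable of a homogeneous
polynomial. -/
noncomputable def lineEval {k E : Type*} [CommRing k] [CommRing E] [Algebra k E] {a : ℕ}
    (v : Fin a → k) (x' : Fin a → E) : Fin (a + 1) → Polynomial E :=
  Fin.snoc (fun j => Polynomial.C (x' j) + Polynomial.C (algebraMap k E (v j)) * Polynomial.X)
    Polynomial.X

/-- Every variable is replaced by a polynomial of degree at most one in `w`, with linear
coefficients `(v, 1)`, so the top coefficient is `f(v, 1)`. When this is non-zero, a relation `f =
0` becomes an integral equation for the last variable over the projected ones. -/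
theorem natDegree_coeff_lineEval {k E : Type*} [Field k] [CommRing E] [Nontrivial E] [Algebra k E] {a d : ℕ}
    (v : Fin a → k) (x' : Fin a → E) {f : MvPolynomial (Fin (a + 1)) k} (hf : f.IsHomogeneous d) :
    (aeval (lineEval v x') f).natDegree ≤ d ∧
      (aeval (lineEval v x') f).coeff d =
        algebraMap k E (MvPolynomial.eval (Fin.snoc v 1 : Fin (a + 1) → k) f) := by
  have h1 : ∀ i, (lineEval v x' i).natDegree ≤ 1 := by
    intro i
    refine Fin.lastCases ?_ (fun j => ?_) i
    · simp [lineEval]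
    · simp only [lineEval, Fin.snoc_castSucc]
      compute_degree
  have h2 : ∀ i, (lineEval v x' i).coeff 1 = algebraMap k E ((Fin.snoc v 1 : Fin (a + 1) → k) i) := by
    intro i
    refine Fin.lastCases ?_ (fun j => ?_) i
    · simp [lineEval]
    · simp [lineEval, Polynomial.coeff_C]
  have hd : ∀ α ∈ f.support, ∑ i, α i = d := by
    intro α hα
    rw [← hf (mem_support_iff.mp hα), Finsupp.weight_apply, Finsupp.sum_fintype _ _ (by simp)]
    simp
  have h3 : ∀ α : Fin (a + 1) →₀ ℕ, ∀ i, (lineEval v x' i ^ α i).natDegree ≤ α i := fun α i =>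
    (Polynomial.natDegree_pow_le_of_le _ (h1 i)).trans (by simp)
  have h4 : ∀ (α : Fin (a + 1) →₀ ℕ) (s : Finset (Fin (a + 1))),
      (∏ i ∈ s, lineEval v x' i ^ α i).natDegree ≤ ∑ i ∈ s, α i ∧
      (∏ i ∈ s, lineEval v x' i ^ α i).coeff (∑ i ∈ s, α i) =
        ∏ i ∈ s, algebraMap k E ((Fin.snoc v 1 : Fin (a + 1) → k) i) ^ α i := by
    intro α s
    induction s using Finset.induction_on with
    | empty => simp
    | insert i s hi ih =>
      rw [Finset.prod_insert hi, Finset.sum_insert hi, Finset.prod_insert hi]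
      refine ⟨Polynomial.natDegree_mul_le_of_le (h3 α i) ih.1, ?_⟩
      rw [Polynomial.coeff_mul_add_eq_of_natDegree_le (h3 α i) ih.1, ih.2, ← h2]
      congr 1
      simpa using Polynomial.coeff_pow_of_natDegree_le (m := α i) (h1 i)
  simp only [aeval_def, eval₂_eq']
  constructor
  · refine Polynomial.natDegree_sum_le_of_forall_le _ _ fun α hα => ?_
    refine (Polynomial.natDegree_C_mul_le _ _).trans ?_
    exact (h4 α _).1.trans (hd α hα).le
  · rw [Polynomial.finsetSum_coeff, eval_eq', map_sum]
    refine Finset.sum_congr rfl fun α hα => ?_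
    rw [IsScalarTower.algebraMap_apply k E (Polynomial E), Polynomial.algebraMap_eq,
      Polynomial.coeff_C_mul, ← hd α hα, (h4 α _).2]
    simp

variable {k C : Type u} [Field k] [CommRing C] [IsLocalRing C] [Algebra k C]

/-- The cotangent space is spanned over `k` by the `m` classes of `w`, so `a > m` elements are
linearly dependent there. The relation is used to recover the last coordinate from the projected
ones modulo the square of the maximal ideal. -/
theorem exists_linear_relation
    (hk : ∀ c : C, ∃ r : k, c - algebraMap k C r ∈ maximalIdeal C) {a m : ℕ}
    {x : Fin a → C} (hxM : ∀ i, x i ∈ maximalIdeal C) {w : Fin m → C}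
    (hw : ∀ i, w i ∈ maximalIdeal C)
    (hM : maximalIdeal C ≤ Ideal.span (Set.range w) ⊔ maximalIdeal C ^ 2) (ham : m < a) :
    ∃ l : Fin a → k, l ≠ 0 ∧ ∑ i, algebraMap k C (l i) * x i ∈ maximalIdeal C ^ 2 := by
  have h1 : ∀ i, ∃ A : Fin m → k,
      x i - ∑ j, algebraMap k C (A j) * w j ∈ maximalIdeal C ^ 2 := by
    intro i
    obtain ⟨y, hy, z, hz, e⟩ := Submodule.mem_sup.mp (hM (hxM i))
    obtain ⟨c, rfl⟩ := (Ideal.mem_span_range_iff_exists_fun).mp hy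
    choose A hA using fun j => hk (c j)
    refine ⟨A, ?_⟩
    have : x i - ∑ j, algebraMap k C (A j) * w j =
        ∑ j, (c j - algebraMap k C (A j)) * w j + z := by
      rw [← e]
      simp only [sub_mul, Finset.sum_sub_distrib]
      ring
    rw [this]
    refine add_mem (sum_mem fun j _ => ?_) hz
    rw [pow_two]
    exact Ideal.mul_mem_mul (hA j) (hw j)
  choose A hA using h1
  let L : (Fin a → k) →ₗ[k] (Fin m → k) := Matrix.vecMulLinear A
  obtain ⟨l, hl, hl0⟩ := Submodule.exists_mem_ne_zero_of_ne_bot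
    (LinearMap.ker_ne_bot_of_finrank_lt (f := L) (by simpa using ham))
  refine ⟨l, hl0, ?_⟩
  have hl' : ∀ j, ∑ i, l i * A i j = 0 := fun j => congrFun (LinearMap.mem_ker.mp hl) j
  have : ∑ i, algebraMap k C (l i) * x i =
      ∑ i, algebraMap k C (l i) * (x i - ∑ j, algebraMap k C (A i j) * w j) := by
    simp only [mul_sub, Finset.sum_sub_distrib, Finset.mul_sum]
    rw [Finset.sum_comm, eq_comm, sub_eq_self]
    refine Finset.sum_eq_zero fun j _ => ?_
    simp only [← mul_assoc, ← map_mul, ← Finset.sum_mul, ← map_sum, hl' j, map_zero, zero_mul]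
  rw [this]
  exact sum_mem fun i _ => Ideal.mul_mem_left _ _ (hA i)

/-- Over an infinite field the non-zero polynomial `f * l * X_last` is non-zero at some point; by
homogeneity that point can be rescaled to have last coordinate `1`. -/
theorem exists_eval_snoc_ne_zero [Infinite k] {a d : ℕ} {f : MvPolynomial (Fin (a + 1)) k}
    (hf : f.IsHomogeneous d) (hf0 : f ≠ 0) {l : Fin (a + 1) → k} (hl : l ≠ 0) :
    ∃ v : Fin a → k, MvPolynomial.eval (Fin.snoc v 1 : Fin (a + 1) → k) f ≠ 0 ∧
      ∑ i, l i * (Fin.snoc v 1 : Fin (a + 1) → k) i ≠ 0 := by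
  let g : MvPolynomial (Fin (a + 1)) k := ∑ i, MvPolynomial.C (l i) * X i
  have hg : g.IsHomogeneous 1 := IsHomogeneous.sum _ _ _ fun i _ => by
    simpa using (isHomogeneous_C _ (l i)).mul (isHomogeneous_X k i)
  have hg' : ∀ u, MvPolynomial.eval u g = ∑ i, l i * u i := fun u => by simp [g]
  have hg0 : g ≠ 0 := by
    intro h
    refine hl (funext fun i => ?_)
    have := hg' (Pi.single i 1)
    rw [h, map_zero] at this
    simpa [Pi.single_apply] using this.symm
  obtain ⟨u, hu⟩ : ∃ u, MvPolynomial.eval u (f * g * X (Fin.last a)) ≠ 0 := by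
    by_contra! h
    exact mul_ne_zero (mul_ne_zero hf0 hg0) (X_ne_zero _)
      (MvPolynomial.funext fun u => by rw [h u, map_zero])
  rw [map_mul, map_mul, eval_X] at hu
  have hu1 := left_ne_zero_of_mul (left_ne_zero_of_mul hu)
  have hu2 := right_ne_zero_of_mul (left_ne_zero_of_mul hu)
  have hu3 := right_ne_zero_of_mul hu
  let v : Fin a → k := fun j => (u (Fin.last a))⁻¹ * u j.castSucc
  have hv : (fun i => u (Fin.last a) * (Fin.snoc v 1 : Fin (a + 1) → k) i) = u := by
    funext i
    refine Fin.lastCases ?_ (fun j => ?_) i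
    · simp
    · simp [v, hu3]
  refine ⟨v, ?_, ?_⟩
  · have := aeval_mul_of_isHomogeneous hf (u (Fin.last a)) (Fin.snoc v 1 : Fin (a + 1) → k)
    rw [hv] at this
    exact right_ne_zero_of_mul (this ▸ hu1)
  · rw [← hg']
    have := aeval_mul_of_isHomogeneous hg (u (Fin.last a)) (Fin.snoc v 1 : Fin (a + 1) → k)
    rw [hv] at this
    exact right_ne_zero_of_mul (this ▸ hu2)

theorem Polynomial.aeval_eq_aeval_divX_mul_add {A B : Type*} [CommRing A] [CommRing B]
    [Algebra A B] (b : B) (p : Polynomial A) :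
    Polynomial.aeval b p = Polynomial.aeval b p.divX * b + algebraMap A B (p.coeff 0) := by
  conv_lhs => rw [← Polynomial.divX_mul_X_add p]
  simp

/-- Modulo `P` the vector `y` equals `y_last · (v, 1)`, so `f(y) = 0` reads `y_last ^ d · f(v, 1) =
0` with `f(v, 1)` a unit. Geometrically, the line in direction `(v, 1)` through the origin meets the
cone `f = 0` only at the origin. -/
theorem last_mem_of_isPrime {A : Type*} [CommRing A] [Algebra k A] {a d : ℕ}
    {f : MvPolynomial (Fin (a + 1)) k} (hf : f.IsHomogeneous d) {v : Fin a → k}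
    (hv : MvPolynomial.eval (Fin.snoc v 1 : Fin (a + 1) → k) f ≠ 0) {y : Fin (a + 1) → A}
    (hy : aeval y f = 0) (P : Ideal A) [P.IsPrime]
    (hP : ∀ j : Fin a, y j.castSucc - algebraMap k A (v j) * y (Fin.last a) ∈ P) :
    y (Fin.last a) ∈ P := by
  have h1 : (fun i => Ideal.Quotient.mkₐ k P (y i)) = fun i => Ideal.Quotient.mk P (y (Fin.last a)) *
      algebraMap k (A ⧸ P) ((Fin.snoc v 1 : Fin (a + 1) → k) i) := by
    funext i
    refine Fin.lastCases ?_ (fun j => ?_) i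
    · simp
    · have := Ideal.Quotient.eq.mpr (hP j)
      rw [map_mul] at this
      rw [Fin.snoc_castSucc, mul_comm]
      exact this
  have h2 : aeval (fun i => Ideal.Quotient.mkₐ k P (y i)) f = 0 := by
    have := comp_aeval_apply y (Ideal.Quotient.mkₐ k P) f
    rw [hy, map_zero] at this
    exact this.symm
  have h4 := aeval_algebraMap_apply (A ⧸ P) (Fin.snoc v 1 : Fin (a + 1) → k) f
  simp only [Function.comp_def] at h4
  rw [h1, aeval_mul_of_isHomogeneous hf, h4] at h2
  have h3 := ((IsUnit.mk0 _ hv).map (algebraMap k (A ⧸ P))).mul_left_eq_zero.mp h2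
  rw [← map_pow, Ideal.Quotient.eq_zero_iff_mem] at h3
  exact Ideal.IsPrime.mem_of_pow_mem ‹_› d h3

/-- If the local ring `C` is generated by one element `w` over a local subring `E`, up to inverses
of units, if `w` is integral over `E` and nilpotent modulo the maximal ideal of `E`, and if the
maximal ideal of `E` generates that of `C`, then `E = C`. -/
theorem Subalgebra.eq_top_of_isIntegral_of_isLocalRing
    (hk : ∀ c : C, ∃ r : k, c - algebraMap k C r ∈ maximalIdeal C) {s : Set C} (w : C)
    (hws : fracAdjoin k (insert w s) = ⊤) (hwM : w ∈ maximalIdeal C)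
    (hint : IsIntegral (fracAdjoin k s) w)
    (hw : ∀ P : Ideal (Algebra.adjoin (fracAdjoin k s) {w}), P.IsMaximal →
      (∀ e : fracAdjoin k s, (e : C) ∈ maximalIdeal C → algebraMap _ _ e ∈ P) →
      (⟨w, Algebra.self_mem_adjoin_singleton _ w⟩ : Algebra.adjoin (fracAdjoin k s) {w}) ∈ P)
    (hM : maximalIdeal C ≤ Ideal.span (maximalIdeal C ⊓ fracAdjoin k s)) :
    fracAdjoin k s = ⊤ := by
  let E := fracAdjoin k s
  let W := Algebra.adjoin E {w}
  let w' : W := ⟨w, Algebra.self_mem_adjoin_singleton _ w⟩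
  have hunit : ∀ e : E, IsUnit (e : C) → IsUnit e := by
    intro e he
    obtain ⟨b, hb⟩ := he.exists_right_inv
    exact IsUnit.of_mul_eq_one ⟨b, mem_fracAdjoin_of_mul_eq_one e.2 hb⟩ (Subtype.ext hb)
  have : IsLocalHom (algebraMap E C) := ⟨fun e he => hunit e he⟩
  have : IsLocalRing E := RingHom.domain_isLocalRing (algebraMap E C)
  have hmem : ∀ e : E, (e : C) ∈ maximalIdeal C → e ∈ maximalIdeal E := fun e he hu =>
    he (hu.map (algebraMap E C))
  have hmem' : ∀ e : E, e ∈ maximalIdeal E → (e : C) ∈ maximalIdeal C := fun e he hu =>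
    he (hunit e hu)
  have : Module.Finite E W := Algebra.finite_adjoin_simple_of_isIntegral hint
  -- A maximal ideal `P` of `W = E[w]` lies over that of `E` and contains `w`. If it contains a
  -- polynomial in `w`, the constant coefficient is in the maximal ideal of `E`, so that the
  -- polynomial is a non-unit of `C`.
  have hW : ∀ q : W, IsUnit (q : C) → IsUnit q := by
    intro q hq
    by_contra hnu
    obtain ⟨P, hP, hqP⟩ := exists_max_ideal_of_mem_nonunits hnu
    have hPE : P.comap (algebraMap E W) = maximalIdeal E := by
      have := Ideal.isMaximal_comap_of_isIntegral_of_isMaximal (R := E) P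
      exact IsLocalRing.eq_maximalIdeal this
    have hw' : w' ∈ P := hw P hP fun e he => by
      have := hmem e he
      rwa [← hPE] at this
    obtain ⟨p, hp⟩ : ∃ p : Polynomial E, Polynomial.aeval w p = q := by
      have h : (q : C) ∈ Algebra.adjoin E {w} := q.2
      rwa [Algebra.adjoin_singleton_eq_range_aeval] at h
    have hp' : Polynomial.aeval w' p = q := Subtype.ext (by
      rw [← hp]
      exact (Polynomial.aeval_algHom_apply W.val w' p).symm)
    have h1 := Polynomial.aeval_eq_aeval_divX_mul_add w' p
    have h2 : p.coeff 0 ∈ maximalIdeal E := by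
      rw [← hPE]
      have : algebraMap E W (p.coeff 0) = q - Polynomial.aeval w' p.divX * w' := by
        rw [← hp', h1]; ring
      rw [Ideal.mem_comap, this]
      exact sub_mem hqP (P.mul_mem_left _ hw')
    have h3 : (q : C) = (Polynomial.aeval w' p.divX : W) * w + (p.coeff 0 : E) := by
      rw [← hp', h1]
      rfl
    have h4 : (q : C) ∈ maximalIdeal C := by
      rw [h3]
      exact add_mem (Ideal.mul_mem_left _ _ hwM) (hmem' _ h2)
    exact h4 hq
  -- By `hW`, `W` is closed under inverses taken in `C`; it contains `w` and `s`, hence everything.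
  have hWtop : W = ⊤ := by
    have : fracAdjoin k (insert w s) ≤ W.restrictScalars k := by
      refine fracAdjoin_le ?_ ?_
      · rintro b (rfl | hb)
        · exact w'.2
        · exact (algebraMap E W ⟨b, subset_fracAdjoin s hb⟩).2
      · intro b hb c hbc
        obtain ⟨d, hd⟩ := (hW ⟨b, hb⟩ (IsUnit.of_mul_eq_one c hbc)).exists_right_inv
        have hd' : b * d = 1 := congrArg Subtype.val hd
        have : c = d := by
          calc c = c * (b * d) := by rw [hd', mul_one]
            _ = (b * c) * d := by ring
            _ = d := by rw [hbc, one_mul]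
        rw [this]
        exact d.2
    rw [hws] at this
    exact top_le_iff.mp fun c _ => this trivial
  have hfin : (⊤ : Submodule E C).FG := by
    have h1 := hint.fg_adjoin_singleton
    change (Subalgebra.toSubmodule W).FG at h1
    rwa [hWtop, Algebra.top_toSubmodule] at h1
  -- `C` is now finite over `E` and equals `E` plus the maximal ideal of `E` times `C`, so
  -- Nakayama's lemma applies.
  have hle : (⊤ : Submodule E C) ≤ 1 := by
    refine Submodule.le_of_le_smul_of_le_jacobson_bot hfin (maximalIdeal_le_jacobson _) ?_
    intro c _
    obtain ⟨r, hr⟩ := hk c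
    rw [← add_sub_cancel (algebraMap k C r) c]
    refine Submodule.add_mem_sup (Submodule.mem_one.mpr ⟨algebraMap k E r, rfl⟩) ?_
    have := hM hr
    clear hr
    generalize c - algebraMap k C r = μ at this ⊢
    induction this using Submodule.span_induction with
    | mem y hy =>
      have : y = (⟨y, hy.2⟩ : E) • (1 : C) := (mul_one y).symm
      rw [this]
      exact Submodule.smul_mem_smul (hmem _ hy.1) trivial
    | zero => exact zero_mem _
    | add y z _ _ hy hz => exact add_mem hy hz
    | smul b y hy' hy =>
      clear hy'
      induction hy using Submodule.smul_induction_on' with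
      | smul e he z hz =>
        rw [smul_comm]
        exact Submodule.smul_mem_smul he trivial
      | add y hy z hz hy' hz' => rw [smul_add]; exact add_mem hy' hz'
  refine top_le_iff.mp fun c _ => ?_
  obtain ⟨e, he⟩ := Submodule.mem_one.mp (hle (trivial : c ∈ ⊤))
  rw [← he]
  exact e.2

/-- A generic linear projection of a germ along a line stays a closed immersion of germs,
as long as the target has dimension bigger than that of the germ. -/
theorem exists_projection [Infinite k]
    (hk : ∀ c : C, ∃ r : k, c - algebraMap k C r ∈ maximalIdeal C) {a m : ℕ}
    {x : Fin (a + 1) → C} (hxM : ∀ i, x i ∈ maximalIdeal C)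
    (hx : fracAdjoin k (Set.range x) = ⊤) {w : Fin m → C} (hw : ∀ i, w i ∈ maximalIdeal C)
    (hM : maximalIdeal C ≤ Ideal.span (Set.range w) ⊔ maximalIdeal C ^ 2) (ham : m + 1 ≤ a) :
    ∃ v : Fin a → k, fracAdjoin k (Set.range fun j : Fin a =>
      x j.castSucc - algebraMap k C (v j) * x (Fin.last a)) = ⊤ := by
  obtain ⟨d, f, hf0, hf, hfx⟩ := exists_isHomogeneous_aeval_eq_zero hk hx hw hM (by omega)
  obtain ⟨l, hl0, hl⟩ := exists_linear_relation hk hxM hw hM (by omega)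
  -- The direction has to satisfy two open conditions: `f(v, 1) ≠ 0` makes the projection finite
  -- with a single point over the origin, and `l(v, 1) ≠ 0` makes it injective on the cotangent
  -- directions of the germ.
  obtain ⟨v, hfv, hlv⟩ := exists_eval_snoc_ne_zero hf hf0 hl0
  refine ⟨v, ?_⟩
  let x' : Fin a → C := fun j => x j.castSucc - algebraMap k C (v j) * x (Fin.last a)
  have hx'M : ∀ j, x' j ∈ maximalIdeal C := fun j =>
    sub_mem (hxM _) (Ideal.mul_mem_left _ _ (hxM _))
  refine Subalgebra.eq_top_of_isIntegral_of_isLocalRing hk (x (Fin.last a)) ?_ (hxM _) ?_ ?_ ?_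
  · refine fracAdjoin_eq_top_of_subset hx ?_
    rintro _ ⟨i, rfl⟩
    have hl := subset_fracAdjoin (k := k) (insert (x (Fin.last a)) (Set.range x'))
      (Set.mem_insert _ _)
    refine Fin.lastCases hl (fun j => ?_) i
    have h2 : x j.castSucc = x' j + algebraMap k C (v j) * x (Fin.last a) := by simp [x']
    rw [h2]
    exact add_mem (subset_fracAdjoin _ (Set.mem_insert_of_mem _ ⟨j, rfl⟩))
      (mul_mem (Subalgebra.algebraMap_mem _ _) hl)
  · let E := fracAdjoin k (Set.range x')
    let x'' : Fin a → E := fun j => ⟨x' j, subset_fracAdjoin _ ⟨j, rfl⟩⟩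
    obtain ⟨h1, h2⟩ := natDegree_coeff_lineEval v x'' hf
    have h3 : Polynomial.aeval (x (Fin.last a)) (aeval (lineEval v x'') f) = 0 := by
      have : ∀ p : MvPolynomial (Fin (a + 1)) k, Polynomial.aeval (R := E) (x (Fin.last a)) (aeval (lineEval v x'') p) =
          aeval x p := by
        intro p
        have : ((Polynomial.aeval (R := E) (x (Fin.last a))).restrictScalars k).comp
            (aeval (lineEval v x'')) = aeval x := by
          refine MvPolynomial.algHom_ext fun i => ?_
          rw [AlgHom.comp_apply, aeval_X, aeval_X, AlgHom.restrictScalars_apply]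
          refine Fin.lastCases ?_ (fun j => ?_) i
          · simp [lineEval]
          · simp only [lineEval, Fin.snoc_castSucc, map_add, map_mul, Polynomial.aeval_C,
              Polynomial.aeval_X]
            exact sub_add_cancel _ _
        exact DFunLike.congr_fun this p
      rw [this, hfx]
    let c : k := MvPolynomial.eval (Fin.snoc v 1 : Fin (a + 1) → k) f
    -- Division by the leading coefficient `c = f(v, 1)` makes the equation monic.
    refine ⟨Polynomial.C (algebraMap k E c⁻¹) * aeval (lineEval v x'') f, ?_, ?_⟩
    · refine Polynomial.monic_of_natDegree_le_of_coeff_eq_one d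
        ((Polynomial.natDegree_C_mul_le _ _).trans h1) ?_
      rw [Polynomial.coeff_C_mul, h2, ← map_mul, inv_mul_cancel₀ hfv, map_one]
    · rw [← Polynomial.aeval_def, map_mul, h3, mul_zero]
  · intro P hP hE
    let E := fracAdjoin k (Set.range x')
    let W := Algebra.adjoin E {x (Fin.last a)}
    let x'' : Fin a → W := fun j => algebraMap E W ⟨x' j, subset_fracAdjoin _ ⟨j, rfl⟩⟩
    let w' : W := ⟨x (Fin.last a), Algebra.self_mem_adjoin_singleton _ _⟩
    let y : Fin (a + 1) → W := Fin.snoc (fun j => x'' j + algebraMap k W (v j) * w') w'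
    have hy : aeval y f = 0 := by
      apply Subtype.ext
      have h1 : (W.val.restrictScalars k) (aeval y f) = aeval (fun i => (y i : C)) f :=
        comp_aeval_apply y (W.val.restrictScalars k) f
      have h2 : (fun i => (y i : C)) = x := by
        funext i
        refine Fin.lastCases ?_ (fun j => ?_) i
        · simp [y, w']
        · simp only [y, Fin.snoc_castSucc]
          exact sub_add_cancel _ _
      rw [h2, hfx] at h1
      exact h1
    have := hP.isPrime
    have h3 := last_mem_of_isPrime hf hfv hy P fun j => by
      simp only [y, Fin.snoc_castSucc, Fin.snoc_last, add_sub_cancel_right]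
      exact hE _ (hx'M j)
    simpa only [y, Fin.snoc_last] using h3
  · have hfg : (maximalIdeal C).FG := by
      rw [maximalIdeal_eq_span_range hxM hx]
      exact Submodule.fg_span (Set.finite_range x)
    have h1 : maximalIdeal C ≤ Ideal.span (Set.range x') := by
      refine Submodule.le_of_le_smul_of_le_jacobson_bot hfg (maximalIdeal_le_jacobson _) ?_
      rw [smul_eq_mul, ← pow_two]
      conv_lhs => rw [maximalIdeal_eq_span_range hxM hx]
      -- Substituting `x_j = x'_j + v_j x_last` in the linear relation leaves `l(v, 1) · x_last` as
      -- the only term outside the span of `x'`.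
      have hlast : x (Fin.last a) ∈ Ideal.span (Set.range x') ⊔ maximalIdeal C ^ 2 := by
        let u := ∑ i, l i * (Fin.snoc v 1 : Fin (a + 1) → k) i
        have e : algebraMap k C u * x (Fin.last a) =
            ∑ i, algebraMap k C (l i) * x i -
              ∑ j : Fin a, algebraMap k C (l j.castSucc) * x' j := by
          simp only [u, Fin.sum_univ_castSucc, Fin.snoc_castSucc, Fin.snoc_last, x', map_add,
            map_sum, map_mul, mul_one, mul_sub, Finset.sum_sub_distrib, add_mul, Finset.sum_mul,
            mul_assoc]
          ring
        have h2 : algebraMap k C u * x (Fin.last a) ∈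
            Ideal.span (Set.range x') ⊔ maximalIdeal C ^ 2 := by
          rw [e]
          refine sub_mem (Submodule.mem_sup_right hl) (Submodule.mem_sup_left ?_)
          exact sum_mem fun j _ => Ideal.mul_mem_left _ _ (Ideal.subset_span ⟨j, rfl⟩)
        exact (Ideal.unit_mul_mem_iff_mem _ ((IsUnit.mk0 _ hlv).map (algebraMap k C))).mp h2
      refine Ideal.span_le.mpr ?_
      rintro _ ⟨i, rfl⟩
      refine Fin.lastCases hlast (fun j => ?_) i
      have h2 : x j.castSucc = x' j + algebraMap k C (v j) * x (Fin.last a) := by simp [x']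
      rw [h2]
      exact add_mem (Submodule.mem_sup_left (Ideal.subset_span ⟨j, rfl⟩))
        (Ideal.mul_mem_left _ _ hlast)
    refine h1.trans (Ideal.span_mono ?_)
    rintro _ ⟨j, rfl⟩
    exact ⟨hx'M j, subset_fracAdjoin _ ⟨j, rfl⟩⟩

end Projection

/-! ### First-order Taylor expansion -/

section Taylor

open MvPolynomial

variable {k A σ : Type*} [CommRing k] [CommRing A] [Algebra k A]

theorem constantCoeff_pderiv_mul (i : σ) {p q : MvPolynomial σ k} (hp : constantCoeff p = 0) :
    constantCoeff (pderiv i (p * q)) = constantCoeff (pderiv i p) * constantCoeff q := by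
  simp [hp, mul_comm]

theorem aeval_sub_linear_mem_sq [Fintype σ] (I : Ideal A) {x : σ → A} (hx : ∀ i, x i ∈ I)
    (p : MvPolynomial σ k) : aeval x p - algebraMap k A (constantCoeff p) -
      ∑ i, algebraMap k A (constantCoeff (pderiv i p)) * x i ∈ I ^ 2 := by
  classical
  induction p using MvPolynomial.induction_on with
  | C r => simp
  | add p q hp hq =>
    convert add_mem hp hq using 1
    simp only [map_add, add_mul, Finset.sum_add_distrib]
    ring
  | mul_X p i hp =>
    have h1 : ∑ j, algebraMap k A (constantCoeff (pderiv j (p * X i))) * x j =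
        algebraMap k A (constantCoeff p) * x i := by
      rw [Finset.sum_eq_single i]
      · simp
      · intro j _ hj
        simp [pderiv_X_of_ne hj.symm]
      · simp
    rw [h1]
    simp only [map_mul, aeval_X, constantCoeff_X, mul_zero, map_zero, sub_zero, ← sub_mul]
    have h2 : aeval x p - algebraMap k A (constantCoeff p) ∈ I := by
      have := add_mem (Ideal.pow_le_self two_ne_zero hp)
        (sum_mem fun i (_ : i ∈ Finset.univ) =>
          I.mul_mem_left (algebraMap k A (constantCoeff (pderiv i p))) (hx i))
      rwa [sub_add_cancel] at this
    rw [pow_two]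
    exact Ideal.mul_mem_mul h2 (hx i)

/-- This describes the effect on an equation `g(x)` of shifting one coordinate by `s`. Where
`∂g/∂x_i` is non-zero at the origin, the factor of `s` is a non-zero constant modulo `I`;
`exists_chart` uses this to move a point into the chart of `g`. -/
theorem exists_aeval_update_eq [DecidableEq σ] (I : Ideal A) {x : σ → A} (hx : ∀ i, x i ∈ I)
    (i : σ) {s : A} (hs : s ∈ I) (p : MvPolynomial σ k) :
    ∃ e ∈ I, aeval (Function.update x i (x i + s)) p =
      aeval x p + s * (algebraMap k A (constantCoeff (pderiv i p)) + e) := by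
  induction p using MvPolynomial.induction_on with
  | C r => exact ⟨0, zero_mem _, by simp⟩
  | add p q hp hq =>
    obtain ⟨e, he, h⟩ := hp
    obtain ⟨e', he', h'⟩ := hq
    refine ⟨e + e', add_mem he he', ?_⟩
    simp only [map_add, h, h']
    ring
  | mul_X p j hp =>
    obtain ⟨e, he, h⟩ := hp
    by_cases hij : j = i
    · subst hij
      refine ⟨aeval x p - algebraMap k A (constantCoeff p) +
        (algebraMap k A (constantCoeff (pderiv j p)) + e) * (x j + s), ?_, ?_⟩
      · refine add_mem ?_ (I.mul_mem_left _ (add_mem (hx j) hs))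
        clear h he
        induction p using MvPolynomial.induction_on with
        | C r => simp
        | add p q hp hq =>
          convert add_mem hp hq using 1
          simp only [map_add]
          ring
        | mul_X p i hp => simpa using I.mul_mem_left _ (hx i)
      · simp only [map_mul, h, aeval_X, Function.update_self, pderiv_mul, pderiv_X_self, map_add,
          constantCoeff_X, mul_zero, mul_one, zero_add]
        ring
    · refine ⟨(algebraMap k A (constantCoeff (pderiv i p)) + e) * x j, I.mul_mem_left _ (hx j), ?_⟩
      simp only [map_mul, h, aeval_X, Function.update_of_ne hij, pderiv_mul, pderiv_X_of_ne hij,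
        map_add, constantCoeff_X, mul_zero, map_zero, zero_add]
      ring

end Taylor

/-! ### Cotangent spaces and adapted coordinates -/

section Cotangent

open MvPolynomial IsLocalRing

variable {k O : Type u} [Field k] [CommRing O] [IsLocalRing O] [Algebra k O]

theorem aeval_mem_maximalIdeal_iff {σ : Type*} {z : σ → O} (hzM : ∀ i, z i ∈ maximalIdeal O)
    (p : MvPolynomial σ k) : aeval z p ∈ maximalIdeal O ↔ constantCoeff p = 0 := by
  have key : ∀ p : MvPolynomial σ k,
      aeval z p - algebraMap k O (constantCoeff p) ∈ maximalIdeal O := by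
    intro p
    induction p using MvPolynomial.induction_on with
    | C r => simp
    | add p q hp hq =>
      convert add_mem hp hq using 1
      simp only [map_add]
      ring
    | mul_X p i hp => simpa using Ideal.mul_mem_left _ _ (hzM i)
  constructor
  · intro h
    by_contra h0
    have h1 := sub_mem h (key p)
    rw [sub_sub_cancel] at h1
    exact h1 ((IsUnit.mk0 _ h0).map _)
  · intro h
    simpa [h] using key p

theorem isUnit_aeval_iff {σ : Type*} {z : σ → O} (hzM : ∀ i, z i ∈ maximalIdeal O)
    (p : MvPolynomial σ k) : IsUnit (aeval z p) ↔ constantCoeff p ≠ 0 := by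
  rw [← not_iff_not, not_not, ← aeval_mem_maximalIdeal_iff hzM]
  rfl

/-- A product of two elements of the maximal ideal is a fraction whose numerator is a product of
polynomials without constant term, thus without linear term. This allows linear terms to be compared
modulo the square. -/
theorem exists_aeval_of_mem_maximalIdeal_sq {σ : Type*} {z : σ → O}
    (hzM : ∀ i, z i ∈ maximalIdeal O) (hz : fracAdjoin k (Set.range z) = ⊤) {μ : O}
    (hμ : μ ∈ maximalIdeal O ^ 2) : ∃ p q : MvPolynomial σ k, constantCoeff q ≠ 0 ∧
      μ * aeval z q = aeval z p ∧ constantCoeff p = 0 ∧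
      ∀ i, constantCoeff (pderiv i p) = 0 := by
  have hfrac : ∀ r : O, ∃ p q : MvPolynomial σ k, constantCoeff q ≠ 0 ∧
      r * aeval z q = aeval z p := fun r => by
    obtain ⟨p, q, hu, e⟩ := exists_aeval_of_mem_fracAdjoin
      (show r ∈ fracAdjoin k (Set.range z) from hz ▸ Algebra.mem_top)
    exact ⟨p, q, (isUnit_aeval_iff hzM q).mp hu, e⟩
  rw [pow_two] at hμ
  induction hμ using Submodule.mul_induction_on' with
  | mem_mul_mem a ha b hb =>
    obtain ⟨p, q, hq, e⟩ := hfrac a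
    obtain ⟨p', q', hq', e'⟩ := hfrac b
    have hp : constantCoeff p = 0 := (aeval_mem_maximalIdeal_iff hzM p).mp
      (e ▸ Ideal.mul_mem_right _ _ ha)
    have hp' : constantCoeff p' = 0 := (aeval_mem_maximalIdeal_iff hzM p').mp
      (e' ▸ Ideal.mul_mem_right _ _ hb)
    refine ⟨p * p', q * q', ?_, ?_, ?_, fun i => ?_⟩
    · rw [map_mul]; exact mul_ne_zero hq hq'
    · rw [map_mul, map_mul, ← e, ← e']; ring
    · rw [map_mul, hp, zero_mul]
    · rw [constantCoeff_pderiv_mul i hp, hp', mul_zero]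
  | add a _ b _ ha hb =>
    obtain ⟨p, q, hq, e, hp, hd⟩ := ha
    obtain ⟨p', q', hq', e', hp', hd'⟩ := hb
    refine ⟨p * q' + p' * q, q * q', ?_, ?_, ?_, fun i => ?_⟩
    · rw [map_mul]; exact mul_ne_zero hq hq'
    · rw [map_mul, map_add, map_mul, map_mul, ← e, ← e']; ring
    · rw [map_add, map_mul, map_mul, hp, hp', zero_mul, zero_mul, add_zero]
    · rw [map_add, map_add, constantCoeff_pderiv_mul i hp, constantCoeff_pderiv_mul i hp', hd, hd',
        zero_mul, zero_mul, add_zero]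

theorem toCotangent_sum {ι : Type*} [Fintype ι] {z : ι → O} (hzM : ∀ i, z i ∈ maximalIdeal O)
    (c : ι → O) {μ : O} (hμ : μ ∈ maximalIdeal O) (h : μ - ∑ i, c i * z i ∈ maximalIdeal O ^ 2) :
    ((maximalIdeal O).toCotangent ⟨μ, hμ⟩ : CotangentSpace O) =
      ∑ i, residue O (c i) • ((maximalIdeal O).toCotangent ⟨z i, hzM i⟩ : CotangentSpace O) := by
  have h1 : ∑ i, residue O (c i) • ((maximalIdeal O).toCotangent ⟨z i, hzM i⟩ : CotangentSpace O) =
      (maximalIdeal O).toCotangent (∑ i, c i • ⟨z i, hzM i⟩) := by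
    rw [map_sum]
    refine Finset.sum_congr rfl fun j _ => ?_
    rw [map_smul]
    rfl
  rw [h1, Ideal.toCotangent_eq]
  simpa using h

theorem span_toCotangent_eq_top {ι : Type*} [Fintype ι] {z : ι → O} (hzM : ∀ i, z i ∈ maximalIdeal O)
    (hz : fracAdjoin k (Set.range z) = ⊤) : Submodule.span (ResidueField O)
      (Set.range fun i => ((maximalIdeal O).toCotangent ⟨z i, hzM i⟩ : CotangentSpace O)) = ⊤ := by
  refine top_le_iff.mp fun v _ => ?_
  obtain ⟨⟨μ, hμ⟩, rfl⟩ := (maximalIdeal O).toCotangent_surjective v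
  have h1 := hμ
  rw [maximalIdeal_eq_span_range hzM hz, Ideal.mem_span_range_iff_exists_fun] at h1
  obtain ⟨c, hc⟩ := h1
  rw [toCotangent_sum hzM c hμ (by rw [hc, sub_self]; exact zero_mem _)]
  exact sum_mem fun i _ => Submodule.smul_mem _ _ (Submodule.subset_span ⟨i, rfl⟩)

/-- A relation `∑ r_j z_j ∈ maximalIdeal O ^ 2` becomes, by injectivity of `aeval z`, a polynomial
identity `(∑ r_j X_j) * q = p` with `q(0) ≠ 0` and `p` without linear terms; hence every `r_j` is
zero. -/
theorem linearIndependent_toCotangent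
    (hk : ∀ c : O, ∃ r : k, c - algebraMap k O r ∈ maximalIdeal O)
    {n : ℕ} {z : Fin n → O} (hzM : ∀ i, z i ∈ maximalIdeal O)
    (hz : fracAdjoin k (Set.range z) = ⊤)
    (hinj : Function.Injective (aeval z : MvPolynomial (Fin n) k →ₐ[k] O)) :
    LinearIndependent (ResidueField O)
      (fun i => ((maximalIdeal O).toCotangent ⟨z i, hzM i⟩ : CotangentSpace O)) := by
  rw [Fintype.linearIndependent_iff]
  intro c hc i
  obtain ⟨b, hb⟩ : ∃ b : Fin n → O, c = fun j => residue O (b j) :=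
    ⟨_, funext fun j => (residue_surjective (c j)).choose_spec.symm⟩
  choose r hr using fun j => hk (b j)
  have h1 : ∑ j, algebraMap k O (r j) * z j ∈ maximalIdeal O ^ 2 := by
    have h2 : (maximalIdeal O).toCotangent (∑ j, b j • ⟨z j, hzM j⟩) = 0 := by
      rw [map_sum, ← hc]
      refine Finset.sum_congr rfl fun j _ => ?_
      rw [map_smul, hb]
      rfl
    rw [Ideal.toCotangent_eq_zero] at h2
    have h3 : ∑ j, (b j - algebraMap k O (r j)) * z j ∈ maximalIdeal O ^ 2 :=
      sum_mem fun j _ => by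
        rw [pow_two]
        exact Ideal.mul_mem_mul (hr j) (hzM j)
    convert sub_mem h2 h3 using 1
    simp [sub_mul, Finset.sum_sub_distrib]
  obtain ⟨p, q, hq, e, -, hp⟩ := exists_aeval_of_mem_maximalIdeal_sq hzM hz h1
  have h2 : (∑ j, MvPolynomial.C (r j) * X j) * q = p := hinj (by
    rw [map_mul, ← e]
    congr 1
    simp)
  have h3 : r i = 0 := by
    have h4 := hp i
    rw [← h2, constantCoeff_pderiv_mul i (by simp)] at h4
    have h5 : constantCoeff (pderiv i (∑ j, MvPolynomial.C (r j) * X j)) = r i := by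
      rw [map_sum, map_sum, Finset.sum_eq_single i]
      · simp
      · intro j _ hj
        simp [pderiv_X_of_ne hj]
      · simp
    rw [h5] at h4
    exact (mul_eq_zero.mp h4).resolve_right hq
  have h4 := hr i
  rw [h3, map_zero, sub_zero] at h4
  rw [hb]
  exact (residue_eq_zero_iff _).mpr h4

/-- The image of an ideal in the cotangent space of a local ring. -/
noncomputable def cotangentImage (J : Ideal O) : Submodule (ResidueField O) (CotangentSpace O) where
  carrier := {v | ∃ μ : maximalIdeal O, (μ : O) ∈ J ∧ (maximalIdeal O).toCotangent μ = v}
  add_mem' := by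
    rintro _ _ ⟨a, ha, rfl⟩ ⟨b, hb, rfl⟩
    exact ⟨a + b, add_mem ha hb, map_add _ _ _⟩
  zero_mem' := ⟨0, zero_mem _, map_zero _⟩
  smul_mem' := by
    rintro c _ ⟨a, ha, rfl⟩
    obtain ⟨c, rfl⟩ := residue_surjective c
    exact ⟨c • a, J.mul_mem_left _ ha, map_smul _ _ _⟩

/-- The `w` lift a basis of the quotient by `cotangentImage J`. When `J` is a proper ideal, `m` is
the dimension of the cotangent space of `O ⧸ J`. -/
theorem exists_span_sup_cotangentImage [IsNoetherianRing O] (J : Ideal O) :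
    ∃ (m : ℕ) (w : Fin m → O), (∀ i, w i ∈ maximalIdeal O) ∧
      maximalIdeal O ≤ Ideal.span (Set.range w) ⊔ J ⊔ maximalIdeal O ^ 2 ∧
      m + Module.finrank (ResidueField O) (cotangentImage J) =
        Module.finrank (ResidueField O) (CotangentSpace O) := by
  let Q := CotangentSpace O ⧸ cotangentImage J
  let b := Module.finBasis (ResidueField O) Q
  have hw : ∀ i, ∃ w : maximalIdeal O,
      (cotangentImage J).mkQ ((maximalIdeal O).toCotangent w) = b i := fun i => by
    obtain ⟨v, hv⟩ := (cotangentImage J).mkQ_surjective (b i)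
    obtain ⟨w, rfl⟩ := (maximalIdeal O).toCotangent_surjective v
    exact ⟨w, hv⟩
  choose w hw using hw
  refine ⟨_, fun i => w i, fun i => (w i).2, ?_, (cotangentImage J).finrank_quotient_add_finrank⟩
  intro μ hμ
  choose c hc using fun i => residue_surjective
    (b.repr ((cotangentImage J).mkQ ((maximalIdeal O).toCotangent ⟨μ, hμ⟩)) i)
  have h1 : (cotangentImage J).mkQ ((maximalIdeal O).toCotangent (⟨μ, hμ⟩ - ∑ i, c i • w i)) = 0 := by
    rw [map_sub, map_sub, sub_eq_zero, map_sum, map_sum,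
      ← b.sum_repr ((cotangentImage J).mkQ ((maximalIdeal O).toCotangent ⟨μ, hμ⟩))]
    refine Finset.sum_congr rfl fun i _ => ?_
    rw [← hc, ← hw, map_smul]
    rfl
  rw [Submodule.mkQ_apply, Submodule.Quotient.mk_eq_zero] at h1
  obtain ⟨j, hj, e⟩ := h1
  rw [Ideal.toCotangent_eq] at e
  have e' : μ = ∑ i, c i * w i + j - (j - (μ - ∑ i, c i * w i)) := by ring
  rw [e']
  refine sub_mem (Submodule.mem_sup_left (Submodule.add_mem_sup ?_ hj)) ?_
  · exact sum_mem fun i _ => Ideal.mul_mem_left _ _ (Ideal.subset_span ⟨i, rfl⟩)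
  · refine Submodule.mem_sup_right ?_
    convert e using 1
    simp

/-- Coordinates on a local ring can be changed so that as many of them as possible
lie in a given ideal `J`: one needs only one more coordinate than the dimension of the
quotient to generate the quotient. -/
theorem exists_coordinates_mem [Infinite k]
    (hk : ∀ c : O, ∃ r : k, c - algebraMap k O r ∈ maximalIdeal O)
    {n : ℕ} {z : Fin n → O} (hzM : ∀ i, z i ∈ maximalIdeal O)
    (hz : fracAdjoin k (Set.range z) = ⊤) {J : Ideal O} (hJ : J ≤ maximalIdeal O) {m : ℕ}
    {w : Fin m → O} (hw : ∀ i, w i ∈ maximalIdeal O)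
    (hwJ : maximalIdeal O ≤ Ideal.span (Set.range w) ⊔ J ⊔ maximalIdeal O ^ 2) (c : ℕ) :
    ∀ a, a + c = n → m + 1 ≤ a → ∃ (x : Fin a → O) (t : Fin c → O), (∀ i, x i ∈ maximalIdeal O) ∧
      (∀ i, t i ∈ J) ∧ fracAdjoin k (Set.range (Sum.elim x t)) = ⊤ := by
  -- Each step projects the germ of `O ⧸ J` from `a + 1` to `a` coordinates and turns the coordinate
  -- lost into an element of `J`.
  induction c with
  | zero =>
    rintro a rfl -
    refine ⟨z, Fin.elim0, hzM, fun i => i.elim0, fracAdjoin_eq_top_of_subset hz ?_⟩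
    rintro _ ⟨i, rfl⟩
    exact subset_fracAdjoin _ ⟨Sum.inl i, rfl⟩
  | succ c ih =>
    intro a hac hma
    obtain ⟨x, t, hx, ht, hxt⟩ := ih (a + 1) (by omega) (by omega)
    have hne : J ≠ ⊤ := fun h => (maximalIdeal.isMaximal O).ne_top (top_le_iff.mp (h ▸ hJ))
    have := Ideal.Quotient.nontrivial_iff.mpr hne
    have : IsLocalRing (O ⧸ J) := .of_surjective' (Ideal.Quotient.mk J) Ideal.Quotient.mk_surjective
    have hloc : IsLocalHom (Ideal.Quotient.mk J) :=
      IsLocalHom.of_surjective _ Ideal.Quotient.mk_surjective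
    have hmk : ∀ μ ∈ maximalIdeal O, Ideal.Quotient.mk J μ ∈ maximalIdeal (O ⧸ J) :=
      fun μ hμ hu => hμ (hloc.map_nonunit μ hu)
    have hkC : ∀ b : O ⧸ J, ∃ r : k, b - algebraMap k (O ⧸ J) r ∈ maximalIdeal (O ⧸ J) := by
      intro b
      obtain ⟨b, rfl⟩ := Ideal.Quotient.mk_surjective b
      obtain ⟨r, hr⟩ := hk b
      exact ⟨r, hmk _ hr⟩
    have hxC : fracAdjoin k (Set.range fun i => Ideal.Quotient.mk J (x i)) = ⊤ := by
      refine fracAdjoin_eq_top_of_surjective (Ideal.Quotient.mkₐ k J)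
        (Ideal.Quotient.mkₐ_surjective k J) hxt ?_
      rintro _ ⟨i | i, rfl⟩
      · exact subset_fracAdjoin _ ⟨i, rfl⟩
      · have : Ideal.Quotient.mkₐ k J (t i) = 0 := Ideal.Quotient.eq_zero_iff_mem.mpr (ht i)
        simp only [Sum.elim_inr, this]
        exact zero_mem _
    have hM : maximalIdeal (O ⧸ J) ≤ Ideal.span (Set.range fun i => Ideal.Quotient.mk J (w i)) ⊔
        maximalIdeal (O ⧸ J) ^ 2 := by
      intro b hb
      obtain ⟨b, rfl⟩ := Ideal.Quotient.mk_surjective b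
      have hbM : b ∈ maximalIdeal O := fun hu => hb (hu.map _)
      have h1 := Ideal.mem_map_of_mem (Ideal.Quotient.mk J) (hwJ hbM)
      rw [Ideal.map_sup, Ideal.map_sup, Ideal.map_quotient_self, sup_bot_eq, Ideal.map_span,
        Ideal.map_pow, ← Set.range_comp] at h1
      have h2 : Ideal.map (Ideal.Quotient.mk J) (maximalIdeal O) ≤ maximalIdeal (O ⧸ J) :=
        Ideal.map_le_iff_le_comap.mpr hmk
      exact (sup_le_sup_left (Ideal.pow_right_mono h2 2) _ : _ ≤ _) h1
    obtain ⟨v, hv⟩ := exists_projection hkC (fun i => hmk _ (hx i)) hxC (fun i => hmk _ (hw i)) hM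
      hma
    let x' : Fin a → O := fun j => x j.castSucc - algebraMap k O (v j) * x (Fin.last a)
    have hx' : ∀ j, x' j ∈ maximalIdeal O := fun j => sub_mem (hx _) (Ideal.mul_mem_left _ _ (hx _))
    obtain ⟨p, q, hu, e⟩ := exists_aeval_of_mem_fracAdjoin
      (show Ideal.Quotient.mk J (x (Fin.last a)) ∈ fracAdjoin k
        (Set.range fun j => Ideal.Quotient.mkₐ k J (x' j)) from by
          have : (fun j => Ideal.Quotient.mkₐ k J (x' j)) = fun j : Fin a =>
            Ideal.Quotient.mk J (x j.castSucc) - algebraMap k (O ⧸ J) (v j) *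
              Ideal.Quotient.mk J (x (Fin.last a)) := by
            funext j
            simp only [x', map_sub, map_mul]
            rfl
          rw [this, hv]
          trivial)
    have hp : ∀ p : MvPolynomial (Fin a) k, aeval (fun j => Ideal.Quotient.mkₐ k J (x' j)) p =
      Ideal.Quotient.mk J (aeval x' p) := fun p => (comp_aeval_apply x' (Ideal.Quotient.mkₐ k J) p).symm
    rw [hp] at hu
    rw [hp, hp, ← map_mul] at e
    -- Modulo `J` the last coordinate equals `p(x') / q(x')`, so `s` lies in `J`. Since `q(x')` is a
    -- unit already in `O`, the last coordinate is recovered as `(s + p(x')) / q(x')`.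
    let s := x (Fin.last a) * aeval x' q - aeval x' p
    refine ⟨x', Fin.cons s t, hx', ?_, fracAdjoin_eq_top_of_subset hxt ?_⟩
    · intro i
      refine Fin.cases (Ideal.Quotient.eq.mp e) (fun i => ?_) i
      simpa using ht i
    · have hx'L : ∀ p : MvPolynomial (Fin a) k, aeval x' p ∈
          fracAdjoin k (Set.range (Sum.elim x' (Fin.cons s t : Fin (c + 1) → O))) := fun p =>
        fracAdjoin_le_fracAdjoin (by
          rintro _ ⟨i, rfl⟩
          exact subset_fracAdjoin _ ⟨Sum.inl i, rfl⟩) (aeval_mem_fracAdjoin x' p)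
      have htL : ∀ i, (Fin.cons s t : Fin (c + 1) → O) i ∈
          fracAdjoin k (Set.range (Sum.elim x' (Fin.cons s t : Fin (c + 1) → O))) := fun i =>
        subset_fracAdjoin _ ⟨Sum.inr i, rfl⟩
      have hlast : x (Fin.last a) ∈
          fracAdjoin k (Set.range (Sum.elim x' (Fin.cons s t : Fin (c + 1) → O))) := by
        refine mem_fracAdjoin_of_mul_mem (hx'L q) (hloc.map_nonunit _ hu) ?_
        have h1 := htL 0
        rw [Fin.cons_zero] at h1
        simpa [s] using add_mem h1 (hx'L p)
      rintro _ ⟨i | i, rfl⟩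
      · refine Fin.lastCases hlast (fun j => ?_) i
        have h2 : x j.castSucc = x' j + algebraMap k O (v j) * x (Fin.last a) := by simp [x']
        rw [Sum.elim_inl, h2]
        exact add_mem (subset_fracAdjoin _ ⟨Sum.inl j, rfl⟩)
          (mul_mem (Subalgebra.algebraMap_mem _ _) hlast)
      · simpa using htL i.succ

end Cotangent

/-! ### Local equations of a smooth germ -/

section LocalStructure

open MvPolynomial IsLocalRing

variable {k O : Type u} [Field k] [CommRing O] [IsLocalRing O] [Algebra k O]

/-- Let `J` be the ideal of a smooth germ in a smooth rational germ `O`. There are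
coordinates `x`, `t` on `O` such that `J` is generated by `t` and a single function of `x`. -/
theorem exists_coordinates_span_eq [Infinite k] [IsNoetherianRing O]
    (hk : ∀ c : O, ∃ r : k, c - algebraMap k O r ∈ maximalIdeal O)
    {n : ℕ} {z : Fin n → O} (hzM : ∀ i, z i ∈ maximalIdeal O)
    (hz : fracAdjoin k (Set.range z) = ⊤)
    (hinj : Function.Injective (aeval z : MvPolynomial (Fin n) k →ₐ[k] O))
    {J : Ideal O} (hJ : J ≤ maximalIdeal O) (hJ0 : J ≠ ⊥)
    (hJM : J ⊓ maximalIdeal O ^ 2 ≤ maximalIdeal O * J) :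
    ∃ (a c : ℕ) (x : Fin a → O) (t : Fin c → O) (g : MvPolynomial (Fin a) k), a + c = n ∧
      (∀ i, x i ∈ maximalIdeal O) ∧ fracAdjoin k (Set.range (Sum.elim x t)) = ⊤ ∧
      J = Ideal.span (insert (aeval x g) (Set.range t)) ∧
      ∃ i, constantCoeff (pderiv i g) ≠ 0 := by
  have hJfg : J.FG := IsNoetherian.noetherian J
  -- The classes of the `z i` form a basis of the cotangent space.
  have hn : Module.finrank (ResidueField O) (CotangentSpace O) = n := by
    have b := Module.Basis.mk (linearIndependent_toCotangent hk hzM hz hinj)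
      (span_toCotangent_eq_top hzM hz).ge
    rw [Module.finrank_eq_card_basis b, Fintype.card_fin]
  obtain ⟨m, w, hw, hwJ, hm⟩ := exists_span_sup_cotangentImage J
  rw [hn] at hm
  -- Otherwise `J` is contained in the square of the maximal ideal, and `hJM` with Nakayama's lemma
  -- gives `J = ⊥`.
  have hU : 0 < Module.finrank (ResidueField O) (cotangentImage J) := by
    by_contra h0
    have h1 : (cotangentImage J) = ⊥ := Submodule.finrank_eq_zero.mp (by omega)
    refine hJ0 (Submodule.eq_bot_of_le_smul_of_le_jacobson_bot (maximalIdeal O) J hJfg ?_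
      (maximalIdeal_le_jacobson _))
    intro j hj
    have h2 : (maximalIdeal O).toCotangent ⟨j, hJ hj⟩ ∈ (cotangentImage J) := ⟨_, hj, rfl⟩
    rw [h1, Submodule.mem_bot, Ideal.toCotangent_eq_zero] at h2
    exact hJM ⟨hj, h2⟩
  -- The projections stop at `m + 1` coordinates, so only `c` of the `c + 1` independent conormal
  -- directions become coordinates; `g` has to supply the remaining one.
  obtain ⟨c, hc⟩ : ∃ c, Module.finrank (ResidueField O) (cotangentImage J) = c + 1 := ⟨_, (Nat.sub_add_cancel hU).symm⟩
  obtain ⟨x, t, hx, ht, hxt⟩ := exists_coordinates_mem hk hzM hz hJ hw hwJ c (m + 1) (by omega)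
    le_rfl
  have hxtM : ∀ i, Sum.elim x t i ∈ maximalIdeal O := by
    rintro (i | i)
    · exact hx i
    · exact hJ (ht i)
  -- The `(m + 1) + c = n` new coordinates span the `n`-dimensional cotangent space, hence are
  -- independent.
  have hli : LinearIndependent (ResidueField O)
      (fun i => ((maximalIdeal O).toCotangent ⟨Sum.elim x t i, hxtM i⟩ : CotangentSpace O)) :=
    linearIndependent_of_top_le_span_of_card_eq_finrank (span_toCotangent_eq_top hxtM hxt).ge
      (by rw [Fintype.card_sum, Fintype.card_fin, Fintype.card_fin, hn]; omega)
  let τ : Fin c → CotangentSpace O := fun i => (maximalIdeal O).toCotangent ⟨t i, hJ (ht i)⟩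
  have hτ : LinearIndependent (ResidueField O) τ := hli.comp Sum.inr Sum.inr_injective
  let T := Submodule.span (ResidueField O) (Set.range τ)
  have hT : Module.finrank (ResidueField O) T = c := by
    rw [finrank_span_eq_card hτ, Fintype.card_fin]
  have hTU : T ≤ (cotangentImage J) := Submodule.span_le.mpr (by
    rintro _ ⟨i, rfl⟩
    exact ⟨_, ht i, rfl⟩)
  obtain ⟨u, huU, huT⟩ : ∃ u ∈ (cotangentImage J), u ∉ T := by
    by_contra! h
    have := Submodule.finrank_mono (show (cotangentImage J) ≤ T from h)
    omega
  have hUeq : (cotangentImage J) = T ⊔ Submodule.span (ResidueField O) {u} := by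
    refine (Submodule.eq_of_le_of_finrank_le
      (sup_le hTU ((Submodule.span_singleton_le_iff_mem _ _).mpr huU)) ?_).symm
    have : T < T ⊔ Submodule.span (ResidueField O) {u} := by
      refine lt_of_le_of_ne le_sup_left fun h => huT ?_
      rw [h]
      exact Submodule.mem_sup_right (Submodule.mem_span_singleton_self u)
    have := Submodule.finrank_lt_finrank_of_lt this
    omega
  obtain ⟨⟨g0, hg0M⟩, hg0, rfl⟩ := huU
  -- By `hJM`, elements that generate the image of `J` in the cotangent space generate `J` modulo
  -- `maximalIdeal O * J`, and so generate `J`.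
  have hJspan : J = Ideal.span (insert g0 (Set.range t)) := by
    refine le_antisymm ?_ (Ideal.span_le.mpr (Set.insert_subset hg0 (by rintro _ ⟨i, rfl⟩; exact ht i)))
    refine Submodule.le_of_le_smul_of_le_jacobson_bot hJfg (maximalIdeal_le_jacobson _) ?_
    intro j hj
    have h1 : (maximalIdeal O).toCotangent ⟨j, hJ hj⟩ ∈ (cotangentImage J) := ⟨_, hj, rfl⟩
    rw [hUeq] at h1
    obtain ⟨v, hv, s, hs, e⟩ := Submodule.mem_sup.mp h1
    obtain ⟨b, rfl⟩ := (Submodule.mem_span_range_iff_exists_fun _).mp hv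
    obtain ⟨d, rfl⟩ := Submodule.mem_span_singleton.mp hs
    choose b' hb' using fun i => residue_surjective (b i)
    obtain ⟨d, rfl⟩ := residue_surjective d
    let y : O := ∑ i, b' i * t i + d * g0
    have hyspan : y ∈ Ideal.span (insert g0 (Set.range t)) := by
      refine add_mem (sum_mem fun i _ => Ideal.mul_mem_left _ _ (Ideal.subset_span ?_))
        (Ideal.mul_mem_left _ _ (Ideal.subset_span ?_))
      · exact Set.mem_insert_of_mem _ ⟨i, rfl⟩
      · exact Set.mem_insert _ _
    have hyJ : y ∈ J := add_mem (sum_mem fun i _ => Ideal.mul_mem_left _ _ (ht i))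
      (Ideal.mul_mem_left _ _ hg0)
    have h2 : (maximalIdeal O).toCotangent ⟨j, hJ hj⟩ = (maximalIdeal O).toCotangent ⟨y, hJ hyJ⟩ := by
      rw [← e, show (⟨y, hJ hyJ⟩ : maximalIdeal O) = ∑ i, b' i • ⟨t i, hJ (ht i)⟩ + d • ⟨g0, hg0M⟩ from
        Subtype.ext (by simp [y]), map_add, map_sum, map_smul]
      congr 1
      refine Finset.sum_congr rfl fun i _ => ?_
      rw [map_smul, ← hb']
      rfl
    rw [Ideal.toCotangent_eq] at h2
    rw [← add_sub_cancel y j]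
    exact Submodule.add_mem_sup hyspan (hJM ⟨sub_mem hj hyJ, h2⟩)
  obtain ⟨p, q, hq, e⟩ := exists_aeval_of_mem_fracAdjoin
    (show g0 ∈ fracAdjoin k (Set.range (Sum.elim x t)) from hxt ▸ Algebra.mem_top)
  -- The denominator of `g0` is a unit, and setting `t = 0` in its numerator changes it only by
  -- elements of `(t)`. The generator thus becomes a polynomial in `x` alone.
  let g : MvPolynomial (Fin (m + 1)) k := aeval (Sum.elim X 0) p
  have hgp : aeval (Sum.elim x t) p - aeval x g ∈ Ideal.span (Set.range t) := by
    clear e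
    induction p using MvPolynomial.induction_on with
    | C r => simp [g]
    | add p p' hp hp' =>
      convert add_mem hp hp' using 1
      simp only [g, map_add]
      ring
    | mul_X p i hp =>
      rcases i with i | i
      · convert Ideal.mul_mem_right (x i) _ hp using 1
        simp only [g, map_mul, aeval_X, Sum.elim_inl]
        ring
      · simp only [g, map_mul, aeval_X, Sum.elim_inr, Pi.zero_apply, mul_zero, map_zero, sub_zero]
        exact Ideal.mul_mem_left _ _ (Ideal.subset_span ⟨i, rfl⟩)
  have hspan : Ideal.span (insert g0 (Set.range t)) =
      Ideal.span (insert (aeval x g) (Set.range t)) := by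
    rw [Ideal.span_insert, Ideal.span_insert]
    refine le_antisymm (sup_le ?_ le_sup_right) (sup_le ?_ le_sup_right)
    · rw [Ideal.span_singleton_le_iff_mem, ← Ideal.mul_unit_mem_iff_mem _ hq, e,
        ← sub_add_cancel (aeval (Sum.elim x t) p) (aeval x g)]
      exact add_mem (Submodule.mem_sup_right hgp)
        (Submodule.mem_sup_left (Ideal.mem_span_singleton_self _))
    · rw [Ideal.span_singleton_le_iff_mem, ← sub_sub_cancel (aeval (Sum.elim x t) p) (aeval x g)]
      refine sub_mem ?_ (Submodule.mem_sup_right hgp)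
      rw [← e]
      exact Submodule.mem_sup_left (Ideal.mul_mem_right _ _ (Ideal.mem_span_singleton_self _))
  refine ⟨m + 1, c, x, t, g, by omega, hx, hxt, hJspan.trans hspan, ?_⟩
  -- If all derivatives vanished at the origin, `g(x)` would lie in the square of the maximal ideal,
  -- and the class of `g0` would be in the span `T` of the classes of `t`.
  by_contra! hd
  have hgJ : aeval x g ∈ J := by
    rw [hJspan, hspan]
    exact Ideal.subset_span (Set.mem_insert _ _)
  have hg2 : aeval x g ∈ maximalIdeal O ^ 2 := by
    have h1 := aeval_sub_linear_mem_sq (maximalIdeal O) hx g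
    have h2 := (aeval_mem_maximalIdeal_iff hx g).mp (hJ hgJ)
    simpa [hd, h2] using h1
  obtain ⟨q', hq'⟩ := hq.exists_right_inv
  obtain ⟨b, hb⟩ := Ideal.mem_span_range_iff_exists_fun.mp hgp
  refine huT ?_
  rw [toCotangent_sum (fun i => hJ (ht i)) (fun i => q' * b i) hg0M]
  · exact sum_mem fun i _ => Submodule.smul_mem _ _ (Submodule.subset_span ⟨i, rfl⟩)
  · have h1 : g0 - ∑ i, q' * b i * t i = q' * aeval x g := by
      simp only [mul_assoc, ← Finset.mul_sum]
      rw [hb, ← e]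
      linear_combination (-g0) * hq'
    rw [h1]
    exact Ideal.mul_mem_left _ _ hg2

end LocalStructure

/-! ### The conormal module of a smooth quotient -/

section SmoothQuotient

/-- If `R ⧸ I` is formally smooth over `k`, the conormal module of `I` injects into the cotangent
space at every point of `V(I)`. -/
theorem inf_sq_le_mul_of_formallySmooth {k R : Type*} [CommRing k] [CommRing R] [Algebra k R]
    {I m : Ideal R} [Algebra.FormallySmooth k (R ⧸ I)] (hI : I ≤ m) : I ⊓ m ^ 2 ≤ m * I := by
  let π : R →ₐ[k] R ⧸ I ^ 2 := Ideal.Quotient.mkₐ k (I ^ 2)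
  let ρ : (R ⧸ I ^ 2) →ₐ[k] R ⧸ I := Ideal.Quotient.factorₐ k (Ideal.pow_le_self two_ne_zero)
  have hle : I ^ 2 ≤ I := Ideal.pow_le_self two_ne_zero
  have hρ : Function.Surjective ρ := Ideal.Quotient.factor_surjective hle
  have hker : RingHom.ker (ρ : (R ⧸ I ^ 2) →+* R ⧸ I) = I.map (Ideal.Quotient.mk (I ^ 2)) :=
    Ideal.Quotient.factor_ker hle
  let K : Ideal (R ⧸ I ^ 2) := I.map (Ideal.Quotient.mk (I ^ 2))
  have hsq : K ^ 2 = ⊥ := by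
    rw [← Ideal.map_pow, Ideal.map_quotient_self]
  -- Formal smoothness splits the square-zero extension `R ⧸ I ^ 2 → R ⧸ I`.
  obtain ⟨σ, hσ⟩ : ∃ σ : R ⧸ I →ₐ[k] R ⧸ I ^ 2, ∀ b, ρ (σ b) = b :=
    ⟨Algebra.FormallySmooth.liftOfSurjective (AlgHom.id k _) ρ hρ ⟨2, by rw [hker]; exact hsq⟩,
      fun b => Algebra.FormallySmooth.liftOfSurjective_apply _ _ _ _ b⟩
  -- This is a derivation into `I / I ^ 2` which restricts to the quotient map on `I`. By Leibniz'
  -- rule it sends `m ^ 2` into the image of `m * I`.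
  let D : R → R ⧸ I ^ 2 := fun f => π f - σ (Ideal.Quotient.mk I f)
  have hD : ∀ f, D f ∈ K := by
    intro f
    have : ρ (D f) = 0 := by
      change ρ (π f - σ (Ideal.Quotient.mk I f)) = 0
      rw [map_sub, hσ, sub_eq_zero]
      rfl
    have h2 : D f ∈ RingHom.ker (ρ : (R ⧸ I ^ 2) →+* R ⧸ I) := this
    rwa [hker] at h2
  let N : Ideal (R ⧸ I ^ 2) := (m * I).map (Ideal.Quotient.mk (I ^ 2))
  have hN : ∀ a ∈ m, ∀ b, D b * π a ∈ N := by
    intro a ha b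
    have h1 : π a * D b ∈ m.map (Ideal.Quotient.mk (I ^ 2)) * K :=
      Ideal.mul_mem_mul (Ideal.mem_map_of_mem _ ha) (hD b)
    rw [← Ideal.map_mul] at h1
    rwa [mul_comm (D b)]
  have hDm : ∀ f ∈ m ^ 2, D f ∈ N := by
    intro f hf
    rw [pow_two] at hf
    induction hf using Submodule.mul_induction_on' with
    | mem_mul_mem a ha b hb =>
      have h0 : D a * D b = 0 := by
        have : D a * D b ∈ K ^ 2 := by
          exact pow_two K ▸ Ideal.mul_mem_mul (hD a) (hD b)
        rwa [hsq] at this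
      have h1 : D (a * b) = D a * π b + D b * π a - D a * D b := by
        simp only [D, map_mul]
        ring
      rw [h1, h0, sub_zero]
      exact add_mem (hN b hb a) (hN a ha b)
    | add a _ b _ ha hb =>
      have : D (a + b) = D a + D b := by
        simp only [D, map_add]
        ring
      rw [this]
      exact add_mem ha hb
  rintro f ⟨hfI, hfm⟩
  have h1 := hDm f hfm
  have h2 : D f = Ideal.Quotient.mk (I ^ 2) f := by
    simp only [D]
    rw [Ideal.Quotient.eq_zero_iff_mem.mpr hfI, map_zero, sub_zero]
    rfl
  rw [h2, Ideal.mem_quotient_iff_mem_sup] at h1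
  refine (sup_le le_rfl ?_ : m * I ⊔ I ^ 2 ≤ m * I) h1
  rw [pow_two]
  exact Ideal.mul_mono_left hI

theorem map_inf_sq_le_mul_of_isLocalization {R O : Type*} [CommRing R] [CommRing O] [Algebra R O]
    (S : Submonoid R) [IsLocalization S O] {I m : Ideal R} (h : I ⊓ m ^ 2 ≤ m * I) :
    I.map (algebraMap R O) ⊓ m.map (algebraMap R O) ^ 2 ≤
      m.map (algebraMap R O) * I.map (algebraMap R O) := by
  rintro f ⟨hf1, hf2⟩
  rw [SetLike.mem_coe, ← Ideal.map_pow] at hf2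
  obtain ⟨⟨⟨a, ha⟩, s⟩, e1⟩ := (IsLocalization.mem_map_algebraMap_iff S O).mp hf1
  obtain ⟨⟨⟨b, hb⟩, t⟩, e2⟩ := (IsLocalization.mem_map_algebraMap_iff S O).mp hf2
  have e3 : algebraMap R O (a * t) = algebraMap R O (b * s) := by
    rw [map_mul, map_mul, ← e1, ← e2]
    ring
  obtain ⟨c, hc⟩ := (IsLocalization.eq_iff_exists S O).mp e3
  have h1 : (c : R) * (a * t) ∈ m * I := h ⟨I.mul_mem_left _ (I.mul_mem_right _ ha), by
    rw [hc]; exact Ideal.mul_mem_left _ _ (Ideal.mul_mem_right _ _ hb)⟩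
  rw [← Ideal.map_mul]
  have h2 := Ideal.mem_map_of_mem (algebraMap R O) h1
  rw [map_mul, map_mul, ← e1] at h2
  have h3 := IsLocalization.map_units O c
  have h4 := IsLocalization.map_units O s
  have h5 := IsLocalization.map_units O t
  rw [Ideal.unit_mul_mem_iff_mem _ h3, Ideal.mul_unit_mem_iff_mem _ h5,
    Ideal.mul_unit_mem_iff_mem _ h4] at h2
  exact h2

end SmoothQuotient

/-! ### From a local ring to a basic open -/

section SpreadOut

open MvPolynomial

/-- Coordinates at a local ring of `R` extend to coordinates on a basic open. -/
theorem exists_coordinates_away {k R O : Type u} [CommRing k] [CommRing R] [CommRing O]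
    [Algebra k R] [Algebra R O] [Algebra k O] [IsScalarTower k R O] [Algebra.FiniteType k R]
    [IsNoetherianRing R] (M : Submonoid R) [IsLocalization M O] (I : Ideal R) {a c : ℕ}
    (x : Fin a → O) (t : Fin c → O) (g : MvPolynomial (Fin a) k)
    (hxt : fracAdjoin k (Set.range (Sum.elim x t)) = ⊤)
    (hI : I.map (algebraMap R O) = Ideal.span (insert (aeval x g) (Set.range t))) :
    ∃ s ∈ M, ∀ (R' : Type u) [CommRing R'] [Algebra R R'] [Algebra R' O] [IsScalarTower R R' O]
      [Algebra k R'] [IsScalarTower k R R'] [IsScalarTower k R' O] [IsLocalization.Away s R'],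
      Function.Injective (algebraMap R' O) →
      ∃ (x' : Fin a → R') (t' : Fin c → R'), (∀ i, algebraMap R' O (x' i) = x i) ∧
        (∀ i, algebraMap R' O (t' i) = t i) ∧
        fracAdjoin k (Set.range (Sum.elim x' t')) = ⊤ ∧
        I.map (algebraMap R R') = Ideal.span (insert (aeval x' g) (Set.range t')) := by
  classical
  obtain ⟨gens, hgens⟩ := (Algebra.FiniteType.out : (⊤ : Subalgebra k R).FG)
  have hpq : ∀ r : R, ∃ (p q : MvPolynomial (Fin a ⊕ Fin c) k) (v : O),
      aeval (Sum.elim x t) q * v = 1 ∧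
      algebraMap R O r * aeval (Sum.elim x t) q = aeval (Sum.elim x t) p := fun r => by
    obtain ⟨p, q, hu, e⟩ := exists_aeval_of_mem_fracAdjoin
      (show algebraMap R O r ∈ fracAdjoin k (Set.range (Sum.elim x t)) from hxt ▸ Algebra.mem_top)
    obtain ⟨v, hv⟩ := hu.exists_right_inv
    exact ⟨p, q, v, hv, e⟩
  choose p q v hv hpq using hpq
  obtain ⟨N, f, hf⟩ := Submodule.fg_iff_exists_fin_generating_family.mp (IsNoetherian.noetherian I)
  have hf' : I.map (algebraMap R O) = Ideal.span (Set.range fun l => algebraMap R O (f l)) := by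
    conv_lhs => rw [show I = Ideal.span (Set.range f) from hf.symm]
    rw [Ideal.map_span, ← Set.range_comp]
    rfl
  have hgt : ∀ b ∈ insert (aeval x g) (Set.range t), ∃ d : Fin N → O,
      ∑ l, d l * algebraMap R O (f l) = b := fun b hb => by
    have : b ∈ I.map (algebraMap R O) := hI ▸ Ideal.subset_span hb
    rwa [hf', Ideal.mem_span_range_iff_exists_fun] at this
  obtain ⟨dg, hdg⟩ := hgt _ (Set.mem_insert _ _)
  choose dt hdt using fun j => hgt (t j) (Set.mem_insert_of_mem _ ⟨j, rfl⟩)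
  have hfs : ∀ l, ∃ (b : O) (d : Fin c → O),
      b * aeval x g + ∑ j, d j * t j = algebraMap R O (f l) := fun l => by
    have : algebraMap R O (f l) ∈ I.map (algebraMap R O) := hf' ▸ Ideal.subset_span ⟨l, rfl⟩
    rw [hI, Ideal.mem_span_insert] at this
    obtain ⟨b, y, hy, e⟩ := this
    obtain ⟨d, hd⟩ := Ideal.mem_span_range_iff_exists_fun.mp hy
    exact ⟨b, d, by rw [e, hd]⟩
  choose bf df hbf using hfs
  -- All data in `O` that witness the two claims: the coordinates, the inverses of the denominators
  -- for generators of `R`, and the coefficients that express two generating sets of the ideal in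
  -- each other. After inverting a common denominator `s` they live in `R'`, and injectivity of `R'
  -- → O` carries the identities back.
  let F : Finset O := Finset.univ.image x ∪ Finset.univ.image t ∪ gens.image v ∪
    Finset.univ.image dg ∪ Finset.univ.image (Function.uncurry dt) ∪ Finset.univ.image bf ∪
    Finset.univ.image (Function.uncurry df)
  obtain ⟨s, hs⟩ := IsLocalization.exist_integer_multiples_of_finset M F
  refine ⟨s, s.2, fun R' _ _ _ _ _ _ _ _ hinj => ?_⟩
  have hlift : ∀ b ∈ F, ∃ b' : R', algebraMap R' O b' = b := by
    intro b hb
    obtain ⟨r, hr⟩ := hs b hb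
    obtain ⟨w, hw⟩ := (IsLocalization.Away.algebraMap_isUnit (S := R') (s : R)).exists_left_inv
    refine ⟨w * algebraMap R R' r, ?_⟩
    rw [map_mul, ← IsScalarTower.algebraMap_apply, hr, Algebra.smul_def,
      IsScalarTower.algebraMap_apply R R' O, ← mul_assoc, ← map_mul, hw, map_one, one_mul]
  have hmemx : ∀ i, x i ∈ F := fun i => by simp [F]
  have hmemt : ∀ i, t i ∈ F := fun i => by simp [F]
  have hmemv : ∀ r ∈ gens, v r ∈ F := fun r hr => by
    simp only [F, Finset.mem_union, Finset.mem_image]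
    exact .inl (.inl (.inl (.inl (.inr ⟨r, hr, rfl⟩))))
  have hmemdg : ∀ i, dg i ∈ F := fun i => by simp [F]
  have hmemdt : ∀ j i, dt j i ∈ F := fun j i => by
    simp only [F, Finset.mem_union, Finset.mem_image]
    exact .inl (.inl (.inr ⟨(j, i), Finset.mem_univ _, rfl⟩))
  have hmembf : ∀ i, bf i ∈ F := fun i => by simp [F]
  have hmemdf : ∀ j i, df j i ∈ F := fun j i => by
    simp only [F, Finset.mem_union, Finset.mem_image]
    exact .inr ⟨(j, i), Finset.mem_univ _, rfl⟩
  choose x' hx' using fun i => hlift _ (hmemx i)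
  choose t' ht' using fun i => hlift _ (hmemt i)
  choose dg' hdg' using fun i => hlift _ (hmemdg i)
  choose dt' hdt' using fun j i => hlift _ (hmemdt j i)
  choose bf' hbf' using fun i => hlift _ (hmembf i)
  choose df' hdf' using fun j i => hlift _ (hmemdf j i)
  have haeval : ∀ p : MvPolynomial (Fin a ⊕ Fin c) k,
      algebraMap R' O (aeval (Sum.elim x' t') p) = aeval (Sum.elim x t) p := fun p => by
    have h1 : (fun i => algebraMap R' O (Sum.elim x' t' i)) = Sum.elim x t := by
      funext i
      rcases i with i | i
      · exact hx' i
      · exact ht' i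
    rw [← h1]
    exact (aeval_algebraMap_apply O _ p).symm
  have haevalx : algebraMap R' O (aeval x' g) = aeval x g := by
    have h1 : (fun i => algebraMap R' O (x' i)) = x := funext hx'
    rw [← h1]
    exact (aeval_algebraMap_apply O _ g).symm
  refine ⟨x', t', hx', ht', ?_, ?_⟩
  · have hR : ∀ r : R, algebraMap R R' r ∈ fracAdjoin k (Set.range (Sum.elim x' t')) := by
      intro r
      have h1 : (⊤ : Subalgebra k R) ≤ (fracAdjoin k (Set.range (Sum.elim x' t'))).comap
          (IsScalarTower.toAlgHom k R R') := by
        rw [← hgens]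
        refine Algebra.adjoin_le fun r hr => ?_
        obtain ⟨v', hv'⟩ := hlift _ (hmemv r hr)
        refine mem_fracAdjoin_of_mul_mem (aeval_mem_fracAdjoin _ (q r))
          (IsUnit.of_mul_eq_one v' (hinj ?_)) ?_
        · rw [map_mul, haeval, hv', hv, map_one]
        · have : algebraMap R R' r * aeval (Sum.elim x' t') (q r) = aeval (Sum.elim x' t') (p r) :=
            hinj (by rw [map_mul, haeval, haeval, ← IsScalarTower.algebraMap_apply, hpq])
          have h2 := aeval_mem_fracAdjoin (Sum.elim x' t') (p r)
          rwa [← this] at h2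
      exact h1 (Algebra.mem_top : r ∈ (⊤ : Subalgebra k R))
    refine top_le_iff.mp fun b _ => ?_
    obtain ⟨n, r, hr⟩ := IsLocalization.Away.surj (s : R) b
    exact mem_fracAdjoin_of_mul_mem (pow_mem (hR s) n)
      ((IsLocalization.Away.algebraMap_isUnit (S := R') (s : R)).pow n) (hr ▸ hR r)
  · have hf'' : I.map (algebraMap R R') = Ideal.span (Set.range fun l => algebraMap R R' (f l)) := by
      conv_lhs => rw [show I = Ideal.span (Set.range f) from hf.symm]
      rw [Ideal.map_span, ← Set.range_comp]
      rfl
    refine le_antisymm ?_ (Ideal.span_le.mpr (Set.insert_subset ?_ ?_))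
    · rw [hf'', Ideal.span_le]
      rintro _ ⟨l, rfl⟩
      have : algebraMap R R' (f l) = bf' l * aeval x' g + ∑ j, df' l j * t' j := hinj (by
        simp only [map_add, map_mul, map_sum, haevalx, ht', hbf', hdf', hbf,
          ← IsScalarTower.algebraMap_apply])
      simp only [SetLike.mem_coe, this]
      exact add_mem (Ideal.mul_mem_left _ _ (Ideal.subset_span (Set.mem_insert _ _)))
        (sum_mem fun j _ => Ideal.mul_mem_left _ _
          (Ideal.subset_span (Set.mem_insert_of_mem _ ⟨j, rfl⟩)))
    · have : aeval x' g = ∑ l, dg' l * algebraMap R R' (f l) := hinj (by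
        simp only [map_mul, map_sum, haevalx, hdg', hdg, ← IsScalarTower.algebraMap_apply])
      rw [this, hf'']
      exact sum_mem fun l _ => Ideal.mul_mem_left _ _ (Ideal.subset_span ⟨l, rfl⟩)
    · rintro _ ⟨j, rfl⟩
      have : t' j = ∑ l, dt' j l * algebraMap R R' (f l) := hinj (by
        simp only [map_mul, map_sum, ht', hdt', hdt, ← IsScalarTower.algebraMap_apply])
      rw [this, hf'']
      exact sum_mem fun l _ => Ideal.mul_mem_left _ _ (Ideal.subset_span ⟨l, rfl⟩)

end SpreadOut

/-! ### Coordinates as open immersions into affine space -/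

section OpenImmersion

open MvPolynomial

/-- Every element is a root of some `q X - p` with `q ≠ 0`, so `A` is algebraic over the algebra
generated by the `n` elements `y`. The transcendence degree is at least `n`, which makes `y` a
transcendence basis. -/
theorem AlgebraicIndependent.of_fracAdjoin_eq_top {k A : Type u} [Field k] [CommRing A] [IsDomain A]
    [Algebra k A] {n : ℕ} {z : Fin n → A} (hz : AlgebraicIndependent k z) {ι : Type} [Fintype ι]
    (hι : Fintype.card ι = n) {y : ι → A} (hy : fracAdjoin k (Set.range y) = ⊤) :
    AlgebraicIndependent k y := by
  have : Algebra.IsAlgebraic (Algebra.adjoin k (Set.range y)) A := by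
    refine ⟨fun r => ?_⟩
    obtain ⟨p, hp, q, hq, hu, e⟩ : r ∈ fracAdjoin k (Set.range y) := hy ▸ Algebra.mem_top
    refine ⟨Polynomial.C ⟨q, hq⟩ * Polynomial.X - Polynomial.C ⟨p, hp⟩, ?_, ?_⟩
    · intro h0
      have h1 := congrArg (fun f => Polynomial.coeff f 1) h0
      simp [Polynomial.coeff_C] at h1
      exact hu.ne_zero (congrArg Subtype.val h1)
    · simp only [map_sub, map_mul, Polynomial.aeval_C, Polynomial.aeval_X]
      rw [sub_eq_zero]
      exact (mul_comm q r).trans e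
  refine (Algebra.IsAlgebraic.isTranscendenceBasis_of_lift_le_trdeg_of_finite k y ?_).1
  have h1 := hz.lift_cardinalMk_le_trdeg
  simpa [hι] using h1

/-- A domain which is generated by as many elements as its transcendence degree,
up to inverses of units, is a localization of a polynomial ring. -/
theorem isOpenImmersion_aeval_of_fracAdjoin_eq_top {k A : Type u} [Field k] [CommRing A]
    [IsDomain A] [Algebra k A] [Algebra.FiniteType k A] {n : ℕ} {z : Fin n → A}
    (hz : AlgebraicIndependent k z) {y : ULift.{u} (Fin n) → A}
    (hy : fracAdjoin k (Set.range y) = ⊤) :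
    IsOpenImmersion (Spec.map (CommRingCat.ofHom
      (aeval y : MvPolynomial (ULift.{u} (Fin n)) k →ₐ[k] A).toRingHom)) := by
  classical
  have hinj : Function.Injective (aeval y : MvPolynomial (ULift.{u} (Fin n)) k →ₐ[k] A) := by
    have h1 : AlgebraicIndependent k (fun i : Fin n => y ⟨i⟩) := by
      refine hz.of_fracAdjoin_eq_top (Fintype.card_fin n) ?_
      rw [← hy]
      congr 1
      ext b
      exact ⟨fun ⟨i, hi⟩ => ⟨⟨i⟩, hi⟩, fun ⟨i, hi⟩ => ⟨i.1, hi⟩⟩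
    exact (algebraicIndependent_equiv' Equiv.ulift.symm rfl).mp h1
  obtain ⟨gens, hgens⟩ := (Algebra.FiniteType.out : (⊤ : Subalgebra k A).FG)
  choose p q hq hpq using fun r : A => exists_aeval_of_mem_fracAdjoin
    (show r ∈ fracAdjoin k (Set.range y) from hy ▸ Algebra.mem_top)
  -- A common denominator of finitely many algebra generators suffices, and `A` is the localization
  -- of the polynomial ring away from `h`.
  let h : MvPolynomial (ULift.{u} (Fin n)) k := ∏ r ∈ gens, q r
  let := (aeval y : MvPolynomial (ULift.{u} (Fin n)) k →ₐ[k] A).toRingHom.toAlgebra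
  have hmap : ∀ p : MvPolynomial (ULift.{u} (Fin n)) k, algebraMap _ A p = aeval y p := fun _ => rfl
  have hu : IsUnit (aeval y h) := by
    rw [map_prod]
    exact IsUnit.prod_iff.mpr fun r _ => hq r
  let T : Subalgebra k A :=
    { carrier := {r | ∃ (N : ℕ) (p : MvPolynomial (ULift.{u} (Fin n)) k),
        r * aeval y h ^ N = aeval y p}
      mul_mem' := by
        rintro a b ⟨N, p, e⟩ ⟨N', p', e'⟩
        exact ⟨N + N', p * p', by rw [map_mul, ← e, ← e']; ring⟩
      add_mem' := by
        rintro a b ⟨N, p, e⟩ ⟨N', p', e'⟩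
        refine ⟨N + N', p * h ^ N' + p' * h ^ N, ?_⟩
        rw [map_add, map_mul, map_mul, map_pow, map_pow, ← e, ← e']
        ring
      algebraMap_mem' := fun r => ⟨0, MvPolynomial.C r, by simp⟩ }
  have hT : ∀ r : A, r ∈ T := by
    have : (⊤ : Subalgebra k A) ≤ T := by
      rw [← hgens]
      refine Algebra.adjoin_le fun r hr => ⟨1, p r * ∏ r' ∈ gens.erase r, q r', ?_⟩
      rw [pow_one, show h = q r * ∏ r' ∈ gens.erase r, q r' from
        (Finset.mul_prod_erase gens q hr).symm, map_mul, map_mul, ← mul_assoc, hpq]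
    exact fun r => this trivial
  have : IsLocalization.Away h A := by
    refine IsLocalization.Away.mk h hu (fun r => ?_) fun a b hab => ⟨0, by rw [hinj hab]⟩
    obtain ⟨N, p, e⟩ := hT r
    exact ⟨N, p, e⟩
  exact IsOpenImmersion.of_isLocalization h

end OpenImmersion

/-! ### Affine charts of the blow-up -/

namespace BlowUp

section Chart

open Polynomial HomogeneousLocalization

variable {R : Type u} [CommRing R] (I : Ideal R)

/-- The element `b tⁿ` of the Rees algebra, for `b ∈ Iⁿ`. -/
noncomputable def reesMonomial (n : ℕ) (b : R) (hb : b ∈ I ^ n) : reesAlgebra I :=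
  ⟨monomial n b, reesAlgebra.monomial_mem.mpr hb⟩

theorem reesMonomial_mem (n : ℕ) (b : R) (hb : b ∈ I ^ n) :
    reesMonomial I n b hb ∈ reesGrading I n := fun m hm => by
  simp [reesMonomial, coeff_monomial, hm.symm]

theorem eq_reesMonomial {n : ℕ} {y : reesAlgebra I} (hy : y ∈ reesGrading I n) :
    y = reesMonomial I n ((y : R[X]).coeff n) (y.2 n) := by
  apply Subtype.ext
  ext m
  by_cases hm : m = n
  · subst hm; simp [reesMonomial]
  · rw [hy m hm]; simp [reesMonomial, coeff_monomial, Ne.symm hm]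

theorem reesMonomial_add (n : ℕ) {b c : R} (hb : b ∈ I ^ n) (hc : c ∈ I ^ n) :
    reesMonomial I n (b + c) (add_mem hb hc) = reesMonomial I n b hb + reesMonomial I n c hc :=
  Subtype.ext (by simp [reesMonomial])

theorem reesMonomial_mul {n m : ℕ} {b c : R} (hb : b ∈ I ^ n) (hc : c ∈ I ^ m)
    (hbc : b * c ∈ I ^ (n + m)) :
    reesMonomial I (n + m) (b * c) hbc = reesMonomial I n b hb * reesMonomial I m c hc :=
  Subtype.ext (by simp [reesMonomial, monomial_mul_monomial])

theorem algebraMap_mul_reesMonomial {n : ℕ} (r : R) {b : R} (hb : b ∈ I ^ n) :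
    algebraMap R (reesAlgebra I) r * reesMonomial I n b hb =
      reesMonomial I n (r * b) (Ideal.mul_mem_left _ _ hb) :=
  Subtype.ext (by simp [reesMonomial, C_mul_monomial])

variable {I} {γ : R} (hγ : γ ∈ I)

/-- The degree one element `γ t` of the Rees algebra, for `γ ∈ I`. -/
noncomputable def reesVar (hγ : γ ∈ I) : reesAlgebra I :=
  reesMonomial I 1 γ (by rwa [pow_one])

theorem reesVar_mem : reesVar hγ ∈ reesGrading I 1 := reesMonomial_mem I _ _ _

/-- The fraction `b tⁿ / (γ t)ⁿ`, for `b ∈ Iⁿ`. -/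
noncomputable def awayFrac (n : ℕ) (b : R) (hb : b ∈ I ^ n) :
    Away (reesGrading I) (reesVar hγ) :=
  Away.mk (reesGrading I) (reesVar_mem hγ) n (reesMonomial I n b hb)
    (by rw [smul_eq_mul, mul_one]; exact reesMonomial_mem I n b hb)

theorem val_awayFrac (n : ℕ) (b : R) (hb : b ∈ I ^ n) : (awayFrac hγ n b hb).val =
    Localization.mk (reesMonomial I n b hb) (⟨reesVar hγ ^ n, n, rfl⟩ : Submonoid.powers (reesVar hγ)) :=
  Away.val_mk _ _ _ _ _

theorem awayFrac_surjective (z : Away (reesGrading I) (reesVar hγ)) :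
    ∃ (n : ℕ) (b : R) (hb : b ∈ I ^ n), awayFrac hγ n b hb = z := by
  obtain ⟨n, y, hy, rfl⟩ := Away.mk_surjective (reesGrading I) (reesVar_mem hγ) z
  refine ⟨n, (y : R[X]).coeff n, y.2 n, ?_⟩
  have hy' : y ∈ reesGrading I n := by rwa [smul_eq_mul, mul_one] at hy
  ext
  rw [val_awayFrac, Away.val_mk, ← eq_reesMonomial I hy']

theorem awayFrac_add (n : ℕ) {b c : R} (hb : b ∈ I ^ n) (hc : c ∈ I ^ n) :
    awayFrac hγ n (b + c) (add_mem hb hc) = awayFrac hγ n b hb + awayFrac hγ n c hc := by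
  ext
  rw [val_add, val_awayFrac, val_awayFrac, val_awayFrac, reesMonomial_add, Localization.add_mk_self]

theorem awayFrac_zero (n : ℕ) : awayFrac hγ n 0 (zero_mem _) = 0 := by
  ext
  have h : reesMonomial I n 0 (zero_mem _) = 0 := Subtype.ext (by simp [reesMonomial])
  rw [val_awayFrac, val_zero, h, Localization.mk_zero]

theorem awayFrac_mul {n m : ℕ} {b c : R} (hb : b ∈ I ^ n) (hc : c ∈ I ^ m)
    (hbc : b * c ∈ I ^ (n + m)) :
    awayFrac hγ (n + m) (b * c) hbc = awayFrac hγ n b hb * awayFrac hγ m c hc := by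
  ext
  rw [val_mul, val_awayFrac, val_awayFrac, val_awayFrac, reesMonomial_mul I hb hc,
    Localization.mk_mul]
  congr 1
  exact Subtype.ext (pow_add _ _ _)

theorem awayStr_mul_awayFrac {n : ℕ} (r : R) {b : R} (hb : b ∈ I ^ n) :
    awayStr (reesGrading I) (reesVar hγ) r * awayFrac hγ n b hb =
      awayFrac hγ n (r * b) (Ideal.mul_mem_left _ _ hb) := by
  ext
  rw [val_mul, val_awayFrac, val_awayFrac, val_awayStr, ← algebraMap_mul_reesMonomial,
    ← Localization.mk_one_eq_algebraMap, Localization.mk_mul, one_mul]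

theorem awayFrac_zero_eq (r : R) (hr : r ∈ I ^ 0) :
    awayFrac hγ 0 r hr = awayStr (reesGrading I) (reesVar hγ) r := by
  ext
  rw [val_awayFrac, val_awayStr, ← Localization.mk_one_eq_algebraMap]
  congr 1

theorem awayFrac_self (h : γ ∈ I ^ 1) : awayFrac hγ 1 γ h = 1 := by
  ext
  rw [val_awayFrac, val_one, ← Localization.mk_one]
  refine Localization.mk_eq_mk_iff.mpr (Localization.r_of_eq ?_)
  simp [reesVar]

theorem awayStr_eq_mul (b : R) (hb : b ∈ I ^ 1) :
    awayStr (reesGrading I) (reesVar hγ) b =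
      awayStr (reesGrading I) (reesVar hγ) γ * awayFrac hγ 1 b hb := by
  rw [awayStr_mul_awayFrac, ← mul_one (awayStr _ _ b), ← awayFrac_self hγ (by rwa [pow_one]),
    awayStr_mul_awayFrac]
  simp only [mul_comm]

instance [IsDomain R] : IsDomain (reesAlgebra I) := inferInstance

theorem reesVar_ne_zero (h : γ ≠ 0) : reesVar hγ ≠ 0 := fun h0 => by
  have h1 := congrArg (fun y : reesAlgebra I => (y : R[X]).coeff 1) h0
  exact h (by simpa [reesVar, reesMonomial] using h1)

theorem isDomain_away {A S : Type*} [CommRing A] [CommRing S] [Algebra A S] (𝒜 : ℕ → Submodule A S)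
    [GradedAlgebra 𝒜] [IsDomain S] {s : S} (hs : s ≠ 0) : IsDomain (Away 𝒜 s) := by
  have : IsDomain (Localization.Away s) := IsLocalization.isDomain_localization
    (powers_le_nonZeroDivisors_of_noZeroDivisors hs)
  exact (val_injective (𝒜 := 𝒜) (Submonoid.powers s)).isDomain
    (algebraMap (Away 𝒜 s) (Localization.Away s))

theorem awayStr_injective [IsDomain R] (h : γ ≠ 0) :
    Function.Injective (awayStr (reesGrading I) (reesVar hγ)) := by
  intro a b hab
  have h1 := congrArg val hab
  rw [val_awayStr, val_awayStr] at h1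
  have h2 := IsLocalization.injective (Localization.Away (reesVar hγ))
    (powers_le_nonZeroDivisors_of_noZeroDivisors (reesVar_ne_zero hγ h)) h1
  exact FaithfulSMul.algebraMap_injective R (reesAlgebra I) h2

/-- The chart of the blow-up at a generator `γ` of the ideal `(γ, t)` is generated by the
fractions `t / γ`. -/
theorem awayFrac_mem_of_span_eq {ι : Type*} {t : ι → R}
    (hI : I = Ideal.span (insert γ (Set.range t))) (htI : ∀ j, t j ∈ I ^ 1)
    (T : Subring (Away (reesGrading I) (reesVar hγ)))
    (hT : ∀ r, awayStr (reesGrading I) (reesVar hγ) r ∈ T)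
    (hTt : ∀ j, awayFrac hγ 1 (t j) (htI j) ∈ T) (z : Away (reesGrading I) (reesVar hγ)) :
    z ∈ T := by
  obtain ⟨n, b, hb, rfl⟩ := awayFrac_surjective hγ z
  have h1 : ∀ b (hb : b ∈ I ^ 1), awayFrac hγ 1 b hb ∈ T := by
    intro b hb
    have hb' := hb
    rw [pow_one, hI] at hb'
    induction hb' using Submodule.span_induction with
    | mem y hy =>
      rcases hy with rfl | ⟨j, rfl⟩
      · rw [awayFrac_self]; exact one_mem _
      · exact hTt j
    | zero => rw [awayFrac_zero]; exact zero_mem _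
    | add y z hy hz hy' hz' =>
      have e1 : y ∈ I ^ 1 := by rw [pow_one, hI]; exact hy
      have e2 : z ∈ I ^ 1 := by rw [pow_one, hI]; exact hz
      rw [awayFrac_add hγ 1 e1 e2]
      exact add_mem (hy' e1) (hz' e2)
    | smul r y hy hy' =>
      have e1 : y ∈ I ^ 1 := by rw [pow_one, hI]; exact hy
      simp only [smul_eq_mul]
      rw [← awayStr_mul_awayFrac hγ r e1]
      exact mul_mem (hT r) (hy' e1)
  induction n generalizing b with
  | zero => rw [awayFrac_zero_eq]; exact hT b
  | succ n ih =>
    have hb' := hb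
    rw [pow_succ] at hb'
    induction hb' using Submodule.mul_induction_on' with
    | mem_mul_mem y hy z hz =>
      rw [awayFrac_mul hγ hy (by rwa [pow_one])]
      exact mul_mem (ih y hy) (h1 z _)
    | add y hy z hz hy' hz' =>
      rw [← pow_succ] at hy hz
      rw [awayFrac_add hγ _ hy hz]
      exact add_mem (hy' hy) (hz' hz)

/-- The chart of the blow-up of `(g(x), t)`, where `x` and `t` are coordinates, at the generator
`g(x)` is an open subscheme of affine space. -/
theorem exists_isOpenImmersion_away {k : Type u} [Field k] [Algebra k R] [IsDomain R]
    [Algebra.FiniteType k R] {n a c : ℕ} {z : Fin n → R} (hz : AlgebraicIndependent k z)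
    (hac : a + c = n) {x : Fin a → R} {t : Fin c → R}
    (hxt : fracAdjoin k (Set.range (Sum.elim x t)) = ⊤) {g : MvPolynomial (Fin a) k}
    (hI : I = Ideal.span (insert (MvPolynomial.aeval x g) (Set.range t)))
    (hg : MvPolynomial.aeval x g ∈ I) (hg0 : MvPolynomial.aeval x g ≠ 0) :
    ∃ θ : MvPolynomial (ULift.{u} (Fin n)) k →+* Away (reesGrading I) (reesVar hg),
      IsOpenImmersion (Spec.map (CommRingCat.ofHom θ)) ∧
      θ.comp MvPolynomial.C = (awayStr (reesGrading I) (reesVar hg)).comp (algebraMap k R) := by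
  classical
  set γ := MvPolynomial.aeval x g with hγ
  let A := Away (reesGrading I) (reesVar hg)
  let ρ : R →+* A := awayStr (reesGrading I) (reesVar hg)
  have hρ : Function.Injective ρ := awayStr_injective hg hg0
  let : Algebra k A := (ρ.comp (algebraMap k R)).toAlgebra
  let ρ' : R →ₐ[k] A := { ρ with commutes' := fun _ => rfl }
  have htI : ∀ j, t j ∈ I ^ 1 := fun j => by
    rw [pow_one, hI]
    exact Ideal.subset_span (Set.mem_insert_of_mem _ ⟨j, rfl⟩)
  -- The coordinates of the chart are `x` and `t_j / γ`, again `a + c = n` in number.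
  let w : Fin a ⊕ Fin c → A := Sum.elim (fun i => ρ (x i)) fun j => awayFrac hg 1 (t j) (htI j)
  have : IsDomain A := isDomain_away _ (reesVar_ne_zero hg hg0)
  have hw : fracAdjoin k (Set.range w) = ⊤ := by
    have hx : ∀ i, ρ (x i) ∈ fracAdjoin k (Set.range w) := fun i =>
      subset_fracAdjoin _ ⟨Sum.inl i, rfl⟩
    -- It is essential here that `γ = g(x)` does not involve `t`: it is a polynomial in the new
    -- coordinates, whence so is `t_j = γ · (t_j / γ)`.
    have hγw : ρ γ ∈ fracAdjoin k (Set.range w) := by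
      have h1 : ρ' γ = MvPolynomial.aeval (fun i => ρ' (x i)) g :=
        MvPolynomial.comp_aeval_apply x ρ' g
      have h2 := aeval_mem_fracAdjoin (k := k) (fun i => ρ' (x i)) g
      rw [← h1] at h2
      refine fracAdjoin_le_fracAdjoin ?_ h2
      rintro _ ⟨i, rfl⟩
      exact hx i
    have hR : ∀ r, ρ r ∈ fracAdjoin k (Set.range w) := fun r => by
      refine map_mem_fracAdjoin ρ' (s := Set.range (Sum.elim x t)) ?_ (hxt ▸ Algebra.mem_top)
      rintro _ ⟨i | j, rfl⟩
      · exact hx i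
      · have h1 : ρ (t j) = ρ γ * awayFrac hg 1 (t j) (htI j) := awayStr_eq_mul hg (t j) (htI j)
        change ρ (t j) ∈ _
        rw [h1]
        exact mul_mem hγw (subset_fracAdjoin _ ⟨Sum.inr j, rfl⟩)
    refine top_le_iff.mp fun b _ => ?_
    exact awayFrac_mem_of_span_eq hg hI htI (fracAdjoin k (Set.range w)).toSubring hR
      (fun j => subset_fracAdjoin _ ⟨Sum.inr j, rfl⟩) b
  have hft : Algebra.FiniteType k A := by
    obtain ⟨gens, hgens⟩ := (Algebra.FiniteType.out : (⊤ : Subalgebra k R).FG)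
    refine ⟨gens.image ρ ∪ Finset.univ.image fun j => awayFrac hg 1 (t j) (htI j), ?_⟩
    let T := Algebra.adjoin k ((gens.image ρ ∪
      Finset.univ.image fun j => awayFrac hg 1 (t j) (htI j) : Finset A) : Set A)
    have hR : ∀ r, ρ r ∈ T := by
      have : (⊤ : Subalgebra k R) ≤ T.comap ρ' := by
        rw [← hgens]
        refine Algebra.adjoin_le fun r hr => ?_
        exact Algebra.subset_adjoin (Finset.mem_coe.mpr (Finset.mem_union_left _
          (Finset.mem_image_of_mem ρ hr)))
      exact fun r => this trivial
    refine top_le_iff.mp fun b _ => ?_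
    exact awayFrac_mem_of_span_eq hg hI htI T.toSubring hR
      (fun j => Algebra.subset_adjoin (Finset.mem_coe.mpr (Finset.mem_union_right _
          (Finset.mem_image_of_mem _ (Finset.mem_univ j))))) b
  have hzA : AlgebraicIndependent k fun i => ρ' (z i) := hz.map' hρ
  let e : ULift.{u} (Fin n) ≃ Fin a ⊕ Fin c :=
    Equiv.ulift.trans ((finCongr hac.symm).trans finSumFinEquiv.symm)
  have hwe : fracAdjoin k (Set.range (w ∘ e)) = ⊤ := by
    rw [e.surjective.range_comp]
    exact hw
  refine ⟨_, isOpenImmersion_aeval_of_fracAdjoin_eq_top hzA hwe, ?_⟩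
  refine RingHom.ext fun r => ?_
  exact MvPolynomial.aeval_C (w ∘ e) r

/-- Every point of the blow-up of `(g(x), t)` over the origin of the coordinate system `x`, `t`
has a neighbourhood which is an open subscheme of affine space. -/
theorem exists_chart {k : Type u} [Field k] [Algebra k R] [IsDomain R]
    [Algebra.FiniteType k R] {n a c : ℕ} {z : Fin n → R} (hz : AlgebraicIndependent k z)
    (hac : a + c = n) {x : Fin a → R} {t : Fin c → R}
    (hxt : fracAdjoin k (Set.range (Sum.elim x t)) = ⊤) {g : MvPolynomial (Fin a) k}
    (hI : I = Ideal.span (insert (MvPolynomial.aeval x g) (Set.range t)))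
    (P : Ideal (reesAlgebra I)) [P.IsPrime]
    (hP : ∃ n, 0 < n ∧ ∃ y ∈ reesGrading I n, y ∉ P)
    (hx : ∀ i, algebraMap R (reesAlgebra I) (x i) ∈ P)
    (ht : ∀ i, algebraMap R (reesAlgebra I) (t i) ∈ P)
    (hg : c = 0 ∨ ∃ i, MvPolynomial.constantCoeff (MvPolynomial.pderiv i g) ≠ 0) :
    ∃ (γ : R) (hγ : γ ∈ I), reesVar hγ ∉ P ∧
      ∃ θ : MvPolynomial (ULift.{u} (Fin n)) k →+* Away (reesGrading I) (reesVar hγ),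
        IsOpenImmersion (Spec.map (CommRingCat.ofHom θ)) ∧
        θ.comp MvPolynomial.C = (awayStr (reesGrading I) (reesVar hγ)).comp (algebraMap k R) := by
  classical
  have hne : ∀ {γ : R} (hγ : γ ∈ I), reesVar hγ ∉ P → γ ≠ 0 := by
    rintro γ hγ h rfl
    refine h ?_
    have h1 : reesVar hγ = 0 := Subtype.ext (by simp [reesVar, reesMonomial])
    rw [h1]
    exact zero_mem _
  have hgI : MvPolynomial.aeval x g ∈ I := hI.ge (Ideal.subset_span (Set.mem_insert _ _))
  have htI : ∀ j, t j ∈ I := fun j =>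
    hI.ge (Ideal.subset_span (Set.mem_insert_of_mem _ ⟨j, rfl⟩))
  by_cases hgP : reesVar hgI ∈ P
  -- The degree one elements coming from the generators of `I` cannot all lie in `P`, since they
  -- generate the irrelevant ideal.
  · obtain ⟨j, hj⟩ : ∃ j, reesVar (htI j) ∉ P := by
      by_contra! hall
      have h1 : ∀ b (hb : b ∈ I), reesVar hb ∈ P := by
        intro b hb
        have hb' := hb
        rw [hI] at hb'
        induction hb' using Submodule.span_induction with
        | mem y hy =>
          rcases hy with rfl | ⟨j, rfl⟩
          · exact hgP
          · exact hall j
        | zero => by_contra h; exact hne hb h rfl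
        | add y z hy hz hy' hz' =>
          have e1 : y ∈ I := hI ▸ hy
          have e2 : z ∈ I := hI ▸ hz
          have := add_mem (hy' e1) (hz' e2)
          rwa [reesVar, reesVar, ← reesMonomial_add] at this
        | smul r y hy hy' =>
          have e1 : y ∈ I := hI ▸ hy
          have := P.mul_mem_left (algebraMap R (reesAlgebra I) r) (hy' e1)
          rwa [reesVar, algebraMap_mul_reesMonomial] at this
      obtain ⟨n, hn, y, hy, hyP⟩ := hP
      obtain ⟨n, rfl⟩ : ∃ m, n = m + 1 := ⟨n - 1, by omega⟩
      have h2 : ∀ b (hb : b ∈ I ^ (n + 1)), reesMonomial I (n + 1) b hb ∈ P := by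
        intro b hb
        have hb' := hb
        rw [pow_succ] at hb'
        induction hb' using Submodule.mul_induction_on' with
        | mem_mul_mem y hy z hz =>
          rw [reesMonomial_mul I hy (by rwa [pow_one])]
          exact P.mul_mem_left _ (h1 z hz)
        | add y hy z hz hy' hz' =>
          rw [← pow_succ] at hy hz
          rw [reesMonomial_add I _ hy hz]
          exact add_mem (hy' hy) (hz' hz)
      rw [eq_reesMonomial I hy] at hyP
      exact hyP (h2 _ _)
    obtain rfl | ⟨i, hi⟩ := hg
    · exact j.elim0
    obtain ⟨e, he, hxe⟩ := exists_aeval_update_eq (P.comap (algebraMap R (reesAlgebra I))) hx i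
      (ht j) g
    -- Shifting `x i` by `t j` changes `g(x)` by a multiple of `t j`: both the ideal and the
    -- generated algebra stay the same.
    set x' := Function.update x i (x i + t j) with hx'
    have hI' : I = Ideal.span (insert (MvPolynomial.aeval x' g) (Set.range t)) := by
      have htj : t j ∈ Ideal.span (Set.range t) := Ideal.subset_span ⟨j, rfl⟩
      rw [hI, Ideal.span_insert, Ideal.span_insert]
      refine le_antisymm (sup_le ?_ le_sup_right) (sup_le ?_ le_sup_right)
      · rw [Ideal.span_singleton_le_iff_mem, eq_sub_of_add_eq hxe.symm]
        exact sub_mem (Submodule.mem_sup_left (Ideal.mem_span_singleton_self _))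
          (Submodule.mem_sup_right (Ideal.mul_mem_right _ _ htj))
      · rw [Ideal.span_singleton_le_iff_mem, hxe]
        exact add_mem (Submodule.mem_sup_left (Ideal.mem_span_singleton_self _))
          (Submodule.mem_sup_right (Ideal.mul_mem_right _ _ htj))
    have hgI' : MvPolynomial.aeval x' g ∈ I := by
      rw [hxe]
      exact add_mem hgI (Ideal.mul_mem_right _ _ (htI j))
    have hxt' : fracAdjoin k (Set.range (Sum.elim x' t)) = ⊤ := by
      refine fracAdjoin_eq_top_of_subset hxt ?_
      have htj : ∀ j, t j ∈ fracAdjoin k (Set.range (Sum.elim x' t)) := fun j =>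
        subset_fracAdjoin _ ⟨Sum.inr j, rfl⟩
      have hxj : ∀ j, x' j ∈ fracAdjoin k (Set.range (Sum.elim x' t)) := fun j =>
        subset_fracAdjoin _ ⟨Sum.inl j, rfl⟩
      rintro _ ⟨l | l, rfl⟩
      · by_cases hl : l = i
        · subst hl
          have h1 := sub_mem (hxj l) (htj j)
          have h2 : x' l = x l + t j := Function.update_self ..
          rwa [h2, add_sub_cancel_right] at h1
        · have h2 : x' l = x l := Function.update_of_ne hl ..
          have h3 := hxj l
          rwa [h2] at h3
      · exact htj l
    have hgP' : reesVar hgI' ∉ P := by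
      intro h
      -- The first summand lies in `P`. In the second, the factor of `reesVar (htI j)` is a non-zero
      -- constant modulo `P`, so the sum is not in `P`.
      have h1 : reesVar hgI' = reesVar hgI + (algebraMap k (reesAlgebra I)
          (MvPolynomial.constantCoeff (MvPolynomial.pderiv i g)) +
            algebraMap R (reesAlgebra I) e) * reesVar (htI j) := by
        rw [IsScalarTower.algebraMap_apply k R (reesAlgebra I), ← map_add]
        simp only [reesVar]
        rw [algebraMap_mul_reesMonomial, ← reesMonomial_add]
        simp only [hxe, mul_comm]
      rw [h1] at h
      have h2 := (P.add_mem_iff_right hgP).mp h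
      have h3 := (Ideal.IsPrime.mem_or_mem ‹_› h2).resolve_right hj
      have h4 := (P.add_mem_iff_left he).mp h3
      exact ‹P.IsPrime›.ne_top (P.eq_top_of_isUnit_mem h4 ((IsUnit.mk0 _ hi).map _))
    exact ⟨_, hgI', hgP', exists_isOpenImmersion_away hz hac hxt' hI' hgI' (hne _ hgP')⟩
  · exact ⟨_, hgI, hgP, exists_isOpenImmersion_away hz hac hxt hI hgI (hne _ hgP)⟩

end Chart

end BlowUp

/-! ### Properness and irreducibility of Proj -/

namespace BlowUp

open HomogeneousIdeal

section

variable {R : Type u} [CommRing R] (I : Ideal R)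

theorem surjective_algebraMap_reesGrading_zero :
    Function.Surjective (algebraMap R (reesGrading I 0)) := by
  rintro ⟨y, hy⟩
  refine ⟨(y : Polynomial R).coeff 0, Subtype.ext ?_⟩
  refine Eq.trans ?_ (eq_reesMonomial I hy).symm
  rfl

end

section

variable {A S : Type u} [CommRing A] [CommRing S] [Algebra A S] (𝒜 : ℕ → Submodule A S)
  [GradedAlgebra 𝒜]

theorem isProper_projToSpec [Algebra.FiniteType A S]
    (h : Function.Surjective (algebraMap A (𝒜 0))) : IsProper (projToSpec 𝒜) := by
  have : IsScalarTower A (𝒜 0) S := ⟨fun a b c => smul_mul_assoc a (b : S) c⟩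
  have : Algebra.FiniteType (𝒜 0) S := Algebra.FiniteType.of_restrictScalars_finiteType A (𝒜 0) S
  have : IsClosedImmersion (Spec.map (CommRingCat.ofHom (algebraMap A (𝒜 0)))) :=
    IsClosedImmersion.spec_of_surjective (CommRingCat.ofHom (algebraMap A (𝒜 0))) h
  unfold projToSpec
  infer_instance

variable [IsDomain S]

theorem isReduced_proj : IsReduced (Proj 𝒜) := by
  refine @IsReduced.of_openCover _ (Proj.affineOpenCover 𝒜).openCover fun s => ?_
  change IsReduced (Spec (.of (HomogeneousLocalization.Away 𝒜 (s.2 : S))))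
  have : _root_.IsReduced (HomogeneousLocalization.Away 𝒜 (s.2 : S)) :=
    isReduced_of_injective (algebraMap (HomogeneousLocalization.Away 𝒜 (s.2 : S))
      (Localization.Away (s.2 : S))) (HomogeneousLocalization.val_injective _)
  infer_instance

theorem preirreducibleSpace_proj : PreirreducibleSpace (Proj 𝒜) := by
  by_cases h : irrelevant 𝒜 ≤ ⊥
  · have : IsEmpty (Proj 𝒜) := ⟨fun x => x.not_irrelevant_le (h.trans bot_le)⟩
    infer_instance
  -- The zero ideal is a generic point unless the irrelevant ideal vanishes, in which case Proj is
  -- empty.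
  · let η : Proj 𝒜 := ⟨⊥, Ideal.isPrime_bot, h⟩
    have hη : (Set.univ : Set (Proj 𝒜)) = closure {η} := by
      refine (Set.eq_univ_of_forall fun x => ?_).symm
      exact (ProjectiveSpectrum.le_iff_mem_closure 𝒜 η x).mp (bot_le (a := x.asHomogeneousIdeal))
    exact ⟨hη ▸ isIrreducible_singleton.closure.isPreirreducible⟩

theorem nonempty_proj {d : ℕ} (hd : 0 < d) {s : S} (hs : s ∈ 𝒜 d) (hs0 : s ≠ 0) :
    Nonempty (Proj 𝒜) := by
  refine ⟨⟨⊥, Ideal.isPrime_bot, fun h => hs0 ?_⟩⟩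
  exact h ((toIdeal_irrelevant_le _).mp le_rfl d hd hs)

end

end BlowUp

/-! ### The global blow-up: properness and integrality -/

namespace AlgebraicGeometry.Scheme.IdealSheafData

open AffineZariskiSite BlowUp Limits

variable {X : Scheme.{u}} (I : X.IdealSheafData)

/-- The open immersion of `Proj (⨁ I(U)ⁿ)` into the blow-up. -/
noncomputable def blowupι (U : X.AffineZariskiSite) :
    Proj (reesGrading (I.zariskiIdeal U)) ⟶ I.blowup :=
  I.blowupGlueData.cover.f U

instance (U : X.AffineZariskiSite) : IsOpenImmersion (I.blowupι U) := by
  exact I.blowupGlueData.cover.map_prop U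

theorem isPullback_blowupι (U : X.AffineZariskiSite) :
    IsPullback (I.blowupDiagramMap.app U) (I.blowupι U) U.1.ι I.blowupMap :=
  I.blowupGlueData.isPullback_natTrans_ι_toBase U

theorem blowupι_blowupMap (U : X.AffineZariskiSite) :
    I.blowupι U ≫ I.blowupMap = projToSpec (reesGrading (I.zariskiIdeal U)) ≫ U.2.fromSpec := by
  refine (I.isPullback_blowupι U).w.symm.trans ?_
  simp only [blowupDiagramMap, blowupDiagramToSpec, NatTrans.comp_app, restrictIsoSpec_inv_app]
  exact (Category.assoc _ _ _).trans (congrArg _ (IsAffineOpen.isoSpec_inv_ι _))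

theorem opensRange_blowupι (U : X.AffineZariskiSite) :
    (I.blowupι U).opensRange = I.blowupMap ⁻¹ᵁ U.1 := by
  have := I.blowupGlueData.toBase_preimage_eq_opensRange_ι U
  refine this.symm.trans ?_
  congr 1
  exact U.1.opensRange_ι

theorem exists_blowupι_eq (b : I.blowup) :
    ∃ (U : X.AffineZariskiSite) (y : Proj (reesGrading (I.zariskiIdeal U))), I.blowupι U y = b :=
  let ⟨y, hy⟩ := I.blowupGlueData.cover.covers b
  ⟨_, y, hy⟩

/-- Properness is local on the target. Over an affine open the map is the Proj of a Rees algebra,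
which is of finite type since the ring is noetherian, and whose degree zero part is the image of the
ring. -/
theorem isProper_blowupMap [IsLocallyNoetherian X] : IsProper I.blowupMap := by
  refine (IsZariskiLocalAtTarget.iff_of_openCover (P := @IsProper) (directedCover X)).mpr fun U => ?_
  have h1 := I.isPullback_blowupι U
  have h2 : IsProper (I.blowupDiagramMap.app U) := by
    have : IsNoetherianRing Γ(X, U.toOpens) := IsLocallyNoetherian.component_noetherian ⟨U.1, U.2⟩
    have : I.blowupDiagramMap.app U =
        projToSpec (reesGrading (I.zariskiIdeal U)) ≫ U.2.isoSpec.inv := by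
      simp only [blowupDiagramMap, blowupDiagramToSpec, NatTrans.comp_app, restrictIsoSpec_inv_app]
      rfl
    have h4 : IsProper (projToSpec (reesGrading (I.zariskiIdeal U))) :=
      isProper_projToSpec _ (surjective_algebraMap_reesGrading_zero _)
    rw [this]
    exact MorphismProperty.comp_mem @IsProper _ _ h4 (inferInstanceAs (IsProper U.2.isoSpec.inv))
  have h3 := (MorphismProperty.cancel_left_of_respectsIso @IsProper
    (h1.isoIsPullback _ _ (IsPullback.of_hasPullback I.blowupMap U.1.ι).flip).inv _).mpr h2
  exact (congrArg (fun f => IsProper f) (h1.isoIsPullback_inv_fst _ _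
    (IsPullback.of_hasPullback I.blowupMap U.1.ι).flip)).mp h3


theorem isReduced_blowup [IsIntegral X] : IsReduced I.blowup := by
  refine @IsReduced.of_openCover _ I.blowupGlueData.cover fun U => ?_
  change IsReduced (Proj (reesGrading (I.zariskiIdeal U)))
  rcases isEmpty_or_nonempty U.1 with hU | hU
  · refine @isReduced_of_isReduced_stalk _ fun y => ?_
    have hy : I.blowupMap (I.blowupι U y) ∈ U.1 :=
      (I.opensRange_blowupι U).le ⟨y, rfl⟩
    exact hU.elim ⟨_, hy⟩
  · have : IsDomain Γ(X, U.toOpens) := IsIntegral.component_integral U.1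
    exact isReduced_proj _

theorem nonempty_proj_zariskiIdeal [IsIntegral X] (U : X.AffineZariskiSite) [Nonempty U.1]
    (hU : I.zariskiIdeal U ≠ ⊥) : Nonempty (Proj (reesGrading (I.zariskiIdeal U))) := by
  have : IsDomain Γ(X, U.toOpens) := IsIntegral.component_integral U.1
  obtain ⟨a, ha, ha0⟩ := (Submodule.ne_bot_iff _).mp hU
  exact nonempty_proj _ one_pos (reesVar_mem ha) (reesVar_ne_zero ha ha0)

theorem irreducibleSpace_blowup [IsIntegral X]
    (hI : ∀ U : X.AffineZariskiSite, Nonempty U.1 → I.zariskiIdeal U ≠ ⊥) :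
    IrreducibleSpace I.blowup := by
  have hirr (U : X.AffineZariskiSite) (hU : Nonempty U.1) :
      IsIrreducible ((I.blowupι U).opensRange : Set I.blowup) := by
    have : IsDomain Γ(X, U.toOpens) := IsIntegral.component_integral U.1
    have h1 := I.nonempty_proj_zariskiIdeal U (hI U hU)
    have h2 := preirreducibleSpace_proj (reesGrading (I.zariskiIdeal U))
    have : IrreducibleSpace (Proj (reesGrading (I.zariskiIdeal U))) := { h2 with toNonempty := h1 }
    rw [Scheme.Hom.coe_opensRange, ← Set.image_univ]
    exact (IrreducibleSpace.isIrreducible_univ _).image _ (I.blowupι U).continuous.continuousOn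
  have hne (b : I.blowup) : ∃ U : X.AffineZariskiSite, Nonempty U.1 ∧ b ∈ (I.blowupι U).opensRange := by
    obtain ⟨U, y, rfl⟩ := I.exists_blowupι_eq b
    exact ⟨U, ⟨_, (I.opensRange_blowupι U).le ⟨y, rfl⟩⟩, y, rfl⟩
  have : Nonempty I.blowup := by
    obtain ⟨x⟩ : Nonempty X := inferInstance
    obtain ⟨U, hU, hxU, -⟩ := exists_isAffineOpen_mem_and_subset (U := ⊤) (x := x) trivial
    have hne : Nonempty (U : X.Opens) := ⟨⟨x, hxU⟩⟩
    obtain ⟨b, -⟩ := (hirr ⟨U, hU⟩ hne).1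
    exact ⟨b⟩
  have : PreirreducibleSpace I.blowup := by
    refine ⟨fun A B hA hB ⟨a, _, ha⟩ ⟨b, _, hb⟩ => ?_⟩
    obtain ⟨U, hU, haU⟩ := hne a
    obtain ⟨V, hV, hbV⟩ := hne b
    have hUV : ((U.1 : Set X) ∩ V.1).Nonempty :=
      nonempty_preirreducible_inter U.1.2 V.1.2
        ⟨_, hU.some.2⟩ ⟨_, hV.some.2⟩
    obtain ⟨x, hxU, hxV⟩ := hUV
    -- The pieces over `U` and `V` are irreducible and share the non-empty irreducible piece over a
    -- common basic open `W`; both given open sets meet it, and so meet each other.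
    obtain ⟨f, g, e, hxf⟩ := exists_basicOpen_le_affine_inter U.2 V.2 _ ⟨hxU, hxV⟩
    let W : X.AffineZariskiSite := U.basicOpen f
    have hW : Nonempty W.1 := ⟨⟨x, hxf⟩⟩
    have hWU : (I.blowupι W).opensRange ≤ (I.blowupι U).opensRange := by
      rw [opensRange_blowupι, opensRange_blowupι]
      exact Scheme.Hom.preimage_mono _ (X.basicOpen_le f)
    have hWV : (I.blowupι W).opensRange ≤ (I.blowupι V).opensRange := by
      rw [opensRange_blowupι, opensRange_blowupι]
      exact Scheme.Hom.preimage_mono _ (e.le.trans (X.basicOpen_le g))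
    obtain ⟨w, hw⟩ := (hirr W hW).1
    obtain ⟨a', ha'U, ha', ha'W⟩ := (hirr U hU).2 _ _ hA (I.blowupι W).opensRange.2
      ⟨a, haU, ha⟩ ⟨w, hWU hw, hw⟩
    obtain ⟨b', hb'U, hb', hb'W⟩ := (hirr V hV).2 _ _ hB (I.blowupι W).opensRange.2
      ⟨b, hbV, hb⟩ ⟨w, hWV hw, hw⟩
    obtain ⟨c, hcW, hc⟩ := (hirr W hW).2 _ _ hA hB ⟨a', ha'W, ha'⟩ ⟨b', hb'W, hb'⟩
    exact ⟨c, trivial, hc⟩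
  constructor
  infer_instance

theorem isIntegral_blowup [IsIntegral X]
    (hI : ∀ U : X.AffineZariskiSite, Nonempty U.1 → I.zariskiIdeal U ≠ ⊥) :
    IsIntegral I.blowup := by
  have := I.isReduced_blowup
  have := I.irreducibleSpace_blowup hI
  exact isIntegral_of_irreducibleSpace_of_isReduced _

/-- The kernel of a closed immersion into an integral scheme which is not an isomorphism is
non-zero on every non-empty affine open. -/
theorem ker_ideal_ne_bot [IsIntegral X] {Y : Scheme.{u}} (i : Y ⟶ X) [IsClosedImmersion i]
    (hi : ¬ IsIso i) (U : X.affineOpens) (hU : Nonempty U.1) : i.ker.ideal U ≠ ⊥ := by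
  intro h
  refine hi ?_
  -- On the integral scheme `X` the kernel vanishes once its support is everything. A zero ideal
  -- over `U` puts the dense set `U` inside the closed support.
  rw [IsClosedImmersion.isIso_iff_ker_eq_bot, ← support_eq_top_iff]
  have h1 : (U.1 : Set X) ⊆ i.ker.support := by
    have h2 := i.ker.coe_support_inter U
    rw [h] at h2
    refine fun x hx => (h2.ge ⟨?_, hx⟩).1
    simp [Scheme.mem_zeroLocus_iff]
  have h2 : closure (U.1 : Set X) = Set.univ :=
    (U.1.2.dense ⟨_, hU.some.2⟩).closure_eq
  have h3 := closure_minimal h1 i.ker.support.2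
  rw [h2] at h3
  exact top_le_iff.mp fun x _ => h3 trivial

end AlgebraicGeometry.Scheme.IdealSheafData

/-! ### Coordinates at closed points of opens in affine space -/

theorem bijective_localRingHom_of_isOpenImmersion {A B : Type u} [CommRing A] [CommRing B]
    (φ : A →+* B) [h : IsOpenImmersion (Spec.map (CommRingCat.ofHom φ))] (p : Ideal B)
    [hp : p.IsPrime] :
    Function.Bijective (Localization.localRingHom (p.comap φ) p φ rfl) := by
  let q : Spec (.of B) := ⟨p, hp⟩
  have h1 : IsIso ((Spec.map (CommRingCat.ofHom φ)).stalkMap q) := inferInstance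
  have h2 := ((MorphismProperty.isomorphisms CommRingCat).arrow_mk_iso_iff
    (Scheme.arrowStalkMapSpecIso (CommRingCat.ofHom φ) q)).mp h1
  have h3 : IsIso (CommRingCat.ofHom (Localization.localRingHom (p.comap φ) p φ rfl)) := h2
  exact ConcreteCategory.bijective_of_isIso
    (CommRingCat.ofHom (Localization.localRingHom (p.comap φ) p φ rfl))

section

open MvPolynomial IsLocalRing

variable {k R : Type u} [Field k] [CommRing R] [Algebra k R]

theorem exists_sub_algebraMap_mem [IsAlgClosed k] [Algebra.FiniteType k R] (m : Ideal R)
    [m.IsMaximal] (r : R) : ∃ c : k, r - algebraMap k R c ∈ m := by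
  let := Ideal.Quotient.field m
  have : Module.Finite k (R ⧸ m) := finite_of_finite_type_of_isJacobsonRing k (R ⧸ m)
  obtain ⟨c, hc⟩ := (IsAlgClosed.algebraMap_bijective_of_isIntegral (k := k) (K := R ⧸ m)).2
    (Ideal.Quotient.mk m r)
  exact ⟨c, Ideal.Quotient.eq.mp hc.symm⟩

theorem exists_sub_algebraMap_mem_maximalIdeal [IsAlgClosed k] [Algebra.FiniteType k R]
    (m : Ideal R) [m.IsMaximal] (O : Type u) [CommRing O] [IsLocalRing O] [Algebra R O]
    [Algebra k O] [IsScalarTower k R O] [IsLocalization.AtPrime O m] (y : O) :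
    ∃ c : k, y - algebraMap k O c ∈ maximalIdeal O := by
  obtain ⟨r, hr⟩ := (IsLocalization.AtPrime.equivQuotMaximalIdeal m O).surjective
    (Ideal.Quotient.mk _ y)
  obtain ⟨r, rfl⟩ := Ideal.Quotient.mk_surjective r
  rw [IsLocalization.AtPrime.equivQuotMaximalIdeal_apply_mk] at hr
  obtain ⟨c, hc⟩ := exists_sub_algebraMap_mem (k := k) m r
  refine ⟨c, ?_⟩
  have h1 : y - algebraMap R O r ∈ maximalIdeal O := Ideal.Quotient.eq.mp hr.symm
  have h2 : algebraMap R O (r - algebraMap k R c) ∈ maximalIdeal O :=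
    (IsLocalization.AtPrime.to_map_mem_maximal_iff O m _).mpr hc
  have h3 := add_mem h1 h2
  rwa [map_sub, ← IsScalarTower.algebraMap_apply, sub_add_sub_cancel] at h3

/-- The local ring of an open subscheme of affine space is generated by
algebraically independent elements of the maximal ideal, up to inverses of units. -/
theorem exists_coordinates_of_isOpenImmersion [IsAlgClosed k] [Algebra.FiniteType k R] [IsDomain R]
    {n : ℕ}
    (ψ : MvPolynomial (ULift.{u} (Fin n)) k →ₐ[k] R)
    [IsOpenImmersion (Spec.map (CommRingCat.ofHom ψ.toRingHom))] (m : Ideal R) [m.IsMaximal]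
    (O : Type u) [CommRing O] [IsLocalRing O] [IsDomain O] [Algebra R O]
    [Algebra k O] [IsScalarTower k R O] [IsLocalization.AtPrime O m] :
    ∃ z : Fin n → O, (∀ i, z i ∈ maximalIdeal O) ∧ fracAdjoin k (Set.range z) = ⊤ ∧
      AlgebraicIndependent k z := by
  let P := MvPolynomial (ULift.{u} (Fin n)) k
  have hb := bijective_localRingHom_of_isOpenImmersion ψ.toRingHom m
  let e : Localization.AtPrime m ≃ₐ[R] O := IsLocalization.algEquiv m.primeCompl _ _
  let w : Fin n → O := fun i => algebraMap R O (ψ (X ⟨i⟩))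
  let f : P →ₐ[k] O := (IsScalarTower.toAlgHom k R O).comp ψ
  have hfw : ∀ p : P, f p ∈ Algebra.adjoin k (Set.range w) := fun p => by
    have h1 : f = aeval fun i => w i.down := MvPolynomial.algHom_ext fun i => by
      rw [aeval_X]; rfl
    rw [h1, Algebra.adjoin_range_eq_range_aeval]
    refine ⟨rename ULift.down p, ?_⟩
    rw [AlgHom.toRingHom_eq_coe, RingHom.coe_coe, aeval_rename]
    rfl
  have hw : fracAdjoin k (Set.range w) = ⊤ := by
    refine top_le_iff.mp fun r _ => ?_
    obtain ⟨l, hl⟩ := hb.2 (e.symm r)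
    obtain ⟨p, ⟨q, hq⟩, rfl⟩ := IsLocalization.exists_mk'_eq
      (m.comap ψ.toRingHom).primeCompl l
    have hq' : IsUnit (algebraMap R O (ψ q)) :=
      IsLocalization.map_units (M := m.primeCompl) O ⟨ψ q, hq⟩
    refine mem_fracAdjoin_of_mul_mem (b := f q) (adjoin_le_fracAdjoin _ (hfw q)) hq' ?_
    have h1 : e.symm r * algebraMap R _ (ψ q) = algebraMap R _ (ψ p) := by
      rw [← hl]
      have h2 := congrArg (Localization.localRingHom (m.comap ψ.toRingHom) m ψ.toRingHom rfl)
        (IsLocalization.mk'_spec (Localization.AtPrime (m.comap ψ.toRingHom)) p ⟨q, hq⟩)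
      rw [map_mul, Localization.localRingHom_to_map, Localization.localRingHom_to_map] at h2
      exact h2
    have h2 : r * f q = f p := by
      have := congrArg e h1
      rwa [map_mul, AlgEquiv.apply_symm_apply, AlgEquiv.commutes, AlgEquiv.commutes] at this
    rw [h2]
    exact adjoin_le_fracAdjoin _ (hfw p)
  have hwa : AlgebraicIndependent k w := by
    have h1 : Function.Injective f := by
      have h2 : ∀ p, f p = e (Localization.localRingHom _ m ψ.toRingHom rfl
          (algebraMap P (Localization.AtPrime (m.comap ψ.toRingHom)) p)) := fun p => by
        rw [Localization.localRingHom_to_map, AlgEquiv.commutes]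
        rfl
      intro p q hpq
      rw [h2, h2] at hpq
      exact IsLocalization.injective _ (m.comap ψ.toRingHom).primeCompl_le_nonZeroDivisors
        (hb.1 (e.injective hpq))
    have h2 : (aeval w : MvPolynomial (Fin n) k →ₐ[k] O) = f.comp (rename ULift.up) :=
      MvPolynomial.algHom_ext fun i => by
        rw [aeval_X, AlgHom.comp_apply, rename_X]; rfl
    change Function.Injective (aeval w : MvPolynomial (Fin n) k →ₐ[k] O)
    rw [h2]
    exact h1.comp (rename_injective _ ULift.up_injective)
  -- The residue field is `k`, so the coordinates can be translated to vanish at the point.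
  choose c hc using fun i => exists_sub_algebraMap_mem_maximalIdeal (k := k) m O (w i)
  have hz : fracAdjoin k (Set.range fun i => w i - algebraMap k O (c i)) = ⊤ := by
    refine fracAdjoin_eq_top_of_subset hw ?_
    rintro _ ⟨i, rfl⟩
    have h1 := add_mem (subset_fracAdjoin (k := k) (Set.range fun i => w i - algebraMap k O (c i))
      ⟨i, rfl⟩) (Subalgebra.algebraMap_mem _ (c i))
    simpa using h1
  exact ⟨_, hc, hz, hwa.of_fracAdjoin_eq_top (Fintype.card_fin n) hz⟩

/-- On a neighbourhood of a point of an open subscheme of affine space, a smooth closed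
subscheme is given by an ideal `(g(x), t)`, where `x` and `t` are coordinates, and the
hypersurface `g = 0` is smooth at the given point. -/
theorem exists_coordinates_span_eq_away [IsAlgClosed k] [Algebra.FiniteType k R] [IsDomain R]
    {n : ℕ}
    (ψ : MvPolynomial (ULift.{u} (Fin n)) k →ₐ[k] R)
    [IsOpenImmersion (Spec.map (CommRingCat.ofHom ψ.toRingHom))] (m : Ideal R) [m.IsMaximal]
    (I : Ideal R) (hI0 : I ≠ ⊥) [Algebra.FormallySmooth k (R ⧸ I)] :
    ∃ s ∉ m, ∀ (R' : Type u) [CommRing R'] [Algebra R R'] [Algebra k R']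
      [IsScalarTower k R R'] [IsLocalization.Away s R'],
      ∃ (a c : ℕ) (z : Fin n → R') (x : Fin a → R') (t : Fin c → R') (g : MvPolynomial (Fin a) k),
        AlgebraicIndependent k z ∧ a + c = n ∧ fracAdjoin k (Set.range (Sum.elim x t)) = ⊤ ∧
        I.map (algebraMap R R') = Ideal.span (insert (aeval x g) (Set.range t)) ∧
        (c = 0 ∨ ∃ i, constantCoeff (pderiv i g) ≠ 0) ∧
        ∀ q : Ideal R', q.IsPrime → q.comap (algebraMap R R') = m →
          (∀ i, x i ∈ q) ∧ ∀ i, t i ∈ q := by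
  have : IsNoetherianRing R := Algebra.FiniteType.isNoetherianRing k R
  let O := Localization.AtPrime m
  have : IsDomain O := IsLocalization.isDomain_localization m.primeCompl_le_nonZeroDivisors
  have : IsNoetherianRing O := IsLocalization.isNoetherianRing m.primeCompl O inferInstance
  have hRO : Function.Injective (algebraMap R O) :=
    IsLocalization.injective _ m.primeCompl_le_nonZeroDivisors
  obtain ⟨z, hzM, hz, hza⟩ := exists_coordinates_of_isOpenImmersion ψ m O
  obtain ⟨a, c, x, t, g, hac, hx, ht, hxt, hI, hg⟩ : ∃ (a c : ℕ) (x : Fin a → O) (t : Fin c → O)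
      (g : MvPolynomial (Fin a) k), a + c = n ∧ (∀ i, x i ∈ maximalIdeal O) ∧
      (∀ i, t i ∈ maximalIdeal O) ∧
      fracAdjoin k (Set.range (Sum.elim x t)) = ⊤ ∧
      I.map (algebraMap R O) = Ideal.span (insert (aeval x g) (Set.range t)) ∧
      (c = 0 ∨ ∃ i, constantCoeff (pderiv i g) ≠ 0) := by
    by_cases hIm : I ≤ m
    · have hm : m.map (algebraMap R O) = maximalIdeal O := Localization.AtPrime.map_eq_maximalIdeal
      have h1 := map_inf_sq_le_mul_of_isLocalization (O := O) m.primeCompl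
        (inf_sq_le_mul_of_formallySmooth (k := k) hIm)
      rw [hm] at h1
      have hJ : I.map (algebraMap R O) ≤ maximalIdeal O := hm ▸ Ideal.map_mono hIm
      have hJ0 : I.map (algebraMap R O) ≠ ⊥ := fun h =>
        hI0 ((Ideal.map_eq_bot_iff_of_injective hRO).mp h)
      obtain ⟨a, c, x, t, g, hac, hx, hxt, hI, hg⟩ := exists_coordinates_span_eq (k := k)
        (exists_sub_algebraMap_mem_maximalIdeal m O) hzM hz hza hJ hJ0 h1
      exact ⟨a, c, x, t, g, hac, hx, fun i => hJ (hI.ge (Ideal.subset_span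
        (Set.mem_insert_of_mem _ ⟨i, rfl⟩))), hxt, hI, Or.inr hg⟩
    -- Away from the centre the ideal is the unit ideal, so `g = 1` with no `t` will do; this
    -- accounts for the alternative `c = 0`.
    · refine ⟨n, 0, z, Fin.elim0, 1, rfl, hzM, fun i => i.elim0, ?_, ?_, Or.inl rfl⟩
      · refine fracAdjoin_eq_top_of_subset hz ?_
        rintro _ ⟨i, rfl⟩
        exact subset_fracAdjoin _ ⟨Sum.inl i, rfl⟩
      · obtain ⟨b, hb, hbm⟩ := SetLike.not_le_iff_exists.mp hIm
        have h1 : I.map (algebraMap R O) = ⊤ := Ideal.eq_top_of_isUnit_mem _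
          (Ideal.mem_map_of_mem _ hb) (IsLocalization.map_units (M := m.primeCompl) O ⟨b, hbm⟩)
        rw [h1, eq_comm, Ideal.eq_top_iff_one]
        exact Ideal.subset_span (Set.mem_insert_iff.mpr (Or.inl (map_one _).symm))
  obtain ⟨s, hs, H⟩ := exists_coordinates_away m.primeCompl I x t g hxt hI
  refine ⟨s, hs, fun R' _ _ _ _ _ => ?_⟩
  have hle : Submonoid.powers s ≤ m.primeCompl := by
    rintro _ ⟨l, rfl⟩
    exact pow_mem hs l
  let := (IsLocalization.map (M := Submonoid.powers s) (T := m.primeCompl) (S := R') O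
    (RingHom.id R) hle).toAlgebra
  have hcomp : ∀ r, algebraMap R' O (algebraMap R R' r) = algebraMap R O r := fun r =>
    IsLocalization.map_eq hle r
  have : IsScalarTower R R' O := .of_algebraMap_eq fun r => (hcomp r).symm
  have : IsScalarTower k R' O := .of_algebraMap_eq fun r => by
    rw [IsScalarTower.algebraMap_apply k R R', hcomp, ← IsScalarTower.algebraMap_apply]
  have hinj : Function.Injective (algebraMap R' O) :=
    (injective_iff_map_eq_zero _).mpr fun y hy => by
      obtain ⟨r, d, rfl⟩ := IsLocalization.exists_mk'_eq (Submonoid.powers s) y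
      have h1 : algebraMap R O r = 0 := by
        rw [← hcomp, ← IsLocalization.mk'_spec R' r d, map_mul, hy, zero_mul]
      rw [hRO (h1.trans (map_zero _).symm), IsLocalization.mk'_zero]
  obtain ⟨x', t', hx', ht', hxt', hI'⟩ := H R' hinj
  have hRloc : ∀ q : Ideal R', q.IsPrime → q.comap (algebraMap R R') = m → ∀ y,
      algebraMap R' O y ∈ maximalIdeal O → y ∈ q := by
    intro q hq hqm y hy
    obtain ⟨r, d, rfl⟩ := IsLocalization.exists_mk'_eq (Submonoid.powers s) y
    have h1 : algebraMap R O r ∈ maximalIdeal O := by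
      rw [← hcomp, ← IsLocalization.mk'_spec R' r d, map_mul]
      exact Ideal.mul_mem_right _ _ hy
    rw [IsLocalization.AtPrime.to_map_mem_maximal_iff O m, ← hqm, Ideal.mem_comap,
      ← IsLocalization.mk'_spec R' r d] at h1
    exact (hq.mem_or_mem h1).resolve_right fun h =>
      hq.ne_top (Ideal.eq_top_of_isUnit_mem _ h (IsLocalization.map_units R' d))
  have hza' : AlgebraicIndependent k (Sum.elim x t) :=
    hza.of_fracAdjoin_eq_top (by simp [hac]) hxt
  have hza'' : AlgebraicIndependent k (Sum.elim x' t') := by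
    refine AlgebraicIndependent.of_comp (IsScalarTower.toAlgHom k R' O) ?_
    convert hza' using 1
    ext i
    rcases i with i | i
    · exact hx' i
    · exact ht' i
  let e : Fin n ≃ Fin a ⊕ Fin c := (finCongr hac.symm).trans finSumFinEquiv.symm
  exact ⟨a, c, _, x', t', g, hza''.comp e e.injective, hac, hxt', hI', hg,
    fun q hq hqm => ⟨fun i => hRloc q hq hqm _ ((hx' i).symm ▸ hx i),
      fun i => hRloc q hq hqm _ ((ht' i).symm ▸ ht i)⟩⟩

end

/-! ### The structure morphism of Proj on points -/

namespace BlowUp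

open HomogeneousLocalization

/-- This turns the vanishing of coordinates at the image point into membership in the homogeneous
prime, as `exists_chart` requires. -/
theorem mem_projToSpec_asIdeal {A S : Type u} [CommRing A] [CommRing S] [Algebra A S]
    (𝒜 : ℕ → Submodule A S) [GradedAlgebra 𝒜] (y : Proj 𝒜) (r : A) :
    r ∈ (projToSpec 𝒜 y).asIdeal ↔
      algebraMap A S r ∈ y.asHomogeneousIdeal.toIdeal := by
  obtain ⟨s, w, rfl⟩ : ∃ (s : Σ i : PNat, 𝒜 i) (w : _),
      Proj.awayι 𝒜 (s.2 : S) s.2.2 s.1.2 w = y :=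
    let ⟨w, hw⟩ := (Proj.affineOpenCover 𝒜).covers y
    ⟨_, w, hw⟩
  obtain ⟨⟨d, hd⟩, f, hf⟩ := s
  dsimp only at w hf ⊢
  have hfr : algebraMap A S r * f ∈ 𝒜 d := by
    rw [← Algebra.smul_def]
    exact Submodule.smul_mem _ _ hf
  set y := Proj.awayι 𝒜 f hf hd w with hy
  have h1 : projToSpec 𝒜 y = Spec.map (CommRingCat.ofHom (awayStr 𝒜 f)) w := by
    rw [← awayι_projToSpec f hf hd]
    rfl
  have h2 : r ∈ (projToSpec 𝒜 y).asIdeal ↔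
      awayStr 𝒜 f r ∈ w.asIdeal := by
    rw [h1]
    rfl
  have hfy : f ∉ y.asHomogeneousIdeal.toIdeal := by
    have : y ∈ Proj.basicOpen 𝒜 f := by
      rw [← Proj.opensRange_awayι 𝒜 f hf hd]
      exact ⟨w, rfl⟩
    exact this
  have h3 : algebraMap A S r * f ∈ y.asHomogeneousIdeal.toIdeal ↔
      Away.isLocalizationElem hf hfr ∈ w.asIdeal := by
    have := congrArg (fun U => w ∈ U) (Proj.awayι_preimage_basicOpen 𝒜 hf hd hfr hd)
    exact not_iff_not.mp this.to_iff
  -- As `f` and `r f` both have degree `d`, the element is `(r f) ^ d / f ^ d = r ^ d`.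
  have h4 : Away.isLocalizationElem hf hfr = awayStr 𝒜 f r ^ d := by
    ext
    rw [val_pow, val_awayStr, Away.val_mk, ← map_pow, ← Localization.mk_one_eq_algebraMap]
    refine Localization.mk_eq_mk_iff.mpr (Localization.r_of_eq ?_)
    simp [mul_pow, mul_comm]
  rw [h2, ← Ideal.IsPrime.pow_mem_iff_mem w.isPrime d hd, ← h4, ← h3]
  exact ⟨fun h => (y.isPrime.mem_or_mem h).resolve_right hfy,
    fun h => Ideal.mul_mem_right _ _ h⟩

end BlowUp

/-! ### Affine space charts on schemes over a field -/

namespace AlgebraicGeometry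

variable {k : Type u} [Field k] {X Y : Scheme.{u}}

/-- The structure morphism of the ring of sections over an affine open of a `k`-scheme. -/
noncomputable def IsAffineOpen.structureHom (s : X ⟶ Spec (.of k)) {W : X.Opens}
    (hW : IsAffineOpen W) : k →+* Γ(X, W) :=
  (Spec.preimage (hW.fromSpec ≫ s)).hom

theorem IsAffineOpen.SpecMap_structureHom (s : X ⟶ Spec (.of k)) {W : X.Opens}
    (hW : IsAffineOpen W) :
    Spec.map (CommRingCat.ofHom (hW.structureHom s)) = hW.fromSpec ≫ s :=
  Spec.map_preimage _

theorem IsAffineOpen.map_comp_structureHom (s : X ⟶ Spec (.of k)) {W V : X.Opens}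
    (hW : IsAffineOpen W) (hV : IsAffineOpen V) (h : V ⟶ W) :
    (X.presheaf.map h.op).hom.comp (hW.structureHom s) = hV.structureHom s := by
  have : CommRingCat.ofHom ((X.presheaf.map h.op).hom.comp (hW.structureHom s)) =
      CommRingCat.ofHom (hV.structureHom s) := by
    refine Spec.map_injective ?_
    rw [CommRingCat.ofHom_comp, Spec.map_comp, SpecMap_structureHom, SpecMap_structureHom,
      ← hW.map_fromSpec hV h.op, Category.assoc]
    rfl
  exact congrArg CommRingCat.Hom.hom this

theorem IsAffineOpen.finiteType_structureHom (s : X ⟶ Spec (.of k)) [LocallyOfFiniteType s]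
    {W : X.Opens} (hW : IsAffineOpen W) : (hW.structureHom s).FiniteType := by
  have : LocallyOfFiniteType (Spec.map (CommRingCat.ofHom (hW.structureHom s))) := by
    rw [SpecMap_structureHom]
    infer_instance
  exact (HasRingHomProperty.Spec_iff (P := @LocallyOfFiniteType)).mp this

theorem IsAffineOpen.formallySmooth_quotient_ker (s : X ⟶ Spec (.of k)) (i : Y ⟶ X)
    [IsClosedImmersion i] [Smooth (i ≫ s)] {W : X.Opens} (hW : IsAffineOpen W) :
    letI := (hW.structureHom s).toAlgebra
    Algebra.FormallySmooth k (Γ(X, W) ⧸ i.ker.ideal ⟨W, hW⟩) := by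
  let := (hW.structureHom s).toAlgebra
  have hV : IsAffineOpen (i ⁻¹ᵁ W) := hW.preimage i
  have h1 : Smooth (Spec.map (CommRingCat.ofHom ((i.app W).hom.comp (hW.structureHom s)))) := by
    have h2 : Spec.map (CommRingCat.ofHom ((i.app W).hom.comp (hW.structureHom s))) =
        hV.fromSpec ≫ i ≫ s := by
      rw [CommRingCat.ofHom_comp, Spec.map_comp, SpecMap_structureHom]
      have h3 := IsAffineOpen.SpecMap_appLE_fromSpec i hW hV le_rfl
      rw [← Scheme.Hom.app_eq_appLE] at h3
      rw [← Category.assoc, ← Category.assoc, ← h3]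
      rfl
    rw [h2]
    infer_instance
  have h2 : ((i.app W).hom.comp (hW.structureHom s)).Smooth :=
    (HasRingHomProperty.Spec_iff (P := @Smooth)).mp h1
  let := ((i.app W).hom.comp (hW.structureHom s)).toAlgebra
  have h3 : Algebra.Smooth k Γ(Y, i ⁻¹ᵁ W) := h2
  have hsurj : Function.Surjective (i.app W) :=
    (isClosedImmersion_iff_isAffineHom.mp ‹_›).2 W hW
  let f : Γ(X, W) →ₐ[k] Γ(Y, i ⁻¹ᵁ W) := { (i.app W).hom with commutes' := fun _ => rfl }
  have hker : i.ker.ideal ⟨W, hW⟩ = RingHom.ker f := i.ker_apply ⟨W, hW⟩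
  let e : (Γ(X, W) ⧸ i.ker.ideal ⟨W, hW⟩) ≃ₐ[k] Γ(Y, i ⁻¹ᵁ W) :=
    (Ideal.quotientEquivAlgOfEq k hker).trans (Ideal.quotientKerAlgEquivOfSurjective hsurj)
  exact Algebra.FormallySmooth.of_equiv e.symm

/-- A point of a `k`-scheme has a Zariski open neighbourhood which is isomorphic to an open
subscheme of affine `n`-space. -/
def HasAffineSpaceChart (n : ℕ) (s : X ⟶ Spec (.of k)) (x : X) : Prop :=
  ∃ U : X.Opens, x ∈ U ∧
    ∃ j : U.toScheme ⟶ 𝔸(ULift.{u} (Fin n); Spec (.of k)),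
      IsOpenImmersion j ∧ j ≫ (𝔸(ULift.{u} (Fin n); Spec (.of k)) ↘ Spec (.of k)) = U.ι ≫ s

theorem HasAffineSpaceChart.of_isOpenImmersion {n : ℕ} (s : X ⟶ Spec (.of k)) {A : CommRingCat.{u}}
    (f : Spec A ⟶ X) [IsOpenImmersion f]
    (θ : CommRingCat.of (MvPolynomial (ULift.{u} (Fin n)) k) ⟶ A) [IsOpenImmersion (Spec.map θ)]
    (h : Spec.map θ ≫ Spec.map (CommRingCat.ofHom MvPolynomial.C) = f ≫ s) (w : Spec A) :
    HasAffineSpaceChart n s (f w) := by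
  refine ⟨f.opensRange, ⟨w, rfl⟩, f.isoOpensRange.inv ≫ Spec.map θ ≫
    (AffineSpace.SpecIso (ULift.{u} (Fin n)) (.of k)).inv, inferInstance, ?_⟩
  rw [Category.assoc, Category.assoc, AffineSpace.SpecIso_inv_over, h,
    Scheme.Hom.isoOpensRange_inv_comp_assoc]

/-- If every closed point of a quasi-compact scheme has a chart, then so does every point. -/
theorem HasAffineSpaceChart.of_closedPoints [CompactSpace X] {n : ℕ} (s : X ⟶ Spec (.of k))
    (h : ∀ x : X, IsClosed {x} → HasAffineSpaceChart n s x) (x : X) :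
    HasAffineSpaceChart n s x := by
  let S : Set X := {x | HasAffineSpaceChart n s x}
  -- The points with a chart form an open set, and a non-empty closed complement would contain a
  -- closed point.
  have hS : IsOpen S := isOpen_iff_forall_mem_open.mpr fun x ⟨U, hxU, hU⟩ =>
    ⟨U, fun y hy => ⟨U, hy, hU⟩, U.2, hxU⟩
  by_contra hx
  obtain ⟨y, hy, hyc⟩ := hS.isClosed_compl.exists_closed_singleton ⟨x, hx⟩
  exact hy (h y hyc)

/-- Smoothness is local on the source and affine space is smooth, so the charts alone give
smoothness. -/
theorem smooth_of_hasAffineSpaceChart {n : ℕ} (s : X ⟶ Spec (.of k))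
    (h : ∀ x : X, HasAffineSpaceChart n s x) : Smooth s := by
  choose U hU j hj hjs using h
  have hA : Smooth (𝔸(ULift.{u} (Fin n); Spec (.of k)) ↘ Spec (.of k)) := by
    have h1 : Smooth (Spec.map (CommRingCat.ofHom
        (MvPolynomial.C : k →+* MvPolynomial (ULift.{u} (Fin n)) k))) := by
      refine (HasRingHomProperty.Spec_iff (P := @Smooth)).mpr ?_
      have h2 : (algebraMap k (MvPolynomial (ULift.{u} (Fin n)) k)).Smooth := by
        rw [RingHom.smooth_algebraMap]
        exact ⟨inferInstance, inferInstance⟩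
      exact h2
    have h2 := AffineSpace.SpecIso_inv_over (n := ULift.{u} (Fin n)) (.of k)
    rw [Iso.inv_comp_eq] at h2
    rw [h2]
    infer_instance
  have hcov : ⨆ x, U x = ⊤ := top_le_iff.mp fun x _ => TopologicalSpace.Opens.mem_iSup.mpr ⟨x, hU x⟩
  have : IsZariskiLocalAtSource (@Smooth.{u}) :=
    HasRingHomProperty.instIsZariskiLocalAtSource (Q := RingHom.Smooth)
  have key (x : X) : Smooth ((U x).ι ≫ s) := by
    rw [← hjs]
    have := hj x
    infer_instance
  exact (IsZariskiLocalAtSource.iff_of_openCover (P := @Smooth)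
    (X.openCoverOfIsOpenCover U hcov)).mpr fun x => key x

end AlgebraicGeometry

/-! ### Charts of the blow-up over closed points, and conclusion -/

namespace AlgebraicGeometry

open BlowUp Scheme

variable {k : Type u} [Field k] {X Y : Scheme.{u}}

/-- A morphism from an affine scheme over `k` to affine space is given by a homomorphism of
`k`-algebras. -/
theorem exists_algHom_of_isOpenImmersion {n : ℕ} {R : Type u} [CommRing R] [Algebra k R]
    (f : Spec (.of R) ⟶ 𝔸(ULift.{u} (Fin n); Spec (.of k))) [IsOpenImmersion f]
    (hf : f ≫ (𝔸(ULift.{u} (Fin n); Spec (.of k)) ↘ Spec (.of k)) =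
      Spec.map (CommRingCat.ofHom (algebraMap k R))) :
    ∃ ψ : MvPolynomial (ULift.{u} (Fin n)) k →ₐ[k] R,
      IsOpenImmersion (Spec.map (CommRingCat.ofHom ψ.toRingHom)) := by
  let F := f ≫ (AffineSpace.SpecIso (ULift.{u} (Fin n)) (.of k)).hom
  let χ := Spec.preimage F
  have hA : (AffineSpace.SpecIso (ULift.{u} (Fin n)) (.of k)).hom ≫
      Spec.map (CommRingCat.ofHom MvPolynomial.C) =
      𝔸(ULift.{u} (Fin n); Spec (.of k)) ↘ Spec (.of k) := by
    rw [← Iso.eq_inv_comp, AffineSpace.SpecIso_inv_over]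
  have hχ : χ.hom.comp MvPolynomial.C = algebraMap k R := by
    have h1 : CommRingCat.ofHom MvPolynomial.C ≫ χ = CommRingCat.ofHom (algebraMap k R) := by
      refine Spec.map_injective ?_
      rw [Spec.map_comp, Spec.map_preimage, ← hf, ← hA]
      exact Category.assoc _ _ _
    exact congrArg CommRingCat.Hom.hom h1
  refine ⟨{ χ.hom with commutes' := fun r => congr($hχ r) }, ?_⟩
  change IsOpenImmersion (Spec.map χ)
  rw [Spec.map_preimage]
  infer_instance

theorem IsAffineOpen.isMaximal_of_isClosed {W : X.Opens} (hW : IsAffineOpen W)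
    (p : PrimeSpectrum Γ(X, W)) (h : IsClosed {hW.fromSpec p}) : p.asIdeal.IsMaximal := by
  rw [← PrimeSpectrum.isClosed_singleton_iff_isMaximal]
  have h1 := h.preimage hW.fromSpec.continuous
  have h2 : hW.fromSpec ⁻¹' {hW.fromSpec p} = {p} := by
    ext q
    exact ⟨fun hq => hW.fromSpec.injective hq, fun hq => hq ▸ rfl⟩
  rwa [h2] at h1

theorem IsAffineOpen.exists_algHom_of_le {n : ℕ} (s : X ⟶ Spec (.of k)) {U W : X.Opens}
    (hW : IsAffineOpen W) (hWU : W ≤ U) (j : U.toScheme ⟶ 𝔸(ULift.{u} (Fin n); Spec (.of k)))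
    [IsOpenImmersion j]
    (hj : j ≫ (𝔸(ULift.{u} (Fin n); Spec (.of k)) ↘ Spec (.of k)) = U.ι ≫ s) :
    letI := (hW.structureHom s).toAlgebra
    ∃ ψ : MvPolynomial (ULift.{u} (Fin n)) k →ₐ[k] Γ(X, W),
      IsOpenImmersion (Spec.map (CommRingCat.ofHom ψ.toRingHom)) := by
  let := (hW.structureHom s).toAlgebra
  have : IsOpenImmersion (hW.isoSpec.inv ≫ X.homOfLE hWU ≫ j) := inferInstance
  refine exists_algHom_of_isOpenImmersion (hW.isoSpec.inv ≫ X.homOfLE hWU ≫ j) ?_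
  refine Eq.trans ?_ (hW.SpecMap_structureHom s).symm
  rw [← IsAffineOpen.isoSpec_inv_ι]
  simp only [Category.assoc, hj, Scheme.homOfLE_ι_assoc]

/-- Near a closed point, a smooth closed subscheme of an open subscheme of affine space is given
by an ideal `(g(x), t)`, where `x` and `t` are coordinates which vanish at the given point. -/
theorem exists_coordinates_ker [IsAlgClosed k] [IsIntegral X] (s : X ⟶ Spec (.of k))
    [LocallyOfFiniteType s] (i : Y ⟶ X) [IsClosedImmersion i] [Smooth (i ≫ s)] (hi : ¬ IsIso i)
    {n : ℕ} (b : X) (hb : IsClosed {b}) (hs : HasAffineSpaceChart n s b) :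
    ∃ V : X.AffineZariskiSite, b ∈ V.1 ∧ letI := (V.2.structureHom s).toAlgebra
      ∃ (a c : ℕ) (z : Fin n → Γ(X, V.toOpens)) (x : Fin a → Γ(X, V.toOpens))
        (t : Fin c → Γ(X, V.toOpens)) (g : MvPolynomial (Fin a) k),
        AlgebraicIndependent k z ∧ a + c = n ∧ fracAdjoin k (Set.range (Sum.elim x t)) = ⊤ ∧
        i.ker.zariskiIdeal V = Ideal.span (insert (MvPolynomial.aeval x g) (Set.range t)) ∧
        (c = 0 ∨ ∃ i, MvPolynomial.constantCoeff (MvPolynomial.pderiv i g) ≠ 0) ∧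
        ∀ q : PrimeSpectrum Γ(X, V.toOpens), V.2.fromSpec q = b →
          (∀ i, x i ∈ q.asIdeal) ∧ ∀ i, t i ∈ q.asIdeal := by
  obtain ⟨U, hbU, j, hj, hjs⟩ := hs
  obtain ⟨W, hW, hbW, hWU⟩ := exists_isAffineOpen_mem_and_subset hbU
  have : Nonempty W := ⟨⟨b, hbW⟩⟩
  let : Algebra k Γ(X, W) := (hW.structureHom s).toAlgebra
  have : Algebra.FiniteType k Γ(X, W) := hW.finiteType_structureHom s
  have : Algebra.FormallySmooth k (Γ(X, W) ⧸ i.ker.ideal ⟨W, hW⟩) :=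
    hW.formallySmooth_quotient_ker s i
  have hI0 : i.ker.ideal ⟨W, hW⟩ ≠ ⊥ := IdealSheafData.ker_ideal_ne_bot i hi ⟨W, hW⟩ ‹_›
  obtain ⟨ψ, hψ⟩ := hW.exists_algHom_of_le s hWU j hjs
  let p : PrimeSpectrum Γ(X, W) := hW.primeIdealOf ⟨b, hbW⟩
  have hp : hW.fromSpec p = b := hW.fromSpec_primeIdealOf ⟨b, hbW⟩
  have hm : p.asIdeal.IsMaximal := hW.isMaximal_of_isClosed p (hp.symm ▸ hb)
  obtain ⟨r, hr, H⟩ := exists_coordinates_span_eq_away ψ p.asIdeal _ hI0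
  let V : X.AffineZariskiSite := ⟨X.basicOpen r, hW.basicOpen r⟩
  let h : V.1 ⟶ W := homOfLE (X.basicOpen_le r)
  let : Algebra k Γ(X, V.1) := (V.2.structureHom s).toAlgebra
  let : Algebra Γ(X, W) Γ(X, V.1) := (X.presheaf.map h.op).hom.toAlgebra
  have : IsScalarTower k Γ(X, W) Γ(X, V.1) :=
    .of_algebraMap_eq' (hW.map_comp_structureHom s V.2 h).symm
  have : IsLocalization.Away r Γ(X, V.1) := hW.isLocalization_of_eq_basicOpen r h rfl
  obtain ⟨a, c, z, x, t, g, hz, hac, hxt, hI, hg, hq⟩ := H Γ(X, V.1)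
  refine ⟨V, ?_, a, c, z, x, t, g, hz, hac, hxt,
    (i.ker.map_ideal' (U := ⟨V.1, V.2⟩) (V := ⟨W, hW⟩) h.op).symm.trans hI, hg, fun q hqb => ?_⟩
  · have h1 : p ∈ PrimeSpectrum.basicOpen r := hr
    have h2 : p ∈ hW.fromSpec ⁻¹ᵁ X.basicOpen r := hW.fromSpec_preimage_basicOpen r ▸ h1
    exact hp ▸ h2
  · refine hq q.asIdeal q.isPrime ?_
    have h2 : Spec.map (X.presheaf.map h.op) q = p := by
      apply hW.fromSpec.injective
      refine Eq.trans ?_ (hqb.trans hp.symm)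
      exact congr($(hW.map_fromSpec V.2 h.op) q)
    exact congrArg PrimeSpectrum.asIdeal h2

/-- Near the image point the centre is `(g(x), t)` with coordinates vanishing there, so
`exists_chart` yields a chart of Proj containing the given point; composing with `blowupι` makes it
a chart of the blow-up. -/
theorem hasAffineSpaceChart_blowup [IsAlgClosed k] [IsIntegral X] (s : X ⟶ Spec (.of k))
    [LocallyOfFiniteType s] (i : Y ⟶ X) [IsClosedImmersion i] [Smooth (i ≫ s)] (hi : ¬ IsIso i)
    {n : ℕ} (b : i.ker.blowup) (hx : IsClosed {i.ker.blowupMap b})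
    (hs : HasAffineSpaceChart n s (i.ker.blowupMap b)) :
    HasAffineSpaceChart n (i.ker.blowupMap ≫ s) b := by
  obtain ⟨V, hbV, a, c, z, x, t, g, hz, hac, hxt, hI, hg, hq⟩ :=
    exists_coordinates_ker s i hi _ hx hs
  have : Nonempty V.1 := ⟨⟨_, hbV⟩⟩
  let : Algebra k Γ(X, V.toOpens) := (V.2.structureHom s).toAlgebra
  have : Algebra.FiniteType k Γ(X, V.toOpens) := V.2.finiteType_structureHom s
  have : IsDomain Γ(X, V.toOpens) := IsIntegral.component_integral V.1
  obtain ⟨y, hy⟩ : b ∈ (i.ker.blowupι V).opensRange := by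
    rw [IdealSheafData.opensRange_blowupι]
    exact hbV
  have hqP := hq (projToSpec (reesGrading (i.ker.zariskiIdeal V)) y) (by
    rw [← hy, ← Scheme.Hom.comp_apply, ← Scheme.Hom.comp_apply,
      IdealSheafData.blowupι_blowupMap])
  have hirr : ∃ n, 0 < n ∧ ∃ f ∈ reesGrading (i.ker.zariskiIdeal V) n,
      f ∉ y.asHomogeneousIdeal.toIdeal := by
    by_contra! hall
    exact y.not_irrelevant_le ((HomogeneousIdeal.toIdeal_irrelevant_le _).mpr
      fun n hn f hf => hall n hn f hf)
  have hPp : y.asHomogeneousIdeal.toIdeal.IsPrime := y.isPrime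
  obtain ⟨γ, hγ, hγP, θ, hθ, hθC⟩ := exists_chart hz hac hxt hI _ hirr
    (fun i => (mem_projToSpec_asIdeal _ y _).mp (hqP.1 i))
    (fun i => (mem_projToSpec_asIdeal _ y _).mp (hqP.2 i)) hg
  obtain ⟨w, hw⟩ : y ∈ (Proj.awayι _ _ (reesVar_mem hγ) one_pos).opensRange := by
    rw [Proj.opensRange_awayι]
    exact hγP
  let f := Proj.awayι _ _ (reesVar_mem hγ) one_pos ≫ i.ker.blowupι V
  have hfw : f w = b := by
    rw [← hy, ← hw]
    rfl
  rw [← hfw]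
  refine HasAffineSpaceChart.of_isOpenImmersion _ f (CommRingCat.ofHom θ) ?_ w
  rw [← Spec.map_comp, ← CommRingCat.ofHom_comp, hθC, CommRingCat.ofHom_comp, Spec.map_comp,
    ← awayι_projToSpec _ (reesVar_mem hγ) one_pos]
  have h1 := V.2.SpecMap_structureHom s
  have h2 := i.ker.blowupι_blowupMap V
  refine (congrArg _ h1).trans ?_
  rw [Category.assoc, ← reassoc_of% h2]
  exact (Category.assoc _ _ _).symm

end AlgebraicGeometry

theorem proposition2p4 {k : Type u} [Field k] [IsAlgClosed k] {X Y : Scheme.{u}}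
    (s : X ⟶ Spec (.of k)) (hX : IsUniformlyRational s)
    (i : Y ⟶ X) (hi : IsClosedImmersion i) (hY : Smooth (i ≫ s)) (hYX : ¬ IsIso i) :
    IsUniformlyRational (i.ker.blowupMap ≫ s) := by
  have := hX.isIntegral
  have := hX.isSeparated
  have := hX.locallyOfFiniteType
  have := hX.quasiCompact
  have : IsLocallyNoetherian X := LocallyOfFiniteType.isLocallyNoetherian s
  have := i.ker.isProper_blowupMap
  have hV : IsVariety (i.ker.blowupMap ≫ s) :=
    { isIntegral := i.ker.isIntegral_blowup fun U hU =>
        Scheme.IdealSheafData.ker_ideal_ne_bot i hYX ⟨U.1, U.2⟩ hU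
      isSeparated := inferInstance
      locallyOfFiniteType := inferInstance
      quasiCompact := inferInstance }
  have : CompactSpace i.ker.blowup :=
    have := hV.quasiCompact
    QuasiCompact.compactSpace_of_compactSpace (i.ker.blowupMap ≫ s)
  obtain ⟨n, hn⟩ := hX.exists_nhd
  have hn' : ∀ b, HasAffineSpaceChart n (i.ker.blowupMap ≫ s) b :=
    HasAffineSpaceChart.of_closedPoints _ fun b hb => by
      refine hasAffineSpaceChart_blowup s i hYX b ?_ (hn _)
      -- The blow-down map is proper, hence closed, and so maps closed points to closed points.
      have := i.ker.blowupMap.isClosedMap _ hb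
      rwa [Set.image_singleton] at this
  exact { hV with
    smooth := smooth_of_hasAffineSpaceChart _ hn'
    exists_nhd := ⟨n, hn'⟩ }
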